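/- **Notation.** $\mathbb D\subset\mathbb R^2$ is the closed unit disc and $\omega=dx\wedge dy$. A *conservative* map is a $C^2$-embedding $F:\mathbb D\to\mathbb R^2$ with $F^*\omega=\omega$ (in particular, any $C^2$ area-preserving diffeomorphism of $\mathbb D$). Let $\Lambda_F$ be the set of points all of whose forward iterates stay in $\mathbb D$ ($\Lambda_F=\mathbb D$ if $F(\mathbb D)\subset\mathbb D$). For $x\in\Lambda_F$ let $\lambda(x)=\limsup_{n\to\infty}\frac1n\log\|DF^n(x)\|$ be the maximal Lyapunov exponent, and let $h_\omega(F)=\int_{\Lambda_F}\lambda\,d\omega$ be the metric entropy. For a hyperbolic periodic point $P$ of $F$ (eigenvalues of $DF^k(P)$, $k$ a period, off the unit circle), $W^s(P;F)$ and $W^u(P;F)$ are its stable and unstable manifolds. A *heteroclinic link* is a topologically embedded circle $L$, invariant under an iterate of $F$, containing finitely many hyperbolic periodic points and contained in the union of their stable and unstable manifolds. For hyperbolic fixed points $P\ne Q$, a *heteroclinic bi-link* defined by $W^u(P;F)\cup W^s(Q;F)$ is an $F$-invariant embedded circle $L\ni P,Q$ with $L\subset W^u(P;F)\cup W^s(Q;F)$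 (it is the union of two arcs $L^a,L^b$ joining $P$ to $Q$). A *stochastic island* is a domain (open connected set) $\mathcal I\subset\Lambda_F$ whose boundary is a finite union of heteroclinic links and all of whose points have positive maximal Lyapunov exponent. **The map $\check F$.** Let $A=\begin{pmatrix}13&8\\8&5\end{pmatrix}$, acting on $\mathbb T^2=\mathbb R^2/\mathbb Z^2$, let $\sigma=\ln(9+4\sqrt5)$, and let $\Omega_0=(0,0)$, $\Omega_1=(\frac12,\frac12)$, $\Omega_2=(\frac12,0)$, $\Omega_3=(0,\frac12)$. Near $\Omega_i$ use polar coordinates $(\rho,\theta)$, $(u,v)=(\sqrt{2\rho}\cos\theta,\sqrt{2\rho}\sin\theta)$, where $(u,v)$ are the coordinates centred at $\Omega_i$ in a positively oriented orthonormal frame of (unstable, stable) eigenvectors of $A$. Let $0<\delta<\varepsilon<\frac14$, let $V_i\subset V_i'$ be the closed discs of radii $\delta,\varepsilon$ about $\Omega_i$, and let $\psi:[\frac{\delta^2}2,\frac{\varepsilon^2}2]\to[0,\frac{\varepsilon^2}2]$ be a $C^\infty$-diffeomorphism with $\psi(\rho)=\rho-\frac{\delta^2}2$ near $\frac{\delta^2}2$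 and $\psi(\rho)=\rho$ near $\frac{\varepsilon^2}2$. Let $\Psi$ be $(\rho,\theta)\mapsto(\psi(\rho),\theta)$ on each $V_i'\setminus V_i$ and the identity off $\bigcup_i V_i'$. Let $\hat F=\Psi^{-1}\circ A\circ\Psi$ on $\mathbb T^2\setminus\bigcup_i V_i$ and, on each $V_i$, let $\hat F$ be the time-$\sigma$ map of the Hamiltonian flow of $(\rho-\frac{\delta^2}2)\sin(2\theta)\,\xi(\rho)$, where $\xi$ is $C^\infty$, zero near $\rho=0$ and $1$ for $\rho\ge\frac{\delta^2}2$. Let $\hat\omega=\Psi^*\omega$ off $\bigcup_i V_i$ and $\hat\omega=\omega$ on $\bigcup_i V_i$. Let $p:\mathbb T^2\setminus\{\Omega_0\}\to\mathbb R^2$ realize the quotient by $-\mathrm{id}$, as a sphere with $\Omega_0$ sent to $\infty$ (e.g. a Weierstrass function): $p$ is continuous and onto, its fibres are the pairs $\{z,-z\}$, it is a $C^\infty$ local diffeomorphism away from $\Omega_1,\Omega_2,\Omega_3$, and $|p(z)|\to\infty$ as $z\to\Omega_0$. Let $\beta\,dx\wedge dy$ be a $C^\infty$ nowhere vanishing form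 on $\mathbb R^2$ whose pull-back by $p$ is $\hat\omega$ outside small discs about the $\Omega_i$ on which $\xi(\rho)=0$. Let $\kappa>0$ and $\Phi(z)=\kappa\,\bigl(x,\int_0^y\beta(x,s)\,ds\bigr)$ with $(x,y)=p(z)$. Then $\check F$ is the map equal to $\Phi\circ\hat F\circ\Phi^{-1}$ on the image of $\Phi$ and to the identity elsewhere, $\kappa$ being such that $\check F=\mathrm{id}$ outside $\mathbb D$. For $0\le i\le3$ let $\check L_i=\Phi(\partial V_i)$, $\check Q_i=\Phi(\{\rho=\frac{\delta^2}2,\theta=0\})$ and $\check P_i=\Phi(\{\rho=\frac{\delta^2}2,\theta=\frac\pi2\})$ in the polar coordinates at $\Omega_i$; each $\check L_i$ is a smooth circle, parametrized by $\theta\in\mathbb R/\pi\mathbb Z$. **Proposition 2.1.** For every map $\check F$ so constructed there is $\eta>0$ with the following property. Let $F$ be a conservative map that is $\eta$-close to $\check F$ in the $C^2$-topology on $\mathbb D$, and let $P_i,Q_i$ ($0\le i\le3$) be the hyperbolic continuations of $\check P_i,\check Q_i$, i.e. hyperbolic fixed points of $F$ that are $\eta$-close to $\check P_i,\check Q_i$.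 Suppose that $W^u(P_i;F)\cup W^s(Q_i;F)$ define four heteroclinic bi-links $L_i$ which are $\eta$-close, as $C^2$ closed curves, to $\check L_i$. Then $L_0,L_1,L_2,L_3$ bound a stochastic island of $F$ (there is a stochastic island $\mathcal I$ with $\partial\mathcal I=\bigcup_i L_i$). In particular, $h_\omega(F)>0$. -/

import Mathlib

open scoped ContDiff Topology

noncomputable section

namespace StochasticIsland

/-- The Euclidean plane; maps of the torus `ℝ² / ℤ²` are represented by lifts to the plane. -/
abbrev Plane := EuclideanSpace ℝ (Fin 2)

/-- The closed unit disc. -/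
def disc : Set Plane := Metric.closedBall 0 1

/-! ### The linear Anosov map and its eigenframe -/

/-- The linear map with matrix `(13 8; 8 5)`. -/
def anosov (z : Plane) : Plane := !₂[13 * z 0 + 8 * z 1, 8 * z 0 + 5 * z 1]

/-- The logarithm of the unstable eigenvalue. -/
def sigma : ℝ := Real.log (9 + 4 * Real.sqrt 5)

/-- The slope of the unstable eigendirection. -/
def unstableSlope : ℝ := (Real.sqrt 5 - 1) / 2

/-- Unit eigenvector for the eigenvalue `exp sigma`. -/
def eU : Plane := (Real.sqrt (1 + unstableSlope ^ 2))⁻¹ • !₂[1, unstableSlope]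

/-- Unit eigenvector for the eigenvalue `exp (-sigma)`; `(eU, eS)` is a positively oriented
orthonormal frame, so its coordinates are symplectic. -/
def eS : Plane := (Real.sqrt (1 + unstableSlope ^ 2))⁻¹ • !₂[-unstableSlope, 1]

/-- The point with angular coordinate `t` on the unit circle, in the frame `(eU, eS)`. -/
def eAngle (t : ℝ) : Plane := Real.cos t • eU + Real.sin t • eS

/-- The lattice `ℤ²`. -/
def lattice : Set Plane := {z | ∃ m n : ℤ, z = !₂[(m : ℝ), (n : ℝ)]}

/-- The lifts of the four points of the torus that are fixed by `-id`. -/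
def halfLattice : Set Plane := {z | (2 : ℝ) • z ∈ lattice}

/-- The four points of the torus that are fixed by `-id` (all are fixed by the Anosov map). -/
def Omega : Fin 4 → Plane := ![!₂[0, 0], !₂[1 / 2, 1 / 2], !₂[1 / 2, 0], !₂[0, 1 / 2]]

/-- A point of `halfLattice` nearest to `z`. -/
def center (z : Plane) : Plane := !₂[(round (2 * z 0) : ℝ) / 2, (round (2 * z 1) : ℝ) / 2]

/-- The symplectic radial coordinate `ρ = |z|² / 2`. -/
def rho (z : Plane) : ℝ := ‖z‖ ^ 2 / 2

/-! ### The blown-up map of the torus -/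

/-- The (lift of the) torus without the closed discs of radius `δ` about the four points. -/
def hatIsland (δ : ℝ) : Set Plane := {z | δ < ‖z - center z‖}

/-- The blow-down map: near each of the four points it is `(ρ, θ) ↦ (ψ ρ, θ)` in symplectic polar
coordinates, for `δ ≤ radius ≤ ε`, and it is the identity outside the discs of radius `ε`. -/
def blowDown (ε : ℝ) (ψ : ℝ → ℝ) (z : Plane) : Plane :=
  open Classical in
  if ‖z - center z‖ ≤ ε then
    center z + Real.sqrt (ψ (rho (z - center z)) / rho (z - center z)) • (z - center z)
  else z

/-- The Hamiltonian `(ρ - δ² / 2) sin (2θ) ξ(ρ)`, where `ρ sin (2θ) = u v` for the coordinates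
`(u, v)` in the frame `(eU, eS)`. -/
def hamiltonian (δ : ℝ) (ξ : ℝ → ℝ) (z : Plane) : ℝ :=
  (1 - δ ^ 2 / ‖z‖ ^ 2) * (inner ℝ eU z * inner ℝ eS z) * ξ (rho z)

/-- The Hamiltonian vector field `(∂_y H, -∂_x H)`. -/
def hamField (H : Plane → ℝ) (z : Plane) : Plane :=
  !₂[fderiv ℝ H z !₂[0, 1], -fderiv ℝ H z !₂[1, 0]]

/-- The time-`T` map of a vector field (the identity at points without a global trajectory). -/
def timeMap (X : Plane → Plane) (T : ℝ) (z : Plane) : Plane :=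
  open Classical in
  if h : ∃ γ : ℝ → Plane, γ 0 = z ∧ ∀ t, HasDerivAt γ (X (γ t)) t then h.choose T else z

/-- The blown-up map: conjugate by `blowDown` to the Anosov map outside the `δ`-discs, and the
time-`sigma` map of the Hamiltonian flow inside them. -/
def hatMap (δ ε : ℝ) (ψ ξ : ℝ → ℝ) (z : Plane) : Plane :=
  open Classical in
  if z ∈ hatIsland δ then
    Function.invFunOn (blowDown ε ψ) (hatIsland δ) (anosov (blowDown ε ψ z))
  else anosov (center z) + timeMap (hamField (hamiltonian δ ξ)) sigma (z - center z)

/-- The density of the area form preserved by the blown-up map: the pull-back of `dx ∧ dy` by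
`blowDown` outside the `δ`-discs, and `dx ∧ dy` inside them. -/
def hatDensity (δ ε : ℝ) (ψ : ℝ → ℝ) (z : Plane) : ℝ :=
  open Classical in
  if z ∈ hatIsland δ then (fderiv ℝ (blowDown ε ψ) z).det else 1

/-! ### From the torus to the disc -/

/-- `p` realizes the quotient of the torus by `-id` as a sphere, the image of `Omega 0` being the
point at infinity of the plane: smooth and locally diffeomorphic away from the four fixed points
of `-id`, with fibres `{z, -z}`, and continuous at these points. (The values of `p` on `lattice`
play no role.) An example is the Weierstrass elliptic function. -/
structure IsSphereQuotient (p : Plane → Plane) : Prop where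
  fiber : ∀ z ∉ lattice, ∀ w ∉ lattice, p z = p w ↔ (z - w ∈ lattice ∨ z + w ∈ lattice)
  surj : ∀ q, ∃ z ∉ lattice, p z = q
  smooth : ContDiffOn ℝ ∞ p halfLatticeᶜ
  immersive : ∀ z ∉ halfLattice, (fderiv ℝ p z).det ≠ 0
  cont : ContinuousOn p latticeᶜ
  infinity : Filter.Tendsto (fun z => ‖p z‖) (𝓝[≠] 0) Filter.atTop

/-- The change of coordinates `(x, y) ↦ κ (x, ∫₀^y β(x, s) ds)`. -/
def straighten (κ : ℝ) (β : Plane → ℝ) (q : Plane) : Plane :=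
  κ • !₂[q 0, ∫ s in (0 : ℝ)..(q 1), β !₂[q 0, s]]

/-- The push-forward of the blown-up map to the plane, extended by the identity. -/
def checkMap (δ ε : ℝ) (ψ ξ : ℝ → ℝ) (p : Plane → Plane) (κ : ℝ) (β : Plane → ℝ)
    (x : Plane) : Plane :=
  open Classical in
  if h : ∃ z, z ∉ lattice ∧ straighten κ β (p z) = x then
    straighten κ β (p (hatMap δ ε ψ ξ h.choose))
  else x

/-- The choices made in the construction of the disc map. -/
structure Choices where
  /-- radius of the discs that replace the four points -/
  δ : ℝ
  /-- radius of the discs outside which the torus map is not changed -/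
  ε : ℝ
  δ_pos : 0 < δ
  δ_lt : δ < ε
  /-- the closed `ε`-discs about the four points are disjoint -/
  ε_lt : ε < 1 / 4
  /-- radial profile of the blow-down map, a diffeomorphism from `[δ²/2, ε²/2]` to `[0, ε²/2]` -/
  ψ : ℝ → ℝ
  ψ_smooth : ContDiff ℝ ∞ ψ
  ψ_deriv : ∀ s ∈ Set.Icc (δ ^ 2 / 2) (ε ^ 2 / 2), 0 < deriv ψ s
  ψ_inner : ∀ᶠ s in 𝓝 (δ ^ 2 / 2), ψ s = s - δ ^ 2 / 2
  ψ_outer : ∀ᶠ s in 𝓝 (ε ^ 2 / 2), ψ s = s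
  /-- cut-off in the Hamiltonian inside the `δ`-discs -/
  ξ : ℝ → ℝ
  ξ_smooth : ContDiff ℝ ∞ ξ
  ξ_one : ∀ s, δ ^ 2 / 2 ≤ s → ξ s = 1
  /-- radius of discs about the four points on which the cut-off vanishes (so the blown-up map of
  the torus is the identity there) and near whose centres the area form is modified -/
  r : ℝ
  r_pos : 0 < r
  r_lt : r < δ
  ξ_zero : ∀ s ∈ Set.Icc 0 (r ^ 2 / 2), ξ s = 0
  /-- realization of the quotient of the torus by `-id` -/
  p : Plane → Plane
  p_quotient : IsSphereQuotient p
  /-- density of the push-forward of the invariant area form, smoothened inside the `r`-discs -/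
  β : Plane → ℝ
  β_smooth : ContDiff ℝ ∞ β
  β_ne : ∀ q, β q ≠ 0
  β_pull : ∀ z, r ≤ ‖z - center z‖ → β (p z) * (fderiv ℝ p z).det = hatDensity δ ε ψ z
  /-- final scaling, after which the map is the identity outside the unit disc -/
  κ : ℝ
  κ_pos : 0 < κ
  κ_disc : ∀ x ∉ disc, checkMap δ ε ψ ξ p κ β x = x

namespace Choices

/-- The constructed map. -/
def map (c : Choices) : Plane → Plane := checkMap c.δ c.ε c.ψ c.ξ c.p c.κ c.β

/-- A `π`-periodic parametrization of the `i`-th bounding circle of the island of `c.map`: the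
image of the circle of radius `δ` about `Omega i`. -/
def circle (c : Choices) (i : Fin 4) (t : ℝ) : Plane :=
  straighten c.κ c.β (c.p (Omega i + c.δ • eAngle t))

/-- The saddle on the `i`-th circle whose unstable manifold contains arcs of the circle. -/
def saddleP (c : Choices) (i : Fin 4) : Plane := c.circle i (Real.pi / 2)

/-- The saddle on the `i`-th circle whose stable manifold contains arcs of the circle. -/
def saddleQ (c : Choices) (i : Fin 4) : Plane := c.circle i 0

end Choices

/-! ### Dynamics of maps from the disc to the plane -/

/-- A `C²` area-preserving embedding of the disc into the plane; this includes the area-preserving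
`C²` diffeomorphisms of the disc. -/
structure IsConservative (F : Plane → Plane) : Prop where
  smooth : ContDiffOn ℝ 2 F disc
  inj : Set.InjOn F disc
  area : ∀ x ∈ disc, (fderivWithin ℝ F disc x).det = 1

/-- The `C²` distance of `F` and `G` on the disc is less than `η`. -/
def C2Close (η : ℝ) (F G : Plane → Plane) : Prop :=
  ∀ k : ℕ, k ≤ 2 → ∀ x ∈ disc, ‖iteratedFDerivWithin ℝ k (fun y => F y - G y) disc x‖ < η

/-- The points with all forward iterates in the disc; this is the disc if `F` maps the disc to
itself. -/
def survivors (F : Plane → Plane) : Set Plane := {x | ∀ n : ℕ, F^[n] x ∈ disc}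

/-- The derivative of the `n`-th iterate of `F`, through the chain rule. -/
def iterDeriv (F : Plane → Plane) : ℕ → Plane → (Plane →L[ℝ] Plane)
  | 0, _ => ContinuousLinearMap.id ℝ Plane
  | n + 1, x => (iterDeriv F n (F x)).comp (fderivWithin ℝ F disc x)

theorem iterDeriv_eq_fderivWithin {F : Plane → Plane} (hF : DifferentiableOn ℝ F disc)
    (hm : Set.MapsTo F disc disc) (n : ℕ) :
    ∀ x ∈ disc, iterDeriv F n x = fderivWithin ℝ (F^[n]) disc x := by
  have hu : UniqueDiffOn ℝ disc :=
    uniqueDiffOn_convex (convex_closedBall (0 : Plane) 1)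
      (by rw [disc, interior_closedBall _ one_ne_zero]; exact ⟨0, by simp⟩)
  have hd : ∀ n : ℕ, DifferentiableOn ℝ (F^[n]) disc := by
    intro n
    induction n with
    | zero => exact differentiableOn_id
    | succ k ih => rw [Function.iterate_succ]; exact ih.comp hF hm
  induction n with
  | zero =>
    intro x hx
    simp only [iterDeriv, Function.iterate_zero]
    exact (fderivWithin_id (hu x hx)).symm
  | succ k ih =>
    intro x hx
    rw [Function.iterate_succ, fderivWithin_comp x (hd k _ (hm hx)) (hF x hx) hm (hu x hx),
      iterDeriv, ih _ (hm hx)]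

/-- The maximal Lyapunov exponent. -/
def lyapunov (F : Plane → Plane) (x : Plane) : ℝ :=
  Filter.limsup (fun n : ℕ => (1 / (n : ℝ)) * Real.log ‖iterDeriv F n x‖) Filter.atTop

/-- The metric entropy with respect to area, as the integral of the maximal Lyapunov exponent. -/
def metricEntropy (F : Plane → Plane) : ℝ := ∫ x in survivors F, lyapunov F x

/-- `P` is a hyperbolic point with `F^k P = P`. -/
def IsHyperbolicPeriodic (F : Plane → Plane) (k : ℕ) (P : Plane) : Prop :=
  0 < k ∧ P ∈ survivors F ∧ F^[k] P = P ∧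
    ∀ μ : ℂ, ((iterDeriv F k P).toLinearMap.charpoly.map (algebraMap ℝ ℂ)).IsRoot μ → ‖μ‖ ≠ 1

/-- The stable manifold of a point `P` with `F^k P = P`. -/
def stableSet (F : Plane → Plane) (k : ℕ) (P : Plane) : Set Plane :=
  {x | x ∈ survivors F ∧ Filter.Tendsto (fun n : ℕ => F^[k * n] x) Filter.atTop (𝓝 P)}

/-- The unstable manifold of a point `P` with `F^k P = P`; `y` is the backward orbit of `x`. -/
def unstableSet (F : Plane → Plane) (k : ℕ) (P : Plane) : Set Plane :=
  {x | ∃ y : ℕ → Plane, y 0 = x ∧ (∀ n, y n ∈ disc) ∧ (∀ n, F (y (n + 1)) = y n) ∧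
    Filter.Tendsto (fun n : ℕ => y (k * n)) Filter.atTop (𝓝 P)}

/-- A topologically embedded circle. -/
def IsEmbeddedCircle (L : Set Plane) : Prop :=
  ∃ g : Circle → Plane, Continuous g ∧ Function.Injective g ∧ Set.range g = L

/-- A heteroclinic `N`-link: an embedded circle, invariant under some iterate of `F`, that contains
`N` hyperbolic periodic points and lies in the union of their stable and unstable manifolds. -/
def IsHeteroclinicLink (F : Plane → Plane) (N : ℕ) (L : Set Plane) : Prop :=
  IsEmbeddedCircle L ∧ (∃ m : ℕ, 0 < m ∧ F^[m] '' L = L) ∧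
    ∃ (P : Fin N → Plane) (k : Fin N → ℕ), Function.Injective P ∧
      (∀ j, IsHyperbolicPeriodic F (k j) (P j) ∧ P j ∈ L) ∧
      L ⊆ ⋃ j, (stableSet F (k j) (P j) ∪ unstableSet F (k j) (P j))

/-- `L` is a heteroclinic bi-link defined by the unstable manifold of the hyperbolic fixed point
`P` and the stable manifold of the hyperbolic fixed point `Q`: an invariant embedded circle that
contains both points and lies in the union of these two manifolds. -/
def IsBiLink (F : Plane → Plane) (P Q : Plane) (L : Set Plane) : Prop :=
  IsEmbeddedCircle L ∧ F '' L = L ∧ P ≠ Q ∧ P ∈ L ∧ Q ∈ L ∧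
    IsHyperbolicPeriodic F 1 P ∧ IsHyperbolicPeriodic F 1 Q ∧
    L ⊆ unstableSet F 1 P ∪ stableSet F 1 Q

/-- `L` is a closed curve at `C²` distance less than `η` from the `π`-periodic curve `g`. -/
def CurveC2Close (η : ℝ) (L : Set Plane) (g : ℝ → Plane) : Prop :=
  ∃ γ : ℝ → Plane, ContDiff ℝ 2 γ ∧ Function.Periodic γ Real.pi ∧
    Set.InjOn γ (Set.Ico 0 Real.pi) ∧ Set.range γ = L ∧
    ∀ k : ℕ, k ≤ 2 → ∀ t, ‖iteratedDeriv k (fun s => γ s - g s) t‖ < η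

/-- `I` is a stochastic island bounded by the family `L` of heteroclinic links: a domain whose
boundary is the union of the links and all of whose points have positive maximal Lyapunov
exponent. -/
structure IsStochasticIsland (F : Plane → Plane) {n : ℕ} (L : Fin n → Set Plane)
    (I : Set Plane) : Prop where
  isOpen : IsOpen I
  connected : IsConnected I
  subset : I ⊆ survivors F
  links : ∀ i, ∃ N, IsHeteroclinicLink F N (L i)
  boundary : frontier I = ⋃ i, L i
  exponent : ∀ x ∈ I, 0 < lyapunov F x

end StochasticIsland

end

/-! The island of the model map is the Anosov torus map in disguise. Off the half lattice, `chi` is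
a local diffeomorphism onto the island, injective up to sign and lattice translations, and it
satisfies `c.map ∘ chi = chi ∘ anosov`. Hyperbolicity therefore holds for the model; the question is
whether it survives a perturbation up to the boundary circles, where `chi` is singular. The
persistence of the four links is what makes this possible.

Straightening. The displacement from the circles to the links extends to a C²-small vector field, so
some `τ`, C²-close to the identity, carries the circles to the links (`exists_conjugacy`). The map
`H = τ⁻¹ ∘ F ∘ τ` is C²-close to `c.map` on the closed island and preserves each circle.

Lifting (`lifts_all`). Through `chi`, the map `H` lifts to the plane minus the half lattice, with
derivative uniformly close to the constant matrix of `anosov`. In the interior a local inverse of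
`chi` gives this. Near a circle, let `s` be the radial coordinate, with the circle at `s = 0`, and
write `H` as `G = (G₁, G₂)` in the coordinates `(s, θ)`. Invariance of the circle means `G₁(0, θ) =
0`. After the circle is blown down to a point, the differential is expressed through the derivatives
of `G` and the quotients `G₁ / s` and `∂_θ G₁ / s`, which tend to `∂_s G₁` and `∂_s ∂_θ G₁`
(`tendsto_coneMap`). The differential thus has a boundary limit that depends continuously on `G` in
the C² topology, and for the model this limit is the Anosov matrix (`TargetChart.limits`).

Expansion. A linear map within `1/2` of the Anosov matrix preserves the cone `|v| ≤ |u|` and expands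
`u` by at least `16` (`unstable_step`), so a lifted tangent vector that starts along `eU` grows like
`16 ^ n`. To read this growth in the disc one needs lower bounds for the differential of `chi`
(`frequently_bound`). They hold away from the half lattice by compactness. An orbit that eventually
stays near the half lattice must do so close to the stable direction; there an unstable vector is
essentially angular, and the differential of `chi` does not contract it below a fixed factor. Hence
the exponent is positive at every point of the island.

Orbits stay in the disc because the closed model island lies in the open disc
(`clIsl_subset_interior`): elsewhere the model map would have identity differential, against
hyperbolicity. Smoothness of the model across the circles comes from `ringMap`, a single C² time map
that covers both sides. The entropy is positive because the exponent is nonnegative on all surviving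
points, by area preservation, and positive on a nonempty open set.

Uniformity of `η` is obtained by contradiction along a sequence of maps: all estimates are phrased
as convergence near a point, jointly in the index and the point, and compactness turns them into
uniform statements. -/

noncomputable section

namespace StochasticIsland

open Filter Set

/-! ### Convergence of families of maps together with their derivatives -/

section Convergence

set_option linter.unusedSectionVars false

variable {ι E G H K : Type*} [NormedAddCommGroup E] [NormedSpace ℝ E] [NormedAddCommGroup G]
  [NormedSpace ℝ G] [NormedAddCommGroup H] [NormedSpace ℝ H] [NormedAddCommGroup K]
  [NormedSpace ℝ K] {l : Filter ι}

/-- Continuous convergence of the family `f` to `f₀` at `x`. -/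
def Conv0 (l : Filter ι) (f : ι → E → G) (f₀ : E → G) (x : E) : Prop :=
  Tendsto (fun p : ι × E => f p.1 p.2) (l ×ˢ 𝓝 x) (𝓝 (f₀ x))

/-- Continuous convergence at `x` of the family `f` and of its derivatives. -/
structure Conv1 (l : Filter ι) (f : ι → E → G) (f₀ : E → G) (x : E) : Prop where
  diff : ∀ᶠ p in l ×ˢ 𝓝 x, DifferentiableAt ℝ (f p.1) p.2
  diff₀ : ∀ᶠ y in 𝓝 x, DifferentiableAt ℝ f₀ y
  conv : Conv0 l f f₀ x
  conv_fderiv : Conv0 l (fun i => fderiv ℝ (f i)) (fderiv ℝ f₀) x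

/-- Continuous convergence at `x` of the family `f` and of its first and second derivatives. -/
structure Conv2 (l : Filter ι) (f : ι → E → G) (f₀ : E → G) (x : E) : Prop where
  toConv1 : Conv1 l f f₀ x
  deriv : Conv1 l (fun i => fderiv ℝ (f i)) (fderiv ℝ f₀) x

/-- This passes from values to germs at a fixed index, which is what comparing derivatives requires.
-/
theorem eventually_prod_nhds {P : ι × E → Prop} {x : E}
    (h : ∀ᶠ p in l ×ˢ 𝓝 x, P p) : ∀ᶠ p in l ×ˢ 𝓝 x, ∀ᶠ y in 𝓝 p.2, P (p.1, y) := by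
  obtain ⟨pa, ha, pb, hb, h⟩ := eventually_prod_iff.1 h
  exact eventually_prod_iff.2 ⟨pa, ha, _, hb.eventually_nhds,
    fun hx _ hy => hy.mono fun y' hy' => h hx hy'⟩

theorem eventually_prod_of_nhds {P : E → Prop} {x : E} (h : ∀ᶠ y in 𝓝 x, P y) :
    ∀ᶠ p in l ×ˢ 𝓝 x, P p.2 :=
  tendsto_snd.eventually h

/-- A property that holds eventually near each point of a compact set holds eventually on it. -/
theorem eventually_forall_mem_of_isCompact {X : Type*} [TopologicalSpace X] {s : Set X}
    (hs : IsCompact s) {P : ι → X → Prop} (h : ∀ x ∈ s, ∀ᶠ p in l ×ˢ 𝓝 x, P p.1 p.2) :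
    ∀ᶠ i in l, ∀ x ∈ s, P i x := by
  simp only [← eventually_iSup, ← hs.prod_nhdsSet_eq_biSup] at h
  exact h.curry.mono fun _ h ↦ h.self_of_nhdsSet

theorem Conv0.of_continuousAt {f : E → G} {x : E} (h : ContinuousAt f x) :
    Conv0 l (fun _ => f) f x :=
  h.tendsto.comp tendsto_snd

theorem Conv0.tendsto_prodMk {f : ι → E → G} {f₀ : E → G} {x : E} (h : Conv0 l f f₀ x) :
    Tendsto (fun p : ι × E => (p.1, f p.1 p.2)) (l ×ˢ 𝓝 x) (l ×ˢ 𝓝 (f₀ x)) :=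
  tendsto_fst.prodMk h

theorem Conv0.comp {f : ι → E → G} {f₀ : E → G} {g : ι → G → H} {g₀ : G → H} {x : E}
    (hg : Conv0 l g g₀ (f₀ x)) (hf : Conv0 l f f₀ x) :
    Conv0 l (fun i => g i ∘ f i) (g₀ ∘ f₀) x :=
  Tendsto.comp hg hf.tendsto_prodMk

theorem Conv1.of_contDiffAt {f : E → G} {x : E} (h : ContDiffAt ℝ 1 f x) :
    Conv1 l (fun _ => f) f x := by
  have hd : ∀ᶠ y in 𝓝 x, DifferentiableAt ℝ f y :=
    (h.eventually (by simp)).mono fun y hy => hy.differentiableAt one_ne_zero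
  exact ⟨eventually_prod_of_nhds hd, hd, .of_continuousAt h.continuousAt,
    .of_continuousAt (h.fderiv_right (m := 0) le_rfl).continuousAt⟩

theorem Conv1.congr {f g : ι → E → G} {f₀ g₀ : E → G} {x : E} (hf : Conv1 l f f₀ x)
    (h : ∀ᶠ p in l ×ˢ 𝓝 x, f p.1 p.2 = g p.1 p.2) (h₀ : f₀ =ᶠ[𝓝 x] g₀) : Conv1 l g g₀ x := by
  have h' := eventually_prod_nhds h
  refine ⟨?_, ?_, ?_, ?_⟩
  · filter_upwards [hf.diff, h'] with p hp hp'
    exact hp.congr_of_eventuallyEq (EventuallyEq.symm hp')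
  · filter_upwards [hf.diff₀, h₀.eventuallyEq_nhds] with y hy hy'
    exact hy.congr_of_eventuallyEq hy'.symm
  · rw [Conv0, ← h₀.eq_of_nhds]
    exact hf.conv.congr' h
  · rw [Conv0, ← h₀.fderiv_eq]
    refine hf.conv_fderiv.congr' ?_
    filter_upwards [h'] with p hp
    exact EventuallyEq.fderiv_eq hp

theorem contDiff_clm_prodMk :
    ContDiff ℝ 1 (fun q : (E →L[ℝ] G) × (E →L[ℝ] H) => q.1.prod q.2) := by
  have : (fun q : (E →L[ℝ] G) × (E →L[ℝ] H) => q.1.prod q.2) = fun q =>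
      (ContinuousLinearMap.inl ℝ G H).comp q.1 + (ContinuousLinearMap.inr ℝ G H).comp q.2 := by
    ext q v <;> simp
  rw [this]
  exact (contDiff_const.clm_comp contDiff_fst).add (contDiff_const.clm_comp contDiff_snd)

theorem Conv1.prodMk {f : ι → E → G} {f₀ : E → G} {g : ι → E → H} {g₀ : E → H} {x : E}
    (hf : Conv1 l f f₀ x) (hg : Conv1 l g g₀ x) :
    Conv1 l (fun i y => (f i y, g i y)) (fun y => (f₀ y, g₀ y)) x := by
  refine ⟨?_, ?_, hf.conv.prodMk_nhds hg.conv, ?_⟩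
  · filter_upwards [hf.diff, hg.diff] with p hp hp' using hp.prodMk hp'
  · filter_upwards [hf.diff₀, hg.diff₀] with p hp hp' using hp.prodMk hp'
  · rw [Conv0, hf.diff₀.self_of_nhds.fderiv_prodMk hg.diff₀.self_of_nhds]
    have := ((contDiff_clm_prodMk (E := E) (G := G) (H := H)).continuous.tendsto
      (fderiv ℝ f₀ x, fderiv ℝ g₀ x)).comp (hf.conv_fderiv.prodMk_nhds hg.conv_fderiv)
    refine this.congr' ?_
    filter_upwards [hf.diff, hg.diff] with p hp hp'
    rw [hp.fderiv_prodMk hp']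
    rfl

theorem Conv1.comp {f : ι → E → G} {f₀ : E → G} {g : ι → G → H} {g₀ : G → H} {x : E}
    (hg : Conv1 l g g₀ (f₀ x)) (hf : Conv1 l f f₀ x) :
    Conv1 l (fun i => g i ∘ f i) (g₀ ∘ f₀) x := by
  have hc := hf.diff₀.self_of_nhds.continuousAt
  have hgd := hf.conv.tendsto_prodMk.eventually hg.diff
  refine ⟨?_, ?_, hg.conv.comp hf.conv, ?_⟩
  · filter_upwards [hf.diff, hgd] with p hp hp' using hp'.comp _ hp
  · filter_upwards [hf.diff₀, hc.eventually hg.diff₀] with p hp hp' using hp'.comp _ hp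
  · rw [Conv0, fderiv_comp _ hg.diff₀.self_of_nhds hf.diff₀.self_of_nhds]
    have := ((ContinuousLinearMap.compL ℝ E G H).continuous₂.tendsto
      (fderiv ℝ g₀ (f₀ x), fderiv ℝ f₀ x)).comp
        ((hg.conv_fderiv.comp hf.conv).prodMk_nhds hf.conv_fderiv)
    refine this.congr' ?_
    filter_upwards [hf.diff, hgd] with p hp hp'
    rw [fderiv_comp _ hp' hp]
    rfl

theorem Conv2.of_contDiffAt {f : E → G} {x : E} (h : ContDiffAt ℝ 2 f x) :
    Conv2 l (fun _ => f) f x :=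
  ⟨.of_contDiffAt (h.of_le (by norm_num)), .of_contDiffAt (h.fderiv_right (m := 1) (by norm_num))⟩

theorem Conv2.congr {f g : ι → E → G} {f₀ g₀ : E → G} {x : E} (hf : Conv2 l f f₀ x)
    (h : ∀ᶠ p in l ×ˢ 𝓝 x, f p.1 p.2 = g p.1 p.2) (h₀ : f₀ =ᶠ[𝓝 x] g₀) : Conv2 l g g₀ x := by
  refine ⟨hf.toConv1.congr h h₀, hf.deriv.congr ?_ h₀.fderiv⟩
  filter_upwards [eventually_prod_nhds h] with p hp
  exact EventuallyEq.fderiv_eq hp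

theorem Conv2.prodMk {f : ι → E → G} {f₀ : E → G} {g : ι → E → H} {g₀ : E → H} {x : E}
    (hf : Conv2 l f f₀ x) (hg : Conv2 l g g₀ x) :
    Conv2 l (fun i y => (f i y, g i y)) (fun y => (f₀ y, g₀ y)) x := by
  refine ⟨hf.toConv1.prodMk hg.toConv1, ?_⟩
  have hL : Conv1 l (fun _ => fun q : (E →L[ℝ] G) × (E →L[ℝ] H) => q.1.prod q.2)
      (fun q => q.1.prod q.2) (fderiv ℝ f₀ x, fderiv ℝ g₀ x) :=
    .of_contDiffAt contDiff_clm_prodMk.contDiffAt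
  refine Conv1.congr (hL.comp (f₀ := fun y => (fderiv ℝ f₀ y, fderiv ℝ g₀ y))
    (hf.deriv.prodMk hg.deriv)) ?_ ?_
  · filter_upwards [hf.toConv1.diff, hg.toConv1.diff] with p hp hp'
    rw [hp.fderiv_prodMk hp']
    rfl
  · filter_upwards [hf.toConv1.diff₀, hg.toConv1.diff₀] with p hp hp'
    rw [hp.fderiv_prodMk hp']
    rfl

theorem Conv2.comp {f : ι → E → G} {f₀ : E → G} {g : ι → G → H} {g₀ : G → H} {x : E}
    (hg : Conv2 l g g₀ (f₀ x)) (hf : Conv2 l f f₀ x) :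
    Conv2 l (fun i => g i ∘ f i) (g₀ ∘ f₀) x := by
  have hc := hf.toConv1.diff₀.self_of_nhds.continuousAt
  have hgd := hf.toConv1.conv.tendsto_prodMk.eventually hg.toConv1.diff
  refine ⟨hg.toConv1.comp hf.toConv1, ?_⟩
  have hB : Conv1 l (fun _ => fun q : (G →L[ℝ] H) × (E →L[ℝ] G) => q.1.comp q.2)
      (fun q => q.1.comp q.2) (fderiv ℝ g₀ (f₀ x), fderiv ℝ f₀ x) :=
    .of_contDiffAt (contDiff_fst.clm_comp contDiff_snd).contDiffAt
  refine Conv1.congr (hB.comp (f₀ := fun y => (fderiv ℝ g₀ (f₀ y), fderiv ℝ f₀ y))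
    ((hg.deriv.comp hf.toConv1).prodMk hf.deriv)) ?_ ?_
  · filter_upwards [hf.toConv1.diff, hgd] with p hp hp'
    rw [fderiv_comp _ hp' hp]
    rfl
  · filter_upwards [hf.toConv1.diff₀, hc.eventually hg.toConv1.diff₀] with p hp hp'
    rw [fderiv_comp _ hp' hp]
    rfl

theorem Conv2.add {f g : ι → E → G} {f₀ g₀ : E → G} {x : E}
    (hf : Conv2 l f f₀ x) (hg : Conv2 l g g₀ x) :
    Conv2 l (fun i y => f i y + g i y) (fun y => f₀ y + g₀ y) x :=
  Conv2.comp (g := fun _ (q : G × G) => q.1 + q.2) (g₀ := fun (q : G × G) => q.1 + q.2)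
    (f₀ := fun y => (f₀ y, g₀ y))
    (.of_contDiffAt (contDiff_fst.add contDiff_snd).contDiffAt) (hf.prodMk hg)

theorem Conv2.smul {f : ι → E → ℝ} {g : ι → E → G} {f₀ : E → ℝ} {g₀ : E → G} {x : E}
    (hf : Conv2 l f f₀ x) (hg : Conv2 l g g₀ x) :
    Conv2 l (fun i y => f i y • g i y) (fun y => f₀ y • g₀ y) x :=
  Conv2.comp (g := fun _ (q : ℝ × G) => q.1 • q.2) (g₀ := fun (q : ℝ × G) => q.1 • q.2)
    (f₀ := fun y => (f₀ y, g₀ y))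
    (.of_contDiffAt (contDiff_fst.smul contDiff_snd).contDiffAt) (hf.prodMk hg)

theorem Conv2.sum {κ : Type*} (s : Finset κ) {f : κ → ι → E → G} {f₀ : κ → E → G} {x : E}
    (hf : ∀ k ∈ s, Conv2 l (f k) (f₀ k) x) :
    Conv2 l (fun i y => ∑ k ∈ s, f k i y) (fun y => ∑ k ∈ s, f₀ k y) x := by
  classical
  induction s using Finset.induction_on with
  | empty =>
    simp only [Finset.sum_empty]
    exact .of_contDiffAt contDiffAt_const
  | insert a s ha ih =>
    simp only [Finset.sum_insert ha]
    exact (hf a (by simp)).add (ih fun k hk => hf k (by simp [hk]))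

theorem isOpen_setOf_isInvertible [CompleteSpace E] :
    IsOpen {L : E →L[ℝ] G | L.IsInvertible} := by
  convert ContinuousLinearEquiv.isOpen (𝕜 := ℝ) (E := E) (F := G) using 1
  ext L
  rfl

/-- Inverses of maps that converge to the identity. -/
theorem Conv2.of_inverse [CompleteSpace E] {f g : ι → E → E} {y : E} (hf : Conv2 l f id y)
    (hg : Conv0 l g id y) (hgc : ∀ᶠ p in l ×ˢ 𝓝 y, ContinuousAt (g p.1) p.2)
    (hfg : ∀ᶠ p in l ×ˢ 𝓝 y, f p.1 (g p.1 p.2) = p.2) : Conv2 l g id y := by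
  have hi : (fderiv ℝ (id : E → E) y).IsInvertible := ⟨.refl ℝ E, by rw [fderiv_id]; rfl⟩
  have hid : ContinuousLinearMap.inverse (ContinuousLinearMap.id ℝ E) = .id ℝ E :=
    ContinuousLinearMap.inverse_equiv (.refl ℝ E)
  have hd : Conv0 l (fun i => fderiv ℝ (f i) ∘ g i) (fderiv ℝ id ∘ id) y :=
    Conv0.comp (f₀ := id) hf.toConv1.conv_fderiv hg
  -- Invertibility is an open condition and holds for the identity, so the derivative of `f` at `g
  -- p` is invertible near the limit; a continuous local right inverse of `f` is then
  -- differentiable.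
  have key : ∀ᶠ p in l ×ˢ 𝓝 y,
      HasFDerivAt (g p.1) ((fderiv ℝ (f p.1) (g p.1 p.2)).inverse) p.2 := by
    filter_upwards [Tendsto.eventually hd (isOpen_setOf_isInvertible.mem_nhds hi), hgc,
      eventually_prod_nhds hfg, hg.tendsto_prodMk.eventually hf.toConv1.diff]
      with p ⟨e, he⟩ hc hfg hdf
    have he' : (e : E →L[ℝ] E) = fderiv ℝ (f p.1) (g p.1 p.2) := he
    rw [← he', ContinuousLinearMap.inverse_equiv]
    exact HasFDerivAt.of_local_left_inverse hc (he' ▸ hdf.hasFDerivAt) hfg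
  have hg1 : Conv1 l g id y := by
    refine ⟨key.mono fun p hp => hp.differentiableAt, .of_forall fun _ => differentiableAt_id, hg,
      ?_⟩
    have := (hi.contDiffAt_map_inverse (n := 0)).continuousAt.tendsto.comp hd
    rw [fderiv_id, hid] at this
    rw [Conv0, fderiv_id]
    exact this.congr' (key.mono fun p hp => hp.fderiv.symm)
  -- Bootstrap: the derivative of `g` is the inverse of the derivative of `f` along `g`, and `g` is
  -- by now known to converge with one derivative.
  refine ⟨hg1, ?_⟩
  have hI : Conv1 l (fun _ => ContinuousLinearMap.inverse) ContinuousLinearMap.inverse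
    (fderiv ℝ (id : E → E) y) := .of_contDiffAt hi.contDiffAt_map_inverse
  refine Conv1.congr (hI.comp (f₀ := fun z => fderiv ℝ id z)
    (Conv1.comp (f₀ := id) hf.deriv hg1)) ?_ (.of_forall fun z => ?_)
  · exact key.mono fun p hp => hp.fderiv.symm
  · simp only [Function.comp_apply, fderiv_id, hid]

/-- A local inverse of a map with invertible derivative. -/
theorem exists_local_inverse [CompleteSpace E] {n : WithTop ℕ∞} {f : E → G} {a : E}
    (hf : ContDiffAt ℝ n f a) (hn : n ≠ 0) (hi : (fderiv ℝ f a).IsInvertible) :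
    ∃ g : G → E, ContDiffAt ℝ n g (f a) ∧ g (f a) = a ∧ (∀ᶠ y in 𝓝 (f a), f (g y) = y) ∧
      ∀ᶠ x in 𝓝 a, g (f x) = x := by
  obtain ⟨e, he⟩ := hi
  have hf' : HasFDerivAt f (e : E →L[ℝ] G) a := he ▸ (hf.differentiableAt hn).hasFDerivAt
  have hs := hf.hasStrictFDerivAt' hf' hn
  exact ⟨hf.localInverse hf' hn, hf.to_localInverse hf' hn, hf.localInverse_apply_image hf' hn,
    hs.eventually_right_inverse, hs.eventually_left_inverse⟩

/-- A map is smooth if its composition with a local diffeomorphism is. -/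
theorem contDiffAt_of_comp [CompleteSpace E] {n : WithTop ℕ∞} {f : E → G} {g : G → H} {k : E → H}
    {a : E} (hf : ContDiffAt ℝ n f a) (hn : n ≠ 0) (hi : (fderiv ℝ f a).IsInvertible)
    (hk : ContDiffAt ℝ n k a) (h : ∀ᶠ x in 𝓝 a, g (f x) = k x) : ContDiffAt ℝ n g (f a) := by
  obtain ⟨q, hq, hqa, hfq, -⟩ := exists_local_inverse hf hn hi
  have hk' : ContDiffAt ℝ n (k ∘ q) (f a) := ContDiffAt.comp _ (by rwa [hqa]) hq
  refine hk'.congr_of_eventuallyEq ?_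
  have hq' : Tendsto q (𝓝 (f a)) (𝓝 a) := by simpa [ContinuousAt, hqa] using hq.continuousAt
  filter_upwards [hfq, hq'.eventually h] with y hy hy'
  rw [Function.comp_apply, ← hy', hy]

theorem image_mem_nhds_of_isInvertible [CompleteSpace E] {f : E → G} {a : E} {s : Set E}
    (hf : ContDiffAt ℝ 1 f a) (hi : (fderiv ℝ f a).IsInvertible) (hs : s ∈ 𝓝 a) :
    f '' s ∈ 𝓝 (f a) := by
  obtain ⟨q, hq, hqa, hfq, -⟩ := exists_local_inverse hf one_ne_zero hi
  have hq' : Tendsto q (𝓝 (f a)) (𝓝 a) := by simpa [ContinuousAt, hqa] using hq.continuousAt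
  filter_upwards [hfq, hq'.eventually hs] with y hy hy' using ⟨q y, hy', hy⟩

end Convergence

end StochasticIsland
end

noncomputable section

namespace StochasticIsland

open Filter Set

/-! ### Smoothness of the time maps of Lipschitz vector fields -/

section Flow

set_option linter.unusedSectionVars false

universe u

open scoped NNReal

variable {E : Type u} [NormedAddCommGroup E] [NormedSpace ℝ E]

variable {I : Type*} [TopologicalSpace I] [CompactSpace I] {G W : Type u}
    [NormedAddCommGroup G] [NormedSpace ℝ G] [NormedAddCommGroup W] [NormedSpace ℝ W]

theorem norm_bilinear_apply_le (B : W →L[ℝ] E →L[ℝ] G) (T : C(I, W)) (γ : C(I, E)) :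
    ‖(⟨fun t => B (T t) (γ t), (B.continuous.comp T.continuous).clm_apply γ.continuous⟩ :
      C(I, G))‖ ≤ ‖B‖ * ‖T‖ * ‖γ‖ :=
  (ContinuousMap.norm_le _ (by positivity)).2 fun t =>
    (B (T t)).le_of_opNorm_le_of_le (B.le_opNorm_of_le (T.norm_coe_le_norm t))
      (γ.norm_coe_le_norm t)

/-- Pointwise application of a continuous family of linear maps. -/
def applyFamily (B : W →L[ℝ] E →L[ℝ] G) : C(I, W) →L[ℝ] C(I, E) →L[ℝ] C(I, G) :=
  LinearMap.mkContinuous₂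
    (LinearMap.mk₂ ℝ (fun (T : C(I, W)) (γ : C(I, E)) =>
        (⟨fun t => B (T t) (γ t), (B.continuous.comp T.continuous).clm_apply γ.continuous⟩ :
          C(I, G)))
      (fun _ _ _ => by ext; simp) (fun _ _ _ => by ext; simp)
      (fun _ _ _ => by ext; simp) (fun _ _ _ => by ext; simp)) ‖B‖
    (norm_bilinear_apply_le B)

theorem contDiff_applyFamily {n : WithTop ℕ∞} (B : W →L[ℝ] E →L[ℝ] G) :
    ContDiff ℝ n (fun T : C(I, W) => applyFamily B T) :=
  IsBoundedLinearMap.contDiff (IsLinearMap.with_bound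
    ⟨fun _ _ => map_add _ _ _, fun _ _ => map_smul _ _ _⟩ ‖B‖ fun T =>
      ContinuousLinearMap.opNorm_le_bound _ (by positivity) fun γ =>
        norm_bilinear_apply_le B T γ)

/-- The remainder at time `t` is controlled by the mean value inequality on a ball about `γ t`. The
range of `γ` is compact, so the radius of that ball can be chosen independently of `t`. -/
theorem hasFDerivAt_postcomp (B : W →L[ℝ] E →L[ℝ] G) (f : C(E, G)) (f' : C(E, W))
    (hf : ∀ x, HasFDerivAt f (B (f' x)) x) (γ : C(I, E)) :
    HasFDerivAt (fun γ : C(I, E) => f.comp γ) (applyFamily B (f'.comp γ)) γ := by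
  rw [hasFDerivAt_iff_isLittleO_nhds_zero, Asymptotics.isLittleO_iff]
  intro c hc
  have hK : IsCompact (range γ) := isCompact_range γ.continuous
  have := hK.uniformContinuousAt_of_continuousAt (fun x => B (f' x))
    (fun a _ => (B.continuous.comp f'.continuous).continuousAt) (Metric.dist_mem_uniformity hc)
  obtain ⟨d, hd0, hdd⟩ := Metric.mem_uniformity_dist.1 this
  filter_upwards [Metric.ball_mem_nhds (0 : C(I, E)) hd0] with h hh
  refine (ContinuousMap.norm_le _ (by positivity)).2 fun t => ?_
  have hht : ‖h t‖ ≤ ‖h‖ := h.norm_coe_le_norm t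
  rw [mem_ball_zero_iff] at hh
  have key := (convex_ball (γ t) d).norm_image_sub_le_of_norm_hasFDerivWithin_le' (f := f) (𝕜 := ℝ)
    (φ := B (f' (γ t))) (C := c) (x := γ t) (y := γ t + h t) (f' := fun x => B (f' x))
    (fun x _ => (hf x).hasFDerivWithinAt)
    (fun x hx => by
      have h2 : dist (γ t) x < d := by rw [dist_comm]; exact hx
      have h1 : γ t ∈ range γ → dist (B (f' (γ t))) (B (f' x)) < c := hdd h2
      rw [← dist_eq_norm, dist_comm]
      exact (h1 ⟨t, rfl⟩).le)
    (Metric.mem_ball_self hd0) (by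
      rw [mem_ball_iff_norm, add_sub_cancel_left]; exact hht.trans_lt hh)
  rw [add_sub_cancel_left] at key
  exact key.trans (by gcongr)

theorem contDiff_postcomp_succ {n : ℕ} (B : W →L[ℝ] E →L[ℝ] G) (f : C(E, G)) (f' : C(E, W))
    (hf : ∀ x, HasFDerivAt f (B (f' x)) x)
    (hf' : ContDiff ℝ n (fun γ : C(I, E) => f'.comp γ)) :
    ContDiff ℝ (n + 1) (fun γ : C(I, E) => f.comp γ) :=
  contDiff_succ_iff_hasFDerivAt.2 ⟨fun γ => applyFamily B (f'.comp γ),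
    (contDiff_applyFamily B).comp hf', hasFDerivAt_postcomp B f f' hf⟩

/-- The composition operator of a smooth map is smooth on spaces of continuous maps. -/
theorem contDiff_postcomp (n : ℕ) :
    ∀ {G : Type u} [NormedAddCommGroup G] [NormedSpace ℝ G] (f : C(E, G)), ContDiff ℝ n f →
      ContDiff ℝ n (fun γ : C(I, E) => f.comp γ) := by
  -- The induction ranges over all targets `G`, because the derivative of `f` takes values in `E
  -- →L[ℝ] G`.
  induction n with
  | zero =>
    intro G _ _ f _
    exact contDiff_zero.2 (ContinuousMap.continuous_postcomp f)
  | succ n ih =>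
    intro G _ _ f hf
    push_cast at hf ⊢
    have hd := hf.differentiable (by simp)
    have hf' : ContDiff ℝ n (fderiv ℝ f) := hf.fderiv_right le_rfl
    exact contDiff_postcomp_succ (ContinuousLinearMap.id ℝ (E →L[ℝ] G)) f
      ⟨fderiv ℝ f, hf'.continuous⟩ (fun x => (hd x).hasFDerivAt) (ih _ hf')

variable [CompleteSpace E]

/-- The primitive of a continuous curve on `[0, T]`. -/
def primitive (T : ℝ) (hT : 0 ≤ T) : C(Icc (0 : ℝ) T, E) →L[ℝ] C(Icc (0 : ℝ) T, E) :=
  LinearMap.mkContinuous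
    { toFun := fun γ => ⟨fun t => ∫ s in (0 : ℝ)..t, γ (projIcc 0 T hT s), by
        have hc : Continuous fun s => γ (projIcc 0 T hT s) := γ.continuous.comp continuous_projIcc
        exact (intervalIntegral.continuous_primitive
          (fun a b => hc.intervalIntegrable a b) 0).comp continuous_subtype_val⟩
      map_add' := fun γ γ' => by
        ext t
        have hc : ∀ γ : C(Icc (0 : ℝ) T, E), Continuous fun s => γ (projIcc 0 T hT s) :=
          fun γ => γ.continuous.comp continuous_projIcc
        simpa using intervalIntegral.integral_add ((hc γ).intervalIntegrable 0 t)
          ((hc γ').intervalIntegrable 0 t)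
      map_smul' := fun a γ => by
        ext t
        simp }
    T (fun γ => by
      refine (ContinuousMap.norm_le _ (by positivity)).2 fun t => ?_
      have := intervalIntegral.norm_integral_le_of_norm_le_const (a := 0) (b := (t : ℝ))
        (C := ‖γ‖) (f := fun s => γ (projIcc 0 T hT s)) (fun s _ => γ.norm_coe_le_norm _)
      refine this.trans ?_
      rw [sub_zero, abs_of_nonneg t.2.1, mul_comm]
      exact mul_le_mul_of_nonneg_right t.2.2 (norm_nonneg _))

theorem norm_primitive_apply_le (T : ℝ) (hT : 0 ≤ T) (γ : C(Icc (0 : ℝ) T, E)) :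
    ‖primitive T hT γ‖ ≤ T * ‖γ‖ := by
  refine (ContinuousMap.norm_le _ (by positivity)).2 fun t => ?_
  have := intervalIntegral.norm_integral_le_of_norm_le_const (a := 0) (b := (t : ℝ))
    (C := ‖γ‖) (f := fun s => γ (projIcc 0 T hT s)) (fun s _ => γ.norm_coe_le_norm _)
  refine this.trans ?_
  rw [sub_zero, abs_of_nonneg t.2.1, mul_comm]
  exact mul_le_mul_of_nonneg_right t.2.2 (norm_nonneg _)

/-- A perturbation of the identity by a contraction is a homeomorphism. -/
theorem exists_homeomorph_add {h : E → E} {c : ℝ≥0} (hc : c < 1) (hh : LipschitzWith c h) :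
    ∃ e : E ≃ₜ E, ∀ x, e x = x + h x := by
  have ha : ApproximatesLinearOn (fun x => x + h x)
      ((ContinuousLinearEquiv.refl ℝ E : E ≃L[ℝ] E) : E →L[ℝ] E) univ c := by
    refine ApproximatesLinearOn.approximatesLinearOn_iff_lipschitzOnWith.2 ?_
    have : ((fun x => x + h x) - ⇑((ContinuousLinearEquiv.refl ℝ E : E ≃L[ℝ] E) : E →L[ℝ] E)) = h := by
      ext x
      simp
    rw [this]
    exact hh.lipschitzOnWith
  refine ⟨ha.toHomeomorph _ ?_, fun x => rfl⟩
  rcases subsingleton_or_nontrivial E with hE | hE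
  · exact Or.inl hE
  · right
    have : ‖((ContinuousLinearEquiv.refl ℝ E).symm : E →L[ℝ] E)‖₊ = 1 := by
      ext
      exact ContinuousLinearMap.norm_id
    rw [this, inv_one]
    exact hc

theorem exists_homeomorph_add_contDiff {n : ℕ} (hn : n ≠ 0) {R : E → E} (hR : ContDiff ℝ n R)
    {c : ℝ≥0} (hc : c < 1) (hRl : LipschitzWith c R) :
    ∃ e : E ≃ₜ E, (∀ x, e x = x + R x) ∧ ContDiff ℝ n e.symm := by
  obtain ⟨e, he⟩ := exists_homeomorph_add hc hRl
  have hRd : Differentiable ℝ R := hR.differentiable (by exact_mod_cast hn)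
  have hinv : ∀ x, ∃ L : E ≃L[ℝ] E, HasFDerivAt e (L : E →L[ℝ] E) x := by
    intro x
    -- The contraction constant bounds the derivative, so the Neumann series inverts the derivative
    -- of `x + R x`.
    have h1 : ‖-fderiv ℝ R x‖ < 1 := by
      rw [norm_neg]
      exact (norm_fderiv_le_of_lipschitz ℝ hRl).trans_lt hc
    let L := ContinuousLinearEquiv.unitsEquiv ℝ E (Units.oneSub _ h1)
    refine ⟨L, ?_⟩
    have h2 : (L : E →L[ℝ] E) = ContinuousLinearMap.id ℝ _ + fderiv ℝ R x := by
      ext v : 1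
      change v - -(fderiv ℝ R x v) = v + fderiv ℝ R x v
      abel
    rw [h2]
    have h3 := (hasFDerivAt_id x).add (hRd x).hasFDerivAt
    exact h3.congr_of_eventuallyEq (.of_forall he)
  choose L hL using hinv
  refine ⟨e, he, e.contDiff_symm hL ?_⟩
  have : (e : E → E) = fun γ => γ + R γ := funext he
  rw [this]
  exact contDiff_id.add hR

/-- Trajectories are the curves for which `γ - ∫ X(γ)` is the constant curve `γ 0`. On continuous
curves over `[0, T]` with `T * K < 1`, the left side is a contractive perturbation of the identity
and is as smooth as `X`, so it has a smooth inverse. `S` applies this inverse to constant curves and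
evaluates at `T`. -/
theorem exists_contDiff_timeMap_of_small {n : ℕ} {X : E → E} (hX : ContDiff ℝ n X) (hn : n ≠ 0)
    {K : ℝ≥0} (hK : LipschitzWith K X) {T : ℝ} (hT : 0 ≤ T) (hTK : T * K < 1) :
    ∃ S : E → E, ContDiff ℝ n S ∧
      ∀ γ : ℝ → E, (∀ t, HasDerivAt γ (X (γ t)) t) → γ T = S (γ 0) := by
  let Xc : C(E, E) := ⟨X, hX.continuous⟩
  let R : C(Icc (0 : ℝ) T, E) → C(Icc (0 : ℝ) T, E) := fun γ => -primitive T hT (Xc.comp γ)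
  have hR : ContDiff ℝ n R := ((primitive T hT).contDiff.comp (contDiff_postcomp n Xc hX)).neg
  let c : ℝ≥0 := ⟨T, hT⟩ * K
  have hc1 : c < 1 := by exact_mod_cast hTK
  have hRl : LipschitzWith c R := by
    refine LipschitzWith.of_dist_le_mul fun γ γ' => ?_
    have h1 : R γ - R γ' = -primitive T hT (Xc.comp γ - Xc.comp γ') := by
      simp only [R, map_sub]; abel
    have h2 : ‖Xc.comp γ - Xc.comp γ'‖ ≤ K * ‖γ - γ'‖ := by
      refine (ContinuousMap.norm_le _ (by positivity)).2 fun t => ?_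
      exact (hK.norm_sub_le (γ t) (γ' t)).trans
        (mul_le_mul_of_nonneg_left ((γ - γ').norm_coe_le_norm t) K.2)
    rw [dist_eq_norm, dist_eq_norm, h1, norm_neg]
    refine (norm_primitive_apply_le T hT _).trans ((mul_le_mul_of_nonneg_left h2 hT).trans ?_)
    rw [← mul_assoc]
    rfl
  obtain ⟨e, he, hes⟩ := exists_homeomorph_add_contDiff hn hR hc1 hRl
  let ev : C(Icc (0 : ℝ) T, E) →L[ℝ] E :=
    ContinuousMap.evalCLM ℝ (⟨T, right_mem_Icc.2 hT⟩ : Icc (0 : ℝ) T)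
  let co : E →L[ℝ] C(Icc (0 : ℝ) T, E) :=
    LinearMap.mkContinuous
      { toFun := fun z => ContinuousMap.const _ z
        map_add' := fun _ _ => rfl
        map_smul' := fun _ _ => rfl } 1 (fun z => by
          refine (ContinuousMap.norm_le _ (by positivity)).2 fun t => ?_
          rw [one_mul]
          exact le_rfl)
  refine ⟨fun z => ev (e.symm (co z)), ev.contDiff.comp (hes.comp co.contDiff), fun γ hγ => ?_⟩
  have hγc : Continuous γ := continuous_iff_continuousAt.2 fun t => (hγ t).continuousAt
  let γc : C(Icc (0 : ℝ) T, E) := ⟨fun t => γ t, hγc.comp continuous_subtype_val⟩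
  have hmain : e γc = co (γ 0) := by
    rw [he]
    ext t
    change γ t + -(∫ s in (0 : ℝ)..t, X (γ (projIcc 0 T hT s))) = γ 0
    have h1 : ∫ s in (0 : ℝ)..t, X (γ (projIcc 0 T hT s)) = ∫ s in (0 : ℝ)..t, X (γ s) := by
      refine intervalIntegral.integral_congr fun s hs => ?_
      rw [uIcc_of_le t.2.1] at hs
      rw [projIcc_of_mem hT ⟨hs.1, hs.2.trans t.2.2⟩]
    rw [h1, intervalIntegral.integral_eq_sub_of_hasDerivAt (fun s _ => hγ s)
      ((hX.continuous.comp hγc).intervalIntegrable _ _)]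
    abel
  have : e.symm (co (γ 0)) = γc := by rw [← hmain, e.symm_apply_apply]
  change γ T = (e.symm (co (γ 0))) ⟨T, right_mem_Icc.2 hT⟩
  rw [this]
  rfl

/-- The time maps of Lipschitz vector fields are as smooth as the field. -/
theorem exists_contDiff_timeMap {n : ℕ} {X : E → E} (hX : ContDiff ℝ n X) (hn : n ≠ 0)
    {K : ℝ≥0} (hK : LipschitzWith K X) {T : ℝ} (hT : 0 ≤ T) :
    ∃ S : E → E, ContDiff ℝ n S ∧
      ∀ γ : ℝ → E, (∀ t, HasDerivAt γ (X (γ t)) t) → γ T = S (γ 0) := by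
  -- Cut `[0, T]` into `m` steps, each short enough for the contraction argument; the time map is an
  -- iterate.
  obtain ⟨m, hm⟩ := exists_nat_gt (T * K)
  have hm0 : (0 : ℝ) < m := lt_of_le_of_lt (by positivity) hm
  obtain ⟨S, hS, hS'⟩ := exists_contDiff_timeMap_of_small hX hn hK (T := T / m) (by positivity)
    (by rw [div_mul_eq_mul_div, div_lt_one hm0]; exact hm)
  have hit : ∀ k : ℕ, ContDiff ℝ n (S^[k]) := by
    intro k
    induction k with
    | zero => exact contDiff_id
    | succ k ih => rw [Function.iterate_succ]; exact ih.comp hS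
  refine ⟨S^[m], hit m, fun γ hγ => ?_⟩
  have : ∀ k : ℕ, γ (k * (T / m)) = S^[k] (γ 0) := by
    intro k
    induction k with
    | zero => simp
    | succ k ih =>
      have h1 := hS' (fun t => γ (t + k * (T / m))) (fun t => by
        simpa using (hγ (t + k * (T / m))).comp_add_const t (k * (T / m)))
      simp only [zero_add] at h1
      rw [Function.iterate_succ_apply', ← ih, ← h1]
      congr 1
      push_cast
      ring
  rw [← this m, mul_div_cancel₀ _ hm0.ne']

/-- Bounded Lipschitz vector fields are complete. -/
theorem exists_trajectory {X : E → E} {K : ℝ≥0} (hK : LipschitzWith K X) {B : ℝ≥0}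
    (hB : ∀ x, ‖X x‖ ≤ B) (z : E) :
    ∃ γ : ℝ → E, γ 0 = z ∧ ∀ t, HasDerivAt γ (X (γ t)) t := by
  have hloc : ∀ m : ℕ, ∃ α : ℝ → E, α 0 = z ∧
      ∀ t ∈ Ioo (-(m + 1 : ℝ)) (m + 1), HasDerivAt α (X (α t)) t := by
    intro m
    have h0 : (0 : ℝ) ∈ Icc (-(m + 1 : ℝ)) (m + 1) := ⟨by linarith [m.cast_nonneg (α := ℝ)],
      by positivity⟩
    -- Because the field is bounded by `B` everywhere, the ball in which the solution must stay may
    -- be taken of radius `B` times the length of the interval, however long.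
    have hp : IsPicardLindelof (fun _ => X) (⟨0, h0⟩ : Icc (-(m + 1 : ℝ)) (m + 1)) z
        (B * (m + 1)) 0 B K :=
      .of_time_independent (fun x _ => hB x) hK.lipschitzOnWith (by simp)
    obtain ⟨α, hα, hα'⟩ := hp.exists_eq_forall_mem_Icc_hasDerivWithinAt₀
    exact ⟨α, hα, fun t ht => (hα' t (Ioo_subset_Icc_self ht)).hasDerivAt (Icc_mem_nhds ht.1 ht.2)⟩
  choose α hα hα' using hloc
  have hagree : ∀ m M : ℕ, m ≤ M → EqOn (α m) (α M) (Ioo (-(m + 1 : ℝ)) (m + 1)) := by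
    intro m M hmM
    have hmM' : (m : ℝ) ≤ M := by exact_mod_cast hmM
    refine ODE_solution_unique_of_mem_Ioo (v := fun _ => X) (s := fun _ => univ) (K := K) (t₀ := 0)
      (fun _ _ => hK.lipschitzOnWith) ⟨by linarith [m.cast_nonneg (α := ℝ)], by positivity⟩
      (fun t ht => ⟨hα' m t ht, trivial⟩)
      (fun t ht => ⟨hα' M t ⟨by linarith [ht.1], by linarith [ht.2]⟩, trivial⟩) ?_
    rw [hα, hα]
  -- Local solutions on growing intervals agree by uniqueness. Near `t` all the solutions used
  -- coincide with the one of index `⌈|t|⌉₊ + 1`, which gives differentiability where the index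
  -- jumps.
  refine ⟨fun t => α ⌈|t|⌉₊ t, by simp [hα], fun t => ?_⟩
  have hev : (fun s => α ⌈|s|⌉₊ s) =ᶠ[𝓝 t] α (⌈|t|⌉₊ + 1) := by
    have hopen : ∀ᶠ s in 𝓝 t, |s| < |t| + 1 :=
      (continuous_abs.tendsto t).eventually_lt_const (by linarith)
    filter_upwards [hopen] with s hs
    have h1 : ⌈|s|⌉₊ ≤ ⌈|t|⌉₊ + 1 := by
      refine Nat.ceil_le.2 ?_
      push_cast
      linarith [Nat.le_ceil |t|]
    refine hagree _ _ h1 ?_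
    rw [mem_Ioo, ← abs_lt]
    linarith [Nat.le_ceil |s|]
  have hat : α ⌈|t|⌉₊ t = α (⌈|t|⌉₊ + 1) t := hev.eq_of_nhds
  simp only [hat]
  refine (hα' _ t ?_).congr_of_eventuallyEq hev
  rw [mem_Ioo, ← abs_lt]
  push_cast
  linarith [Nat.le_ceil |t|]

theorem trajectory_unique {X : E → E} {K : ℝ≥0} (hK : LipschitzWith K X) {γ γ' : ℝ → E}
    (hγ : ∀ t, HasDerivAt γ (X (γ t)) t) (hγ' : ∀ t, HasDerivAt γ' (X (γ' t)) t) {t₀ : ℝ}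
    (h : γ t₀ = γ' t₀) : γ = γ' :=
  ODE_solution_unique_univ (v := fun _ => X) (s := fun _ => univ) (K := K)
    (fun _ => hK.lipschitzOnWith) (fun t => ⟨hγ t, trivial⟩) (fun t => ⟨hγ' t, trivial⟩) h

end Flow

end StochasticIsland
end

noncomputable section

namespace StochasticIsland

open Filter Set

/-! ### The plane, the eigenframe and the lattices -/

theorem inner_plane (x y : Plane) : inner ℝ x y = x 0 * y 0 + x 1 * y 1 := by
  simp [PiLp.inner_apply, Fin.sum_univ_two, mul_comm]

theorem norm_sq_plane (x : Plane) : ‖x‖ ^ 2 = x 0 ^ 2 + x 1 ^ 2 := by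
  rw [← real_inner_self_eq_norm_sq, inner_plane]; ring

theorem plane_ext {x y : Plane} (h0 : x 0 = y 0) (h1 : x 1 = y 1) : x = y := by
  ext i; fin_cases i <;> assumption

theorem abs_apply_le (x : Plane) (i : Fin 2) : |x i| ≤ ‖x‖ := by
  simpa using PiLp.norm_apply_le x i

theorem sq_sqrt_five : Real.sqrt 5 ^ 2 = 5 := Real.sq_sqrt (by norm_num)

theorem unstableSlope_sq : unstableSlope ^ 2 = 1 - unstableSlope := by
  rw [unstableSlope]; nlinarith [sq_sqrt_five]

theorem sqrt_five_eq : Real.sqrt 5 = 2 * unstableSlope + 1 := by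
  rw [unstableSlope]; ring

theorem exp_sigma : Real.exp sigma = 9 + 4 * Real.sqrt 5 :=
  Real.exp_log (by positivity)

theorem exp_neg_sigma : Real.exp (-sigma) = 9 - 4 * Real.sqrt 5 := by
  rw [Real.exp_neg, exp_sigma]
  refine inv_eq_of_mul_eq_one_right ?_
  nlinarith [sq_sqrt_five]

theorem two_lt_sqrt_five : 2 < Real.sqrt 5 := by
  rw [Real.lt_sqrt (by norm_num)]; norm_num

theorem sqrt_five_lt : Real.sqrt 5 < 9 / 4 := by
  rw [Real.sqrt_lt' (by norm_num)]; norm_num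

theorem sigma_pos : 0 < sigma := Real.log_pos (by linarith [two_lt_sqrt_five])

theorem eU_zero : eU 0 = (Real.sqrt (1 + unstableSlope ^ 2))⁻¹ := by simp [eU]
theorem eU_one : eU 1 = eU 0 * unstableSlope := by simp [eU]
theorem eS_zero : eS 0 = -eU 1 := by simp [eU, eS]
theorem eS_one : eS 1 = eU 0 := by simp [eU, eS]

theorem eU_sq : eU 0 ^ 2 + eU 1 ^ 2 = 1 := by
  have h : 0 < 1 + unstableSlope ^ 2 := by positivity
  rw [eU_one, mul_pow, eU_zero, inv_pow, Real.sq_sqrt h.le]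
  field_simp

/-- The unstable coordinate. -/
def uC (z : Plane) : ℝ := inner ℝ eU z

/-- The stable coordinate. -/
def vC (z : Plane) : ℝ := inner ℝ eS z

theorem uC_eq (z : Plane) : uC z = eU 0 * z 0 + eU 1 * z 1 := inner_plane _ _

theorem vC_eq (z : Plane) : vC z = -eU 1 * z 0 + eU 0 * z 1 := by
  rw [vC, inner_plane, eS_zero, eS_one]

theorem uC_add (z w : Plane) : uC (z + w) = uC z + uC w := inner_add_right _ _ _
theorem vC_add (z w : Plane) : vC (z + w) = vC z + vC w := inner_add_right _ _ _
theorem uC_sub (z w : Plane) : uC (z - w) = uC z - uC w := inner_sub_right _ _ _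
theorem vC_sub (z w : Plane) : vC (z - w) = vC z - vC w := inner_sub_right _ _ _
theorem uC_smul (a : ℝ) (z : Plane) : uC (a • z) = a * uC z := inner_smul_right _ _ _
theorem vC_smul (a : ℝ) (z : Plane) : vC (a • z) = a * vC z := inner_smul_right _ _ _
theorem uC_neg (z : Plane) : uC (-z) = -uC z := inner_neg_right _ _
theorem vC_neg (z : Plane) : vC (-z) = -vC z := inner_neg_right _ _

theorem uC_eU : uC eU = 1 := by rw [uC_eq]; nlinarith [eU_sq]
theorem vC_eU : vC eU = 0 := by rw [vC_eq]; ring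
theorem uC_eS : uC eS = 0 := by rw [uC_eq, eS_zero, eS_one]; ring
theorem vC_eS : vC eS = 1 := by rw [vC_eq, eS_zero, eS_one]; nlinarith [eU_sq]

theorem frame_decomp (z : Plane) : z = uC z • eU + vC z • eS := by
  refine plane_ext ?_ ?_ <;>
    simp only [PiLp.add_apply, PiLp.smul_apply, smul_eq_mul, uC_eq, vC_eq, eS_zero, eS_one] <;>
    linear_combination (-z _) * eU_sq

theorem frame_ext {z w : Plane} (hu : uC z = uC w) (hv : vC z = vC w) : z = w := by
  rw [frame_decomp z, frame_decomp w, hu, hv]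

theorem norm_sq_frame (z : Plane) : ‖z‖ ^ 2 = uC z ^ 2 + vC z ^ 2 := by
  rw [norm_sq_plane, uC_eq, vC_eq]
  linear_combination (-(z 0 ^ 2 + z 1 ^ 2)) * eU_sq

theorem abs_uC_le (z : Plane) : |uC z| ≤ ‖z‖ :=
  abs_le_of_sq_le_sq (b := ‖z‖) (by rw [norm_sq_frame]; nlinarith [sq_nonneg (vC z)])
    (norm_nonneg _)

theorem abs_vC_le (z : Plane) : |vC z| ≤ ‖z‖ :=
  abs_le_of_sq_le_sq (b := ‖z‖) (by rw [norm_sq_frame]; nlinarith [sq_nonneg (uC z)])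
    (norm_nonneg _)

theorem norm_le_abs_add_abs (z : Plane) : ‖z‖ ≤ |uC z| + |vC z| := by
  refine abs_le_of_sq_le_sq' ?_ (by positivity) |>.2
  rw [norm_sq_frame, ← sq_abs (uC z), ← sq_abs (vC z)]
  nlinarith [abs_nonneg (uC z), abs_nonneg (vC z)]

/-- The Anosov map as a linear map. -/
def anosovL : Plane →L[ℝ] Plane :=
  LinearMap.toContinuousLinearMap
    { toFun := anosov
      map_add' := fun x y => by
        refine plane_ext ?_ ?_ <;> simp [anosov] <;> ring
      map_smul' := fun a x => by
        refine plane_ext ?_ ?_ <;> simp [anosov] <;> ring }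

theorem anosovL_apply (z : Plane) : anosovL z = anosov z := rfl

theorem anosov_add (z w : Plane) : anosov (z + w) = anosov z + anosov w := map_add anosovL z w
theorem anosov_sub (z w : Plane) : anosov (z - w) = anosov z - anosov w := map_sub anosovL z w
theorem anosov_neg (z : Plane) : anosov (-z) = -anosov z := map_neg anosovL z
theorem anosov_smul (a : ℝ) (z : Plane) : anosov (a • z) = a • anosov z := map_smul anosovL a z

theorem uC_anosov (z : Plane) : uC (anosov z) = Real.exp sigma * uC z := by
  rw [uC_eq, uC_eq, exp_sigma, eU_one, sqrt_five_eq]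
  simp only [anosov, PiLp.toLp_apply, Matrix.cons_val_zero, Matrix.cons_val_one]
  linear_combination (-8 * eU 0 * z 1) * unstableSlope_sq

theorem vC_anosov (z : Plane) : vC (anosov z) = Real.exp (-sigma) * vC z := by
  rw [vC_eq, vC_eq, exp_neg_sigma, eU_one, sqrt_five_eq]
  simp only [anosov, PiLp.toLp_apply, Matrix.cons_val_zero, Matrix.cons_val_one]
  linear_combination (-8 * eU 0 * z 0) * unstableSlope_sq

/-! #### Angles -/

theorem uC_eAngle (t : ℝ) : uC (eAngle t) = Real.cos t := by
  simp [eAngle, uC_add, uC_smul, uC_eU, uC_eS]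

theorem vC_eAngle (t : ℝ) : vC (eAngle t) = Real.sin t := by
  simp [eAngle, vC_add, vC_smul, vC_eU, vC_eS]

theorem norm_eAngle (t : ℝ) : ‖eAngle t‖ = 1 := by
  have := norm_sq_frame (eAngle t)
  rw [uC_eAngle, vC_eAngle, Real.cos_sq_add_sin_sq] at this
  exact (pow_eq_one_iff_of_nonneg (norm_nonneg _) two_ne_zero).1 this

theorem eAngle_add_pi (t : ℝ) : eAngle (t + Real.pi) = -eAngle t := by
  simp [eAngle, add_comm]

theorem hasDerivAt_eAngle (t : ℝ) : HasDerivAt eAngle (eAngle (t + Real.pi / 2)) t := by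
  have := ((Real.hasDerivAt_cos t).smul_const eU).add ((Real.hasDerivAt_sin t).smul_const eS)
  refine this.congr_deriv ?_
  simp [eAngle, Real.cos_add_pi_div_two, Real.sin_add_pi_div_two]

theorem contDiff_eAngle {n : WithTop ℕ∞} : ContDiff ℝ n eAngle :=
  (Real.contDiff_cos.smul contDiff_const).add (Real.contDiff_sin.smul contDiff_const)

theorem exists_eAngle_eq {z : Plane} (hz : z ≠ 0) : ∃ t, z = ‖z‖ • eAngle t := by
  have h : ‖z‖ ≠ 0 := norm_ne_zero_iff.2 hz
  let w : ℂ := ⟨uC z, vC z⟩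
  have hw : ‖w‖ = ‖z‖ := by
    rw [Complex.norm_eq_sqrt_sq_add_sq, ← norm_sq_frame, Real.sqrt_sq (norm_nonneg _)]
  refine ⟨w.arg, frame_ext ?_ ?_⟩
  · rw [uC_smul, uC_eAngle, ← hw, Complex.norm_mul_cos_arg]
  · rw [vC_smul, vC_eAngle, ← hw, Complex.norm_mul_sin_arg]

theorem eAngle_eq_iff {s t : ℝ} : eAngle s = eAngle t ↔ ∃ k : ℤ, t = s + 2 * k * Real.pi := by
  constructor
  · intro h
    have h1 : Real.cos s = Real.cos t := by rw [← uC_eAngle, h, uC_eAngle]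
    have h2 : Real.sin s = Real.sin t := by rw [← vC_eAngle, h, vC_eAngle]
    have h3 : (s : Real.Angle) = t := Real.Angle.cos_sin_inj h1 h2
    obtain ⟨k, hk⟩ := Real.Angle.angle_eq_iff_two_pi_dvd_sub.1 h3.symm
    exact ⟨k, by linarith⟩
  · rintro ⟨k, rfl⟩
    have : s + 2 * k * Real.pi = s + k * (2 * Real.pi) := by ring
    rw [this]
    simp [eAngle, Real.cos_add_int_mul_two_pi, Real.sin_add_int_mul_two_pi]

theorem eAngle_eq_or_neg {s t : ℝ} (h : eAngle s = eAngle t ∨ eAngle s = -eAngle t) :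
    ∃ k : ℤ, t = s + k * Real.pi := by
  rcases h with h | h
  · obtain ⟨k, hk⟩ := eAngle_eq_iff.1 h
    exact ⟨2 * k, by rw [hk]; push_cast; ring⟩
  · rw [← eAngle_add_pi] at h
    obtain ⟨k, hk⟩ := eAngle_eq_iff.1 h
    exact ⟨2 * k - 1, by push_cast; linarith⟩

/-! #### Lattices -/

theorem mem_lattice_iff {z : Plane} : z ∈ lattice ↔ ∃ m n : ℤ, z 0 = m ∧ z 1 = n := by
  constructor
  · rintro ⟨m, n, rfl⟩; exact ⟨m, n, by simp, by simp⟩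
  · rintro ⟨m, n, h0, h1⟩; exact ⟨m, n, plane_ext (by simpa using h0) (by simpa using h1)⟩

theorem mem_halfLattice_iff {z : Plane} :
    z ∈ halfLattice ↔ ∃ m n : ℤ, z 0 = m / 2 ∧ z 1 = n / 2 := by
  rw [halfLattice, mem_ofPred_eq, mem_lattice_iff]
  simp only [PiLp.smul_apply, smul_eq_mul]
  constructor
  · rintro ⟨m, n, h0, h1⟩; exact ⟨m, n, by linarith, by linarith⟩
  · rintro ⟨m, n, h0, h1⟩; exact ⟨m, n, by linarith, by linarith⟩

theorem zero_mem_lattice : (0 : Plane) ∈ lattice := mem_lattice_iff.2 ⟨0, 0, by simp, by simp⟩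

theorem add_mem_lattice {z w : Plane} (hz : z ∈ lattice) (hw : w ∈ lattice) : z + w ∈ lattice := by
  obtain ⟨m, n, h0, h1⟩ := mem_lattice_iff.1 hz
  obtain ⟨m', n', h0', h1'⟩ := mem_lattice_iff.1 hw
  exact mem_lattice_iff.2 ⟨m + m', n + n', by simp [h0, h0'], by simp [h1, h1']⟩

theorem neg_mem_lattice {z : Plane} (hz : z ∈ lattice) : -z ∈ lattice := by
  obtain ⟨m, n, h0, h1⟩ := mem_lattice_iff.1 hz
  exact mem_lattice_iff.2 ⟨-m, -n, by simp [h0], by simp [h1]⟩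

theorem sub_mem_lattice {z w : Plane} (hz : z ∈ lattice) (hw : w ∈ lattice) : z - w ∈ lattice := by
  rw [sub_eq_add_neg]; exact add_mem_lattice hz (neg_mem_lattice hw)

theorem add_mem_halfLattice {z w : Plane} (hz : z ∈ halfLattice) (hw : w ∈ halfLattice) :
    z + w ∈ halfLattice := by
  rw [halfLattice, mem_ofPred_eq, smul_add]; exact add_mem_lattice hz hw

theorem neg_mem_halfLattice {z : Plane} (hz : z ∈ halfLattice) : -z ∈ halfLattice := by
  rw [halfLattice, mem_ofPred_eq, smul_neg]; exact neg_mem_lattice hz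

theorem sub_mem_halfLattice {z w : Plane} (hz : z ∈ halfLattice) (hw : w ∈ halfLattice) :
    z - w ∈ halfLattice := by
  rw [sub_eq_add_neg]; exact add_mem_halfLattice hz (neg_mem_halfLattice hw)

theorem lattice_subset_halfLattice : lattice ⊆ halfLattice := by
  intro z hz
  rw [halfLattice, mem_ofPred_eq, two_smul]; exact add_mem_lattice hz hz

theorem anosov_mem_lattice {z : Plane} (hz : z ∈ lattice) : anosov z ∈ lattice := by
  obtain ⟨m, n, h0, h1⟩ := mem_lattice_iff.1 hz
  exact mem_lattice_iff.2 ⟨13 * m + 8 * n, 8 * m + 5 * n, by simp [anosov, h0, h1],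
    by simp [anosov, h0, h1]⟩

theorem anosov_mem_halfLattice_iff {z : Plane} : anosov z ∈ halfLattice ↔ z ∈ halfLattice := by
  constructor
  · intro h
    obtain ⟨m, n, h0, h1⟩ := mem_halfLattice_iff.1 h
    simp only [anosov, PiLp.toLp_apply, Matrix.cons_val_zero, Matrix.cons_val_one] at h0 h1
    exact mem_halfLattice_iff.2 ⟨5 * m - 8 * n, -8 * m + 13 * n, by push_cast; linarith,
      by push_cast; linarith⟩
  · intro h
    rw [halfLattice, mem_ofPred_eq, ← anosov_smul]
    exact anosov_mem_lattice h

theorem anosov_sub_mem_lattice {z : Plane} (hz : z ∈ halfLattice) : anosov z - z ∈ lattice := by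
  obtain ⟨m, n, h0, h1⟩ := mem_halfLattice_iff.1 hz
  exact mem_lattice_iff.2 ⟨6 * m + 4 * n, 4 * m + 2 * n, by simp [anosov, h0, h1]; ring,
    by simp [anosov, h0, h1]; ring⟩

theorem Omega_mem_halfLattice (i : Fin 4) : Omega i ∈ halfLattice := by
  fin_cases i
  · exact mem_halfLattice_iff.2 ⟨0, 0, by simp [Omega], by simp [Omega]⟩
  · exact mem_halfLattice_iff.2 ⟨1, 1, by simp [Omega], by simp [Omega]⟩
  · exact mem_halfLattice_iff.2 ⟨1, 0, by simp [Omega], by simp [Omega]⟩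
  · exact mem_halfLattice_iff.2 ⟨0, 1, by simp [Omega], by simp [Omega]⟩

theorem exists_Omega_add {z : Plane} (hz : z ∈ halfLattice) :
    ∃ i, ∃ l ∈ lattice, z = Omega i + l := by
  obtain ⟨m, n, h0, h1⟩ := mem_halfLattice_iff.1 hz
  rcases Int.even_or_odd' m with ⟨a, ha | ha⟩ <;> rcases Int.even_or_odd' n with ⟨b, hb | hb⟩
  · exact ⟨0, !₂[(a : ℝ), (b : ℝ)], ⟨a, b, rfl⟩, plane_ext (by simp [Omega, h0, ha])
      (by simp [Omega, h1, hb])⟩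
  · exact ⟨3, !₂[(a : ℝ), (b : ℝ)], ⟨a, b, rfl⟩, plane_ext (by simp [Omega, h0, ha])
      (by simp [Omega, h1, hb]; ring)⟩
  · exact ⟨2, !₂[(a : ℝ), (b : ℝ)], ⟨a, b, rfl⟩, plane_ext (by simp [Omega, h0, ha]; ring)
      (by simp [Omega, h1, hb])⟩
  · exact ⟨1, !₂[(a : ℝ), (b : ℝ)], ⟨a, b, rfl⟩, plane_ext (by simp [Omega, h0, ha]; ring)
      (by simp [Omega, h1, hb]; ring)⟩

theorem Omega_inj {i j : Fin 4} (h : Omega i - Omega j ∈ lattice) : i = j := by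
  obtain ⟨m, n, h0, h1⟩ := mem_lattice_iff.1 h
  have key : ∀ k : ℤ, (1 / 2 : ℝ) ≠ k := by
    intro k hk
    have : (2 * k : ℝ) = 1 := by linarith
    have h2 : (2 * k : ℤ) = 1 := by exact_mod_cast this
    omega
  have k1 := key m
  have k2 := key n
  have k3 := key (-m)
  have k4 := key (-n)
  push_cast at k3 k4
  fin_cases i <;> fin_cases j <;> simp [Omega] at h0 h1 ⊢ <;>
    first
    | exact absurd (by linarith) k1
    | exact absurd (by linarith) k2
    | exact absurd (by linarith) k3
    | exact absurd (by linarith) k4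

theorem two_smul_Omega (i : Fin 4) : Omega i + Omega i ∈ lattice := by
  rw [← two_smul ℝ]; exact Omega_mem_halfLattice i

theorem countable_halfLattice : halfLattice.Countable := by
  refine (countable_range (fun q : ℤ × ℤ => (!₂[(q.1 : ℝ) / 2, (q.2 : ℝ) / 2] : Plane))).mono ?_
  intro z hz
  obtain ⟨m, n, h0, h1⟩ := mem_halfLattice_iff.1 hz
  exact ⟨(m, n), plane_ext (by simp [h0]) (by simp [h1])⟩

theorem center_mem_halfLattice (z : Plane) : center z ∈ halfLattice :=
  mem_halfLattice_iff.2 ⟨_, _, by simp [center]; rfl, by simp [center]; rfl⟩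

theorem norm_sub_center_le (z : Plane) {c : Plane} (hc : c ∈ halfLattice) :
    ‖z - center z‖ ≤ ‖z - c‖ := by
  obtain ⟨m, n, h0, h1⟩ := mem_halfLattice_iff.1 hc
  refine abs_le_of_sq_le_sq' ?_ (norm_nonneg _) |>.2
  rw [norm_sq_plane, norm_sq_plane]
  have e0 := round_le (2 * z 0) m
  have e1 := round_le (2 * z 1) n
  simp only [PiLp.sub_apply, center, Matrix.cons_val_zero, Matrix.cons_val_one,
    h0, h1]
  have s0 := sq_le_sq.2 e0
  have s1 := sq_le_sq.2 e1
  nlinarith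

theorem half_le_norm_of_mem_halfLattice {c : Plane} (hc : c ∈ halfLattice) (h : c ≠ 0) :
    1 / 2 ≤ ‖c‖ := by
  obtain ⟨m, n, h0, h1⟩ := mem_halfLattice_iff.1 hc
  have key : ∀ k : ℤ, k ≠ 0 → (1 / 2 : ℝ) ≤ |(k : ℝ) / 2| := by
    intro k hk
    have : (1 : ℝ) ≤ |(k : ℝ)| := by exact_mod_cast Int.one_le_abs hk
    rw [abs_div, abs_two]
    linarith
  by_cases hm : m = 0
  · have hn : n ≠ 0 := by
      rintro rfl
      exact h (plane_ext (by simp [h0, hm]) (by simp [h1]))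
    exact (h1 ▸ key n hn).trans (abs_apply_le c 1)
  · exact (h0 ▸ key m hm).trans (abs_apply_le c 0)

/-- Distinct points of the half lattice are at distance at least `1 / 2`, so a point within `1 / 4`
of one of them has no other nearest point. -/
theorem center_eq {z c : Plane} (hc : c ∈ halfLattice) (h : ‖z - c‖ < 1 / 4) : center z = c := by
  by_contra hne
  have h1 := half_le_norm_of_mem_halfLattice (sub_mem_halfLattice hc (center_mem_halfLattice z))
    (sub_ne_zero.2 (Ne.symm hne))
  have h2 := norm_sub_center_le z hc
  have h3 : ‖c - center z‖ ≤ ‖z - center z‖ + ‖z - c‖ := by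
    have : c - center z = (z - center z) - (z - c) := by abel
    rw [this]
    exact norm_sub_le _ _
  linarith

theorem center_add {c p : Plane} (hc : c ∈ halfLattice) (h : ‖p‖ < 1 / 4) : center (c + p) = c :=
  center_eq hc (by rwa [add_sub_cancel_left])

/-- The distance to the nearest point of the half lattice. -/
def centerDist (z : Plane) : ℝ := ‖z - center z‖

theorem centerDist_le (z : Plane) {c : Plane} (hc : c ∈ halfLattice) : centerDist z ≤ ‖z - c‖ :=
  norm_sub_center_le z hc

/-- Although `center` jumps, the distance to it is a minimum of distances to fixed points, hence
1-Lipschitz. -/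
theorem continuous_centerDist : Continuous centerDist := by
  have : LipschitzWith 1 centerDist := LipschitzWith.of_le_add fun z w => by
    refine (centerDist_le z (center_mem_halfLattice w)).trans ?_
    have : z - center w = (w - center w) + (z - w) := by abel
    rw [this, dist_eq_norm]
    exact norm_add_le _ _
  exact this.continuous

theorem centerDist_eq_zero_iff {z : Plane} : centerDist z = 0 ↔ z ∈ halfLattice := by
  constructor
  · intro h
    rw [centerDist, norm_eq_zero, sub_eq_zero] at h
    rw [h]
    exact center_mem_halfLattice z
  · intro h
    have := centerDist_le z h
    rw [sub_self, norm_zero] at this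
    exact le_antisymm this (norm_nonneg _)

theorem centerDist_pos {z : Plane} (h : z ∉ halfLattice) : 0 < centerDist z :=
  lt_of_le_of_ne (norm_nonneg _) fun h' => h (centerDist_eq_zero_iff.1 h'.symm)

theorem centerDist_add (z : Plane) {l : Plane} (hl : l ∈ halfLattice) :
    centerDist (z + l) = centerDist z := by
  refine le_antisymm ?_ ?_
  · have := centerDist_le (z + l) (add_mem_halfLattice (center_mem_halfLattice z) hl)
    rwa [add_sub_add_right_eq_sub] at this
  · have := centerDist_le z (sub_mem_halfLattice (center_mem_halfLattice (z + l)) hl)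
    rwa [← sub_add, sub_add_eq_add_sub] at this

theorem centerDist_neg (z : Plane) : centerDist (-z) = centerDist z := by
  have key : ∀ w, centerDist (-w) ≤ centerDist w := fun w => by
    have := centerDist_le (-w) (neg_mem_halfLattice (center_mem_halfLattice w))
    rwa [neg_sub_neg, ← neg_sub, norm_neg] at this
  refine le_antisymm (key z) ?_
  simpa using key (-z)

theorem isClosed_halfLattice : IsClosed halfLattice := by
  have : halfLattice = centerDist ⁻¹' {0} := by
    ext z; rw [mem_preimage, mem_singleton_iff, centerDist_eq_zero_iff]
  rw [this]
  exact isClosed_singleton.preimage continuous_centerDist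

/-- Every point is equivalent modulo the lattice to a point of a fixed ball. -/
theorem exists_mem_closedBall (z : Plane) :
    ∃ w ∈ Metric.closedBall (0 : Plane) 2, ∃ l ∈ lattice, z = w + l := by
  refine ⟨!₂[Int.fract (z 0), Int.fract (z 1)], ?_, !₂[(⌊z 0⌋ : ℝ), (⌊z 1⌋ : ℝ)], ⟨_, _, rfl⟩,
    plane_ext (by simp) (by simp)⟩
  rw [mem_closedBall_zero_iff]
  refine abs_le_of_sq_le_sq' ?_ (by norm_num) |>.2
  rw [norm_sq_plane]
  simp only [Matrix.cons_val_zero, Matrix.cons_val_one]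
  nlinarith [Int.fract_nonneg (z 0), Int.fract_nonneg (z 1), Int.fract_lt_one (z 0),
    Int.fract_lt_one (z 1)]

end StochasticIsland
end

noncomputable section

namespace StochasticIsland

open Filter Set

/-! ### The blow-down map and its inverse -/

theorem isInvertible_of_injective {E G : Type*} [NormedAddCommGroup E] [NormedSpace ℝ E]
    [NormedAddCommGroup G] [NormedSpace ℝ G] [FiniteDimensional ℝ E] [FiniteDimensional ℝ G]
    (hd : Module.finrank ℝ E = Module.finrank ℝ G) {L : E →L[ℝ] G}
    (h : ∀ v, L v = 0 → v = 0) : L.IsInvertible :=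
  ⟨(LinearMap.linearEquivOfInjective (L : E →ₗ[ℝ] G)
    ((injective_iff_map_eq_zero _).2 h) hd).toContinuousLinearEquiv, by ext v; rfl⟩

theorem isInvertible_ker {E G : Type*} [NormedAddCommGroup E] [NormedSpace ℝ E]
    [NormedAddCommGroup G] [NormedSpace ℝ G] {L : E →L[ℝ] G} (h : L.IsInvertible) {v : E}
    (hv : L v = 0) : v = 0 := by
  obtain ⟨e, rfl⟩ := h
  exact e.map_eq_zero_iff.1 hv

theorem hasFDerivAt_rho (z : Plane) : HasFDerivAt rho (innerSL ℝ z) z := by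
  have h := (hasStrictFDerivAt_norm_sq z).hasFDerivAt.const_mul (1 / 2 : ℝ)
  have e : (fun x : Plane => (1 / 2 : ℝ) * ‖x‖ ^ 2) = rho := by
    ext x; rw [rho]; ring
  rw [e] at h
  refine h.congr_fderiv ?_
  ext v
  simp

theorem contDiff_rho {n : WithTop ℕ∞} : ContDiff ℝ n rho :=
  (contDiff_norm_sq ℝ).div_const 2

theorem rho_pos {z : Plane} (hz : z ≠ 0) : 0 < rho z := by
  have := norm_pos_iff.2 hz
  rw [rho]; positivity

theorem rho_smul (a : ℝ) (z : Plane) : rho (a • z) = a ^ 2 * rho z := by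
  rw [rho, rho, norm_smul, mul_pow, Real.norm_eq_abs, sq_abs]; ring

theorem rho_neg (z : Plane) : rho (-z) = rho z := by rw [rho, rho, norm_neg]

/-- The radial map `(ρ, θ) ↦ (ψ ρ, θ)`. -/
def radial (ψ : ℝ → ℝ) (p : Plane) : Plane := Real.sqrt (ψ (rho p) / rho p) • p

theorem radial_neg (ψ : ℝ → ℝ) (p : Plane) : radial ψ (-p) = -radial ψ p := by
  rw [radial, radial, rho_neg, smul_neg]

theorem rho_radial {ψ : ℝ → ℝ} {p : Plane} (hp : p ≠ 0) (h : 0 ≤ ψ (rho p)) :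
    rho (radial ψ p) = ψ (rho p) := by
  have hr := rho_pos hp
  rw [radial, rho_smul, Real.sq_sqrt (by positivity)]
  field_simp

namespace Choices

variable (c : Choices)

theorem ε_pos : 0 < c.ε := c.δ_pos.trans c.δ_lt

theorem ψ_at_inner : c.ψ (c.δ ^ 2 / 2) = 0 := by rw [c.ψ_inner.self_of_nhds]; ring

theorem ψ_at_outer : c.ψ (c.ε ^ 2 / 2) = c.ε ^ 2 / 2 := c.ψ_outer.self_of_nhds

theorem half_sq_lt : c.δ ^ 2 / 2 < c.ε ^ 2 / 2 := by nlinarith [c.δ_pos, c.δ_lt]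

theorem strictMonoOn_ψ : StrictMonoOn c.ψ (Icc (c.δ ^ 2 / 2) (c.ε ^ 2 / 2)) := by
  refine strictMonoOn_of_deriv_pos (convex_Icc _ _) c.ψ_smooth.continuous.continuousOn ?_
  intro s hs
  rw [interior_Icc] at hs
  exact c.ψ_deriv s (Ioo_subset_Icc_self hs)

theorem ψ_pos {s : ℝ} (h1 : c.δ ^ 2 / 2 < s) (h2 : s ≤ c.ε ^ 2 / 2) : 0 < c.ψ s := by
  rw [← c.ψ_at_inner]
  exact c.strictMonoOn_ψ ⟨le_rfl, c.half_sq_lt.le⟩ ⟨h1.le, h2⟩ h1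

theorem ψ_le {s : ℝ} (h1 : c.δ ^ 2 / 2 ≤ s) (h2 : s ≤ c.ε ^ 2 / 2) : c.ψ s ≤ c.ε ^ 2 / 2 := by
  rw [← c.ψ_at_outer]
  exact c.strictMonoOn_ψ.monotoneOn ⟨h1, h2⟩ ⟨c.half_sq_lt.le, le_rfl⟩ h2

theorem rho_mem {p : Plane} (h1 : c.δ < ‖p‖) (h2 : ‖p‖ ≤ c.ε) :
    c.δ ^ 2 / 2 < rho p ∧ rho p ≤ c.ε ^ 2 / 2 := by
  rw [rho]
  constructor <;> nlinarith [c.δ_pos]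

/-- The blow-down map with the parameters of `c`. -/
def down (z : Plane) : Plane := blowDown c.ε c.ψ z

/-- The complement of the closed `δ`-discs about the half lattice. -/
def hat : Set Plane := hatIsland c.δ

theorem mem_hat {z : Plane} : z ∈ c.hat ↔ c.δ < centerDist z := Iff.rfl

theorem isOpen_hat : IsOpen c.hat := isOpen_lt continuous_const continuous_centerDist

theorem down_near {a p : Plane} (ha : a ∈ halfLattice) (hp : ‖p‖ ≤ c.ε) :
    c.down (a + p) = a + radial c.ψ p := by
  have hc : center (a + p) = a := center_add ha (hp.trans_lt c.ε_lt)
  rw [down, blowDown, hc, add_sub_cancel_left, if_pos hp]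
  rfl

theorem down_far {z : Plane} (hz : c.ε ≤ centerDist z) : c.down z = z := by
  -- On the circle of radius `ε` the definition takes the radial branch, which is the identity there
  -- since `ψ` fixes `ε² / 2`.
  rcases hz.eq_or_lt with h | h
  · have h' : ‖z - center z‖ = c.ε := h.symm
    have := c.down_near (p := z - center z) (center_mem_halfLattice z) h'.le
    rw [add_sub_cancel] at this
    rw [this, radial]
    have hr : rho (z - center z) = c.ε ^ 2 / 2 := by rw [rho, h']
    have hpos := c.ε_pos
    rw [hr, c.ψ_at_outer, div_self (by positivity), Real.sqrt_one, one_smul, add_sub_cancel]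
  · exact if_neg (not_le.2 h)

theorem norm_radial {p : Plane} (h1 : c.δ < ‖p‖) (h2 : ‖p‖ ≤ c.ε) :
    0 < ‖radial c.ψ p‖ ∧ ‖radial c.ψ p‖ ≤ c.ε := by
  obtain ⟨h3, h4⟩ := c.rho_mem h1 h2
  have hp : p ≠ 0 := norm_pos_iff.1 (c.δ_pos.trans h1)
  have h5 := c.ψ_pos h3 h4
  have h6 := rho_radial hp h5.le
  have h7 := c.ψ_le h3.le h4
  rw [← h6, rho] at h5 h7
  refine ⟨norm_pos_iff.2 fun h0 => ?_, ?_⟩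
  · rw [h0] at h5; simp at h5
  · exact abs_le_of_sq_le_sq' (by linarith) c.ε_pos.le |>.2

theorem centerDist_add_of_lt {a p : Plane} (ha : a ∈ halfLattice) (hp : ‖p‖ < 1 / 4) :
    centerDist (a + p) = ‖p‖ := by
  rw [centerDist, center_add ha hp, add_sub_cancel_left]

theorem radial_injOn {p q : Plane} (hp : c.δ < ‖p‖) (hp' : ‖p‖ ≤ c.ε) (hq : c.δ < ‖q‖)
    (hq' : ‖q‖ ≤ c.ε) (h : radial c.ψ p = radial c.ψ q) : p = q := by
  obtain ⟨h3, h4⟩ := c.rho_mem hp hp'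
  obtain ⟨h5, h6⟩ := c.rho_mem hq hq'
  have hp0 : p ≠ 0 := norm_pos_iff.1 (c.δ_pos.trans hp)
  have hq0 : q ≠ 0 := norm_pos_iff.1 (c.δ_pos.trans hq)
  have e : c.ψ (rho p) = c.ψ (rho q) := by
    rw [← rho_radial hp0 (c.ψ_pos h3 h4).le, ← rho_radial hq0 (c.ψ_pos h5 h6).le, h]
  have e' : rho p = rho q := c.strictMonoOn_ψ.injOn ⟨h3.le, h4⟩ ⟨h5.le, h6⟩ e
  rw [radial, radial, e'] at h
  refine smul_right_injective _ ?_ h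
  exact (Real.sqrt_pos.2 (div_pos (c.ψ_pos h5 h6) (rho_pos hq0))).ne'

/-- The annulus about each centre stays in the `ε`-disc of the same centre, and everything farther
away is fixed, so the image determines which case the point comes from. -/
theorem injOn_down : InjOn c.down c.hat := by
  intro z hz w hw h
  rw [mem_hat] at hz hw
  have key : ∀ z, c.δ < centerDist z → centerDist z ≤ c.ε →
      c.down z = center z + radial c.ψ (z - center z) ∧ center (c.down z) = center z ∧
        centerDist (c.down z) ≤ c.ε := by
    intro z h1 h2
    have e := c.down_near (p := z - center z) (center_mem_halfLattice z) h2
    rw [add_sub_cancel] at e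
    obtain ⟨h3, h4⟩ := c.norm_radial h1 h2
    refine ⟨e, ?_, ?_⟩
    · rw [e, center_add (center_mem_halfLattice z) (h4.trans_lt c.ε_lt)]
    · rw [e, centerDist_add_of_lt (center_mem_halfLattice z) (h4.trans_lt c.ε_lt)]
      exact h4
  rcases le_or_gt (centerDist z) c.ε with h1 | h1 <;>
    rcases le_or_gt (centerDist w) c.ε with h2 | h2
  · obtain ⟨a1, a2, -⟩ := key z hz h1
    obtain ⟨b1, b2, -⟩ := key w hw h2
    have hc : center z = center w := by rw [← a2, ← b2, h]
    rw [a1, b1, hc, add_right_inj] at h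
    have e := c.radial_injOn (hc ▸ hz) (hc ▸ h1) hw h2 h
    exact sub_left_injective e
  · have := (key z hz h1).2.2
    rw [h, c.down_far h2.le] at this
    linarith
  · have := (key w hw h2).2.2
    rw [← h, c.down_far h1.le] at this
    linarith
  · rwa [c.down_far h1.le, c.down_far h2.le] at h

theorem mapsTo_down : MapsTo c.down c.hat halfLatticeᶜ := by
  intro z hz hmem
  rw [mem_hat] at hz
  rw [← centerDist_eq_zero_iff] at hmem
  rcases le_or_gt (centerDist z) c.ε with h1 | h1
  · have e := c.down_near (p := z - center z) (center_mem_halfLattice z) h1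
    obtain ⟨h3, h4⟩ := c.norm_radial hz h1
    rw [add_sub_cancel] at e
    rw [e, centerDist_add_of_lt (center_mem_halfLattice z) (h4.trans_lt c.ε_lt)] at hmem
    linarith
  · rw [c.down_far h1.le] at hmem
    linarith [c.ε_pos]

theorem surjOn_down : SurjOn c.down c.hat halfLatticeᶜ := by
  intro w hw
  have hd := centerDist_pos hw
  rcases le_or_gt (centerDist w) c.ε with h1 | h1
  · set q := w - center w with hq
    have hq0 : 0 < ‖q‖ := hd
    have hqε : ‖q‖ ≤ c.ε := h1
    have hqne : q ≠ 0 := norm_pos_iff.1 hq0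
    have hmem : rho q ∈ Icc (c.ψ (c.δ ^ 2 / 2)) (c.ψ (c.ε ^ 2 / 2)) := by
      rw [c.ψ_at_inner, c.ψ_at_outer]
      exact ⟨(rho_pos hqne).le, by rw [rho]; nlinarith⟩
    obtain ⟨s, hs, hs'⟩ := intermediate_value_Icc c.half_sq_lt.le
      c.ψ_smooth.continuous.continuousOn hmem
    have hs0 : c.δ ^ 2 / 2 < s := by
      refine lt_of_le_of_ne hs.1 fun h => ?_
      rw [← h, c.ψ_at_inner] at hs'
      linarith [rho_pos hqne]
    have hspos : 0 < s := lt_of_le_of_lt (by positivity) hs0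
    have hqpos := rho_pos hqne
    -- Rescale `q` along its ray to radial coordinate `s`, where `ψ s = rho q` by the intermediate
    -- value theorem.
    set p := Real.sqrt (s / rho q) • q with hp
    have hrp : rho p = s := by
      rw [hp, rho_smul, Real.sq_sqrt (by positivity)]; field_simp
    have hrp' : ‖p‖ ^ 2 = 2 * s := by rw [← hrp, rho]; ring
    have hpδ : c.δ < ‖p‖ := by
      refine lt_of_pow_lt_pow_left₀ 2 (norm_nonneg _) ?_
      linarith
    have hpε : ‖p‖ ≤ c.ε := by
      refine le_of_sq_le_sq ?_ c.ε_pos.le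
      linarith [hs.2]
    refine ⟨center w + p, ?_, ?_⟩
    · rw [mem_hat, centerDist_add_of_lt (center_mem_halfLattice w) (hpε.trans_lt c.ε_lt)]
      exact hpδ
    · rw [c.down_near (center_mem_halfLattice w) hpε, radial, hrp, hs', hp, smul_smul,
        ← Real.sqrt_mul (by positivity)]
      have : rho q / s * (s / rho q) = 1 := by field_simp
      rw [this, Real.sqrt_one, one_smul, hq, add_sub_cancel]
  · exact ⟨w, by rw [mem_hat]; linarith [c.δ_lt], c.down_far h1.le⟩

theorem down_add (z : Plane) {l : Plane} (hl : l ∈ halfLattice) :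
    c.down (z + l) = c.down z + l := by
  rcases le_or_gt (centerDist z) c.ε with h1 | h1
  · have e1 := c.down_near (p := z - center z) (center_mem_halfLattice z) h1
    have e2 := c.down_near (p := z - center z)
      (add_mem_halfLattice (center_mem_halfLattice z) hl) h1
    have e3 : center z + l + (z - center z) = z + l := by abel
    rw [e3] at e2
    rw [add_sub_cancel] at e1
    rw [e1, e2]
    abel
  · rw [c.down_far h1.le, c.down_far (by rw [centerDist_add z hl]; exact h1.le)]

theorem down_neg (z : Plane) : c.down (-z) = -c.down z := by
  rcases le_or_gt (centerDist z) c.ε with h1 | h1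
  · have e1 := c.down_near (p := z - center z) (center_mem_halfLattice z) h1
    have e2 := c.down_near (p := -(z - center z))
      (neg_mem_halfLattice (center_mem_halfLattice z)) (by rw [norm_neg]; exact h1)
    have e3 : -center z + -(z - center z) = -z := by abel
    rw [e3, radial_neg] at e2
    rw [add_sub_cancel] at e1
    rw [e1, e2]
    abel
  · rw [c.down_far h1.le, c.down_far (by rw [centerDist_neg]; exact h1.le)]

theorem add_mem_hat {z l : Plane} (hl : l ∈ halfLattice) (hz : z ∈ c.hat) : z + l ∈ c.hat := by
  rw [mem_hat, centerDist_add z hl]; exact hz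

theorem neg_mem_hat {z : Plane} (hz : z ∈ c.hat) : -z ∈ c.hat := by
  rw [mem_hat, centerDist_neg]; exact hz

/-- The inverse of the blow-down map. -/
def up (w : Plane) : Plane := Function.invFunOn c.down c.hat w

theorem up_mem {w : Plane} (hw : w ∉ halfLattice) : c.up w ∈ c.hat :=
  Function.invFunOn_mem (c.surjOn_down hw)

theorem down_up {w : Plane} (hw : w ∉ halfLattice) : c.down (c.up w) = w :=
  Function.invFunOn_eq (c.surjOn_down hw)

theorem up_down {z : Plane} (hz : z ∈ c.hat) : c.up (c.down z) = z :=
  c.injOn_down (c.up_mem (c.mapsTo_down hz)) hz (c.down_up (c.mapsTo_down hz))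

theorem up_eq {z w : Plane} (hz : z ∈ c.hat) (h : c.down z = w) : c.up w = z := by
  rw [← h, c.up_down hz]

theorem up_add {w l : Plane} (hw : w ∉ halfLattice) (hl : l ∈ halfLattice) :
    c.up (w + l) = c.up w + l :=
  c.up_eq (c.add_mem_hat hl (c.up_mem hw)) (by rw [c.down_add _ hl, c.down_up hw])

theorem up_neg {w : Plane} (hw : w ∉ halfLattice) : c.up (-w) = -c.up w :=
  c.up_eq (c.neg_mem_hat (c.up_mem hw)) (by rw [c.down_neg, c.down_up hw])

/-- The first bound keeps the annulus `|ρ - δ² / 2| < s₀` inside the `ε`-disc; the second keeps `ρ`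
positive on it, so polar coordinates extend to both sides of the circle. -/
theorem exists_inner_radius : ∃ s₀ > 0, s₀ < (c.ε ^ 2 - c.δ ^ 2) / 2 ∧ s₀ < c.δ ^ 2 / 4 ∧
    ∀ s, |s - c.δ ^ 2 / 2| < s₀ → c.ψ s = s - c.δ ^ 2 / 2 := by
  obtain ⟨s₀, hs₀, h⟩ := Metric.eventually_nhds_iff.1 c.ψ_inner
  have h1 : 0 < (c.ε ^ 2 - c.δ ^ 2) / 2 := by linarith [c.half_sq_lt]
  have h2 : 0 < c.δ ^ 2 / 4 := by have := c.δ_pos; positivity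
  refine ⟨min s₀ (min ((c.ε ^ 2 - c.δ ^ 2) / 2) (c.δ ^ 2 / 4)) / 2, by positivity, ?_, ?_, ?_⟩
  · have := (min_le_right s₀ _).trans (min_le_left ((c.ε ^ 2 - c.δ ^ 2) / 2) (c.δ ^ 2 / 4))
    linarith
  · have := (min_le_right s₀ _).trans (min_le_right ((c.ε ^ 2 - c.δ ^ 2) / 2) (c.δ ^ 2 / 4))
    linarith
  · intro s hs
    refine h ?_
    rw [Real.dist_eq]
    have := min_le_left s₀ (min ((c.ε ^ 2 - c.δ ^ 2) / 2) (c.δ ^ 2 / 4))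
    have h3 : 0 < min s₀ (min ((c.ε ^ 2 - c.δ ^ 2) / 2) (c.δ ^ 2 / 4)) := by positivity
    linarith

/-- A width of the annuli about the circles on which the blow-down map is `ρ ↦ ρ - δ² / 2`. -/
def s₀ : ℝ := c.exists_inner_radius.choose

theorem s₀_pos : 0 < c.s₀ := c.exists_inner_radius.choose_spec.1
theorem s₀_lt : c.s₀ < (c.ε ^ 2 - c.δ ^ 2) / 2 := c.exists_inner_radius.choose_spec.2.1
theorem s₀_lt' : c.s₀ < c.δ ^ 2 / 4 := c.exists_inner_radius.choose_spec.2.2.1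
theorem ψ_eq {s : ℝ} (h : |s - c.δ ^ 2 / 2| < c.s₀) : c.ψ s = s - c.δ ^ 2 / 2 :=
  c.exists_inner_radius.choose_spec.2.2.2 s h

theorem radial_eq {p : Plane} (h : |rho p - c.δ ^ 2 / 2| < c.s₀) :
    radial c.ψ p = Real.sqrt (1 - c.δ ^ 2 / ‖p‖ ^ 2) • p := by
  rw [radial, c.ψ_eq h]
  congr 2
  have h1 := c.s₀_lt'
  have h2 : 0 < rho p := by
    have := (abs_lt.1 h).1
    have := c.δ_pos
    nlinarith
  rw [sub_div, div_self h2.ne', rho, div_div_div_cancel_right₀ two_ne_zero]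

/-- In this range the blow-down map subtracts `δ² / 2` from the radial coordinate and keeps the
angle, so its inverse adds `δ² / 2`. -/
theorem up_near {a e : Plane} (ha : a ∈ halfLattice) (he : ‖e‖ = 1) {s : ℝ} (hs : 0 < s)
    (hs' : s < c.s₀) :
    c.up (a + Real.sqrt (2 * s) • e) = a + Real.sqrt (c.δ ^ 2 + 2 * s) • e := by
  have hδ := c.δ_pos
  have hn : ‖Real.sqrt (c.δ ^ 2 + 2 * s) • e‖ = Real.sqrt (c.δ ^ 2 + 2 * s) := by
    rw [norm_smul, he, mul_one, Real.norm_of_nonneg (Real.sqrt_nonneg _)]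
  have hsq : Real.sqrt (c.δ ^ 2 + 2 * s) ^ 2 = c.δ ^ 2 + 2 * s := Real.sq_sqrt (by positivity)
  have h1 : Real.sqrt (c.δ ^ 2 + 2 * s) ≤ c.ε := by
    refine Real.sqrt_le_iff.2 ⟨c.ε_pos.le, ?_⟩
    linarith [c.s₀_lt]
  refine c.up_eq ?_ ?_
  · rw [mem_hat, centerDist_add_of_lt ha (by rw [hn]; exact h1.trans_lt c.ε_lt), hn]
    exact Real.lt_sqrt_of_sq_lt (by linarith)
  · have hr : rho (Real.sqrt (c.δ ^ 2 + 2 * s) • e) = c.δ ^ 2 / 2 + s := by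
      rw [rho, hn, hsq]; ring
    rw [c.down_near ha (by rw [hn]; exact h1), c.radial_eq, hn, hsq, smul_smul,
      ← Real.sqrt_mul' _ (by positivity)]
    · congr 3
      field_simp
      ring
    · rw [hr, add_sub_cancel_left, abs_of_pos hs]; exact hs'

theorem contDiffAt_radial {p : Plane} (h1 : c.δ < ‖p‖) (h2 : ‖p‖ ≤ c.ε) :
    ContDiffAt ℝ ∞ (radial c.ψ) p := by
  obtain ⟨h3, h4⟩ := c.rho_mem h1 h2
  have hp : p ≠ 0 := norm_pos_iff.1 (c.δ_pos.trans h1)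
  have hpos : c.ψ (rho p) / rho p ≠ 0 := (div_pos (c.ψ_pos h3 h4) (rho_pos hp)).ne'
  exact (((c.ψ_smooth.contDiffAt.comp p contDiff_rho.contDiffAt).div contDiff_rho.contDiffAt
    (rho_pos hp).ne').sqrt hpos).smul contDiffAt_id

/-- Differentiating `ρ ∘ radial = ψ ∘ ρ` shows that a kernel vector is orthogonal to `p`, as `ψ' >
0`. On vectors orthogonal to `p` the derivative is multiplication by the positive number `√(ψ ρ /
ρ)`. -/
theorem isInvertible_fderiv_radial {p : Plane} (h1 : c.δ < ‖p‖) (h2 : ‖p‖ ≤ c.ε) :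
    (fderiv ℝ (radial c.ψ) p).IsInvertible := by
  obtain ⟨h3, h4⟩ := c.rho_mem h1 h2
  have hp : p ≠ 0 := norm_pos_iff.1 (c.δ_pos.trans h1)
  have hψ := c.ψ_pos h3 h4
  have hr := rho_pos hp
  have hψd : HasDerivAt c.ψ (deriv c.ψ (rho p)) (rho p) :=
    (c.ψ_smooth.differentiable (by simp)).differentiableAt.hasDerivAt
  have hB := ((c.contDiffAt_radial h1 h2).differentiableAt (by simp)).hasFDerivAt
  have hm : DifferentiableAt ℝ (fun s => Real.sqrt (c.ψ s / s)) (rho p) :=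
    (hψd.differentiableAt.div differentiableAt_id hr.ne').sqrt (div_pos hψ hr).ne'
  have hd1 : HasFDerivAt (radial c.ψ) _ p :=
    (hm.hasDerivAt.comp_hasFDerivAt p (hasFDerivAt_rho p)).smul (hasFDerivAt_id p)
  have hd2 : HasFDerivAt (fun q => rho (radial c.ψ q)) _ p :=
    (hasFDerivAt_rho (radial c.ψ p)).comp p hB
  have hd3 : HasFDerivAt (fun q => c.ψ (rho q)) _ p :=
    hψd.comp_hasFDerivAt p (hasFDerivAt_rho p)
  have hev : (fun q => rho (radial c.ψ q)) =ᶠ[𝓝 p] fun q => c.ψ (rho q) := by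
    have hc : ContinuousAt (fun q => c.ψ (rho q)) p :=
      (c.ψ_smooth.continuous.comp (contDiff_rho (n := 0)).continuous).continuousAt
    filter_upwards [hc.tendsto.eventually_const_lt hψ, eventually_ne_nhds hp] with q hq hq'
    exact rho_radial hq' hq.le
  refine isInvertible_of_injective rfl fun v hv => ?_
  have e1 := DFunLike.congr_fun (hd2.unique (hd3.congr_of_eventuallyEq hev)) v
  simp only [ContinuousLinearMap.comp_apply, hv, map_zero, smul_apply,
    innerSL_apply_apply, smul_eq_mul] at e1
  have e2 : inner ℝ p v = 0 := by
    rcases mul_eq_zero.1 e1.symm with h | h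
    · exact absurd h (c.ψ_deriv _ ⟨h3.le, h4⟩).ne'
    · exact h
  have e3 := DFunLike.congr_fun (hB.unique hd1) v
  rw [hv] at e3
  simp only [add_apply, smul_apply,
    ContinuousLinearMap.smulRight_apply, innerSL_apply_apply, e2, smul_zero, zero_smul,
    add_zero, ContinuousLinearMap.id_apply] at e3
  exact (smul_eq_zero.1 e3.symm).resolve_left (Real.sqrt_pos.2 (div_pos hψ hr)).ne'

theorem down_smooth {z : Plane} (hz : z ∈ c.hat) :
    ContDiffAt ℝ ∞ c.down z ∧ (fderiv ℝ c.down z).IsInvertible := by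
  rw [mem_hat] at hz
  rcases lt_or_ge (centerDist z) c.ε with h1 | h1
  · set a := center z with ha
    have hev : c.down =ᶠ[𝓝 z] fun y => a + radial c.ψ (y - a) := by
      have : ∀ᶠ y in 𝓝 z, ‖y - a‖ < c.ε :=
        ((continuous_id.sub continuous_const).norm.tendsto z).eventually_lt_const h1
      filter_upwards [this] with y hy
      have := c.down_near (p := y - a) (center_mem_halfLattice z) hy.le
      rwa [add_sub_cancel] at this
    have hc := c.contDiffAt_radial (p := z - a) hz h1.le
    have hs : ContDiffAt ℝ ∞ (fun y : Plane => y - a) z := contDiffAt_id.sub contDiffAt_const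
    refine ⟨(contDiffAt_const.add (ContDiffAt.comp z hc hs)).congr_of_eventuallyEq hev, ?_⟩
    have hfd : HasFDerivAt (fun y => a + radial c.ψ (y - a)) (fderiv ℝ (radial c.ψ) (z - a)) z := by
      have := (hc.differentiableAt (by simp)).hasFDerivAt.comp z ((hasFDerivAt_id z).sub_const a)
      exact (this.const_add a).congr_fderiv (by ext v; simp)
    rw [hev.fderiv_eq, hfd.fderiv]
    exact c.isInvertible_fderiv_radial hz h1.le
  · have hev : c.down =ᶠ[𝓝 z] id := by
      -- Exactly on the `ε`-circle, both branches are the identity nearby because `ψ s = s` on a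
      -- neighbourhood of `ε² / 2`.
      rcases h1.eq_or_lt with h | h
      · set a := center z with ha
        have hψ : ∀ᶠ y in 𝓝 z, c.ψ (rho (y - a)) = rho (y - a) := by
          have hc : Tendsto (fun y => rho (y - a)) (𝓝 z) (𝓝 (c.ε ^ 2 / 2)) := by
            have h' : c.ε ^ 2 / 2 = rho (z - a) := by rw [h]; rfl
            rw [h']
            exact ((contDiff_rho (n := 0)).continuous.comp
              (continuous_id.sub continuous_const)).tendsto z
          exact hc.eventually c.ψ_outer
        have hne : ∀ᶠ y in 𝓝 z, 0 < ‖y - a‖ := by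
          refine ((continuous_id.sub continuous_const).norm.tendsto z).eventually_const_lt ?_
          have : ‖z - a‖ = c.ε := h.symm
          change 0 < ‖z - a‖
          rw [this]
          exact c.ε_pos
        have hlt : ∀ᶠ y in 𝓝 z, ‖y - a‖ < 1 / 4 := by
          refine ((continuous_id.sub continuous_const).norm.tendsto z).eventually_lt_const ?_
          have : ‖z - a‖ = c.ε := h.symm
          change ‖z - a‖ < 1 / 4
          rw [this]
          exact c.ε_lt
        filter_upwards [hψ, hne, hlt] with y hy hy' hy''
        rcases le_or_gt ‖y - a‖ c.ε with h2 | h2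
        · have := c.down_near (p := y - a) (center_mem_halfLattice z) h2
          rw [add_sub_cancel] at this
          rw [this, radial, hy, div_self (rho_pos (norm_pos_iff.1 hy')).ne', Real.sqrt_one,
            one_smul, add_sub_cancel]
          rfl
        · refine c.down_far ?_
          rw [centerDist, center_eq (center_mem_halfLattice z) hy'']
          exact h2.le
      · filter_upwards [continuous_centerDist.continuousAt.eventually_const_lt h] with y hy
        exact c.down_far hy.le
    refine ⟨contDiffAt_id.congr_of_eventuallyEq hev, ?_⟩
    rw [hev.fderiv_eq, fderiv_id]
    exact ⟨.refl ℝ Plane, rfl⟩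

end Choices

end StochasticIsland
end

noncomputable section

namespace StochasticIsland

open Filter Set

/-! ### The projection to the plane -/

/-- The fibrewise primitive of a function on the plane. -/
def fiberPrimitive (b : ℝ × ℝ → ℝ) (q : ℝ × ℝ) : ℝ := ∫ s in (0 : ℝ)..q.2, b (q.1, s)

theorem continuous_fiberPrimitive {b : ℝ × ℝ → ℝ} (hb : Continuous b) :
    Continuous (fiberPrimitive b) :=
  intervalIntegral.continuous_parametric_primitive_of_continuous (f := fun x s => b (x, s)) hb

theorem hasDerivAt_fiberPrimitive_snd {b : ℝ × ℝ → ℝ} (hb : Continuous b) (x y : ℝ) :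
    HasDerivAt (fun y => fiberPrimitive b (x, y)) (b (x, y)) y := by
  have hc : Continuous fun s => b (x, s) := hb.comp (Continuous.prodMk_right x)
  exact intervalIntegral.integral_hasDerivAt_right (hc.intervalIntegrable _ _)
    hc.aestronglyMeasurable.stronglyMeasurableAtFilter hc.continuousAt

theorem hasDerivAt_fiberPrimitive_fst {b : ℝ × ℝ → ℝ} (hb : ContDiff ℝ 1 b) (x y : ℝ) :
    HasDerivAt (fun x => fiberPrimitive b (x, y))
      (fiberPrimitive (fun q => fderiv ℝ b q (1, 0)) (x, y)) x := by
  have hb' : Continuous fun q => fderiv ℝ b q (1, 0) :=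
    (hb.continuous_fderiv one_ne_zero).clm_apply continuous_const
  have hK : IsCompact (Icc (x - 1) (x + 1) ×ˢ uIcc 0 y) := isCompact_Icc.prod isCompact_uIcc
  obtain ⟨C, hC⟩ := hK.exists_bound_of_continuousOn hb'.continuousOn
  have hc : ∀ x', Continuous fun s => b (x', s) := fun x' => hb.continuous.comp (Continuous.prodMk_right x')
  have hc' : Continuous fun s => fderiv ℝ b (x, s) (1, 0) := hb'.comp (Continuous.prodMk_right x)
  exact (intervalIntegral.hasDerivAt_integral_of_dominated_loc_of_deriv_le
    (F := fun x s => b (x, s)) (F' := fun x s => fderiv ℝ b (x, s) (1, 0)) (bound := fun _ => C)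
    (Icc_mem_nhds (by linarith : x - 1 < x) (by linarith : x < x + 1))
    (.of_forall fun x' => (hc x').aestronglyMeasurable)
    ((hc x).intervalIntegrable _ _) hc'.aestronglyMeasurable
    (.of_forall fun s hs x' hx' => hC _ ⟨hx', uIoc_subset_uIcc hs⟩)
    intervalIntegrable_const
    (.of_forall fun s _ x' _ => by
      have h1 := (hb.differentiable one_ne_zero (x', s)).hasFDerivAt
      have h2 : HasDerivAt (fun x : ℝ => (x, s)) (1, 0) x' :=
        (hasDerivAt_id x').prodMk (hasDerivAt_const x' s)
      exact h1.comp_hasDerivAt x' h2)).2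

theorem hasFDerivAt_fiberPrimitive {b : ℝ × ℝ → ℝ} (hb : ContDiff ℝ 1 b) (q : ℝ × ℝ) :
    HasFDerivAt (fiberPrimitive b)
      (fiberPrimitive (fun q => fderiv ℝ b q (1, 0)) q • ContinuousLinearMap.fst ℝ ℝ ℝ +
        b q • ContinuousLinearMap.snd ℝ ℝ ℝ) q := by
  have hb' : Continuous fun q => fderiv ℝ b q (1, 0) :=
    (hb.continuous_fderiv one_ne_zero).clm_apply continuous_const
  have h := hasStrictFDerivAt_uncurry_coprod (𝕜 := ℝ) (u := q)
    (f := fun x y => fiberPrimitive b (x, y))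
    (f₁ := fun x y => ContinuousLinearMap.toSpanSingleton ℝ
      (fiberPrimitive (fun q => fderiv ℝ b q (1, 0)) (x, y)))
    (f₂ := fun x y => ContinuousLinearMap.toSpanSingleton ℝ (b (x, y)))
    (.of_forall fun v => (hasDerivAt_fiberPrimitive_fst hb v.1 v.2).hasFDerivAt)
    (.of_forall fun v => (hasDerivAt_fiberPrimitive_snd hb.continuous v.1 v.2).hasFDerivAt)
    ((ContinuousLinearMap.toSpanSingletonCLE (𝕜 := ℝ) (E := ℝ)).continuous.comp
      (continuous_fiberPrimitive hb')).continuousAt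
    ((ContinuousLinearMap.toSpanSingletonCLE (𝕜 := ℝ) (E := ℝ)).continuous.comp
      hb.continuous).continuousAt
  refine h.hasFDerivAt.congr_fderiv ?_
  ext <;> simp [Function.HasUncurry.uncurry]

/-- One partial derivative is the fibrewise primitive of `∂ₓ b`, the other is `b` itself; hence the
induction runs over all smooth `b` at once. -/
theorem contDiff_fiberPrimitive (n : ℕ) :
    ∀ {b : ℝ × ℝ → ℝ}, ContDiff ℝ ∞ b → ContDiff ℝ n (fiberPrimitive b) := by
  induction n with
  | zero => exact fun hb => contDiff_zero.2 (continuous_fiberPrimitive hb.continuous)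
  | succ n ih =>
    intro b hb
    push_cast
    refine contDiff_succ_iff_hasFDerivAt.2 ⟨_, ?_, hasFDerivAt_fiberPrimitive (hb.of_le (by simp))⟩
    have h1 : ContDiff ℝ ∞ fun q => fderiv ℝ b q (1, 0) :=
      (hb.fderiv_right (by simp)).clm_apply contDiff_const
    exact ((ih h1).smul contDiff_const).add ((hb.of_le (by exact_mod_cast le_top)).smul contDiff_const)

/-- The pair of coordinates, as a map to the plane. -/
def toPlane : ℝ × ℝ →L[ℝ] Plane :=
  (ContinuousLinearMap.fst ℝ ℝ ℝ).smulRight !₂[1, 0] +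
    (ContinuousLinearMap.snd ℝ ℝ ℝ).smulRight !₂[0, 1]

theorem toPlane_apply (q : ℝ × ℝ) : toPlane q = !₂[q.1, q.2] := by
  refine plane_ext ?_ ?_ <;> simp [toPlane]

/-- The coordinates of a point of the plane. -/
def ofPlane : Plane →L[ℝ] ℝ × ℝ :=
  (EuclideanSpace.proj 0 : Plane →L[ℝ] ℝ).prod (EuclideanSpace.proj 1)

theorem ofPlane_apply (z : Plane) : ofPlane z = (z 0, z 1) := rfl

theorem straighten_eq (κ : ℝ) (β : Plane → ℝ) :
    straighten κ β = fun q => κ • toPlane (q 0, fiberPrimitive (β ∘ toPlane) (ofPlane q)) := by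
  ext q : 1
  rw [straighten, toPlane_apply, fiberPrimitive, ofPlane_apply]
  simp only [Function.comp_apply, toPlane_apply]

namespace Choices

variable (c : Choices)

theorem contDiff_β_comp : ContDiff ℝ ∞ (c.β ∘ toPlane) := c.β_smooth.comp toPlane.contDiff

theorem contDiff_straighten : ContDiff ℝ 2 (straighten c.κ c.β) := by
  rw [straighten_eq]
  exact ContDiff.const_smul c.κ (toPlane.contDiff.comp
    ((EuclideanSpace.proj 0 : Plane →L[ℝ] ℝ).contDiff.prodMk
      ((contDiff_fiberPrimitive 2 c.contDiff_β_comp).comp ofPlane.contDiff)))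

/-- The differential is triangular with diagonal entries `κ` and `κ β`, neither of which vanishes.
-/
theorem isInvertible_fderiv_straighten (q : Plane) :
    (fderiv ℝ (straighten c.κ c.β) q).IsInvertible := by
  have h1 := (hasFDerivAt_fiberPrimitive (c.contDiff_β_comp.of_le (by simp)) (ofPlane q)).comp q
    ofPlane.hasFDerivAt
  have h2 := ((EuclideanSpace.proj 0 : Plane →L[ℝ] ℝ).hasFDerivAt (x := q)).prodMk h1
  have h3 := (toPlane.hasFDerivAt (x := (q 0, fiberPrimitive (c.β ∘ toPlane) (ofPlane q)))).comp q h2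
  obtain ⟨D, hD, hDv⟩ : ∃ D : Plane →L[ℝ] Plane, HasFDerivAt (straighten c.κ c.β) D q ∧
      ∀ v : Plane, D v = c.κ • toPlane (v 0,
        fiberPrimitive (fun q => fderiv ℝ (c.β ∘ toPlane) q (1, 0)) (ofPlane q) * v 0 +
          c.β (toPlane (ofPlane q)) * v 1) := by
    refine ⟨_, by rw [straighten_eq]; exact HasFDerivAt.const_smul h3 c.κ, fun v => rfl⟩
  rw [hD.fderiv]
  refine isInvertible_of_injective rfl fun v hv => ?_
  rw [hDv, smul_eq_zero, toPlane_apply] at hv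
  replace hv := hv.resolve_left c.κ_pos.ne'
  have v0 : v 0 = 0 := by simpa using congrArg (fun z : Plane => z 0) hv
  have v1 := congrArg (fun z : Plane => z 1) hv
  simp [v0, c.β_ne] at v1
  exact plane_ext v0 v1

/-- The first coordinate is kept up to scale. On a vertical line, equal values at two points would
by Rolle's theorem force a zero of `β`. -/
theorem straighten_injective : Function.Injective (straighten c.κ c.β) := by
  intro q q' h
  rw [straighten_eq] at h
  have h' := smul_right_injective _ c.κ_pos.ne' h
  simp only [toPlane_apply, ofPlane_apply] at h'
  have h0 : q 0 = q' 0 := by simpa using congrArg (fun z : Plane => z 0) h'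
  have h1 : fiberPrimitive (c.β ∘ toPlane) (q 0, q 1) =
      fiberPrimitive (c.β ∘ toPlane) (q 0, q' 1) := by
    have := congrArg (fun z : Plane => z 1) h'
    rw [← h0] at this
    simpa using this
  have hd := fun y => hasDerivAt_fiberPrimitive_snd c.contDiff_β_comp.continuous (q 0) y
  have hcont : Continuous fun y => fiberPrimitive (c.β ∘ toPlane) (q 0, y) :=
    continuous_iff_continuousAt.2 fun y => (hd y).continuousAt
  refine plane_ext h0 ?_
  rcases lt_trichotomy (q 1) (q' 1) with h2 | h2 | h2
  · obtain ⟨y, -, hy⟩ := exists_hasDerivAt_eq_zero h2 hcont.continuousOn h1 fun y _ => hd y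
    exact absurd hy (c.β_ne _)
  · exact h2
  · obtain ⟨y, -, hy⟩ := exists_hasDerivAt_eq_zero h2 hcont.continuousOn h1.symm fun y _ => hd y
    exact absurd hy (c.β_ne _)

/-- The projection of the torus to the plane. -/
def Phi (z : Plane) : Plane := straighten c.κ c.β (c.p z)

theorem Phi_eq_iff {z w : Plane} (hz : z ∉ lattice) (hw : w ∉ lattice) :
    c.Phi z = c.Phi w ↔ (z - w ∈ lattice ∨ z + w ∈ lattice) := by
  rw [← c.p_quotient.fiber z hz w hw]
  exact c.straighten_injective.eq_iff

theorem Phi_smooth {z : Plane} (hz : z ∉ halfLattice) :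
    ContDiffAt ℝ 2 c.Phi z ∧ (fderiv ℝ c.Phi z).IsInvertible := by
  have hp : ContDiffAt ℝ 2 c.p z :=
    (c.p_quotient.smooth.contDiffAt (isClosed_halfLattice.isOpen_compl.mem_nhds hz)).of_le
      (WithTop.coe_le_coe.2 (le_top : (2 : ℕ∞) ≤ ⊤))
  have hs := c.contDiff_straighten.contDiffAt (x := c.p z)
  refine ⟨hs.comp z hp, ?_⟩
  have hd : fderiv ℝ c.Phi z = (fderiv ℝ (straighten c.κ c.β) (c.p z)).comp (fderiv ℝ c.p z) :=
    fderiv_comp z (hs.differentiableAt (by simp)) (hp.differentiableAt (by simp))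
  rw [hd]
  have hpi : (fderiv ℝ c.p z).IsInvertible := by
    refine ⟨(fderiv ℝ c.p z).toContinuousLinearEquivOfDetNeZero (c.p_quotient.immersive z hz), ?_⟩
    ext v
    rfl
  exact (c.isInvertible_fderiv_straighten (c.p z)).comp hpi

theorem Phi_add {z l : Plane} (hz : z ∉ lattice) (hl : l ∈ lattice) : c.Phi (z + l) = c.Phi z := by
  have h : z + l ∉ lattice := fun h => hz (by simpa using sub_mem_lattice h hl)
  rw [c.Phi_eq_iff h hz, add_sub_cancel_left]
  exact Or.inl hl

theorem Phi_neg {z : Plane} (hz : z ∉ lattice) : c.Phi (-z) = c.Phi z := by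
  have h : -z ∉ lattice := fun h => hz (by simpa using neg_mem_lattice h)
  rw [c.Phi_eq_iff h hz, neg_add_cancel]
  exact Or.inr zero_mem_lattice

end Choices

end StochasticIsland
end

noncomputable section

namespace StochasticIsland

open Filter Set

/-! ### The semiconjugacy from the Anosov map -/

namespace Choices

variable (c : Choices)

theorem not_mem_halfLattice_of_mem_hat {z : Plane} (hz : z ∈ c.hat) : z ∉ halfLattice := by
  intro h
  rw [mem_hat, centerDist_eq_zero_iff.2 h] at hz
  linarith [c.δ_pos]

theorem not_mem_lattice_of_mem_hat {z : Plane} (hz : z ∈ c.hat) : z ∉ lattice :=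
  fun h => c.not_mem_halfLattice_of_mem_hat hz (lattice_subset_halfLattice h)

/-- The semiconjugacy from the Anosov map to the map of the disc. -/
def chi (w : Plane) : Plane := c.Phi (c.up w)

theorem chi_down {z : Plane} (hz : z ∈ c.hat) : c.chi (c.down z) = c.Phi z := by
  rw [chi, c.up_down hz]

/-- The blow-down map and its inverse commute with lattice translations and with `-id`, so the
fibres of `Phi` transfer to `chi`. -/
theorem chi_eq_iff {w w' : Plane} (hw : w ∉ halfLattice) (hw' : w' ∉ halfLattice) :
    c.chi w = c.chi w' ↔ (w - w' ∈ lattice ∨ w + w' ∈ lattice) := by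
  rw [chi, chi, c.Phi_eq_iff (c.not_mem_lattice_of_mem_hat (c.up_mem hw))
    (c.not_mem_lattice_of_mem_hat (c.up_mem hw'))]
  constructor
  · rintro (h | h)
    · left
      have := c.down_add (c.up w') (lattice_subset_halfLattice h)
      rw [add_sub_cancel, c.down_up hw, c.down_up hw'] at this
      rw [this]
      simpa using h
    · right
      have := c.down_add (-c.up w') (lattice_subset_halfLattice h)
      rw [neg_add_eq_sub, add_sub_cancel_right, c.down_neg, c.down_up hw, c.down_up hw'] at this
      rw [this, add_comm, ← add_assoc, add_neg_cancel, zero_add]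
      exact h
  · rintro (h | h)
    · left
      have := c.up_add hw' (lattice_subset_halfLattice h)
      rw [add_sub_cancel] at this
      rw [this]
      simpa using h
    · right
      have hn : -w' ∉ halfLattice := fun h' => hw' (by simpa using neg_mem_halfLattice h')
      have := c.up_add hn (lattice_subset_halfLattice h)
      rw [neg_add_eq_sub, add_sub_cancel_right, c.up_neg hw'] at this
      rw [this, add_comm, ← add_assoc, add_neg_cancel, zero_add]
      exact h

theorem chi_add {w l : Plane} (hw : w ∉ halfLattice) (hl : l ∈ lattice) :
    c.chi (w + l) = c.chi w := by
  have h : w + l ∉ halfLattice :=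
    fun h => hw (by simpa using sub_mem_halfLattice h (lattice_subset_halfLattice hl))
  rw [c.chi_eq_iff h hw, add_sub_cancel_left]
  exact Or.inl hl

theorem chi_neg {w : Plane} (hw : w ∉ halfLattice) : c.chi (-w) = c.chi w := by
  have h : -w ∉ halfLattice := fun h => hw (by simpa using neg_mem_halfLattice h)
  rw [c.chi_eq_iff h hw, neg_add_cancel]
  exact Or.inr zero_mem_lattice

/-- Near `up w` one has `chi ∘ down = Phi`, where `down` and `Phi` are both local diffeomorphisms.
No smoothness of `up`, which is defined by choice, is needed beforehand. -/
theorem chi_smooth {w : Plane} (hw : w ∉ halfLattice) :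
    ContDiffAt ℝ 2 c.chi w ∧ (fderiv ℝ c.chi w).IsInvertible := by
  have hz := c.up_mem hw
  obtain ⟨h1, h2⟩ := c.down_smooth hz
  obtain ⟨h3, h4⟩ := c.Phi_smooth (c.not_mem_halfLattice_of_mem_hat hz)
  have hev : ∀ᶠ x in 𝓝 (c.up w), c.chi (c.down x) = c.Phi x := by
    filter_upwards [c.isOpen_hat.mem_nhds hz] with x hx using c.chi_down hx
  have h1' : ContDiffAt ℝ 2 c.down (c.up w) :=
    h1.of_le (WithTop.coe_le_coe.2 (le_top : (2 : ℕ∞) ≤ ⊤))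
  have h5 := contDiffAt_of_comp h1' two_ne_zero h2 h3 hev
  have h6 : fderiv ℝ c.Phi (c.up w) =
      (fderiv ℝ c.chi (c.down (c.up w))).comp (fderiv ℝ c.down (c.up w)) := by
    rw [← fderiv_comp _ (h5.differentiableAt two_ne_zero) (h1'.differentiableAt two_ne_zero)]
    exact (EventuallyEq.fderiv_eq hev).symm
  rw [c.down_up hw] at h5 h6
  refine ⟨h5, ?_⟩
  rw [h6] at h4
  obtain ⟨e, he⟩ := h2
  obtain ⟨f, hf⟩ := h4
  refine ⟨e.symm.trans f, ?_⟩
  ext v : 1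
  have := DFunLike.congr_fun hf (e.symm v)
  rw [← he] at this
  simpa using this

theorem fderiv_chi_add {w l : Plane} (hw : w ∉ halfLattice) (hl : l ∈ lattice) :
    fderiv ℝ c.chi (w + l) = fderiv ℝ c.chi w := by
  rw [← fderiv_comp_add_right]
  refine EventuallyEq.fderiv_eq ?_
  filter_upwards [isClosed_halfLattice.isOpen_compl.mem_nhds hw] with x hx using c.chi_add hx hl

theorem fderiv_chi_neg {w : Plane} (hw : w ∉ halfLattice) :
    fderiv ℝ c.chi (-w) = -fderiv ℝ c.chi w := by
  have h : (fun x => c.chi (-x)) =ᶠ[𝓝 w] c.chi := by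
    filter_upwards [isClosed_halfLattice.isOpen_compl.mem_nhds hw] with x hx using c.chi_neg hx
  have hn : -w ∉ halfLattice := fun h => hw (by simpa using neg_mem_halfLattice h)
  have hd := ((c.chi_smooth hn).1.differentiableAt two_ne_zero).hasFDerivAt.comp w
    (hasFDerivAt_id w).neg
  have hd' : fderiv ℝ (fun x => c.chi (-x)) w = _ := HasFDerivAt.fderiv hd
  rw [← h.fderiv_eq, hd']
  ext v : 1
  simp

/-- The map is defined through an arbitrarily chosen preimage under `Phi`. Any other preimage
differs by a sign and a lattice vector, so a value common to all of them is the value of the map. -/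
theorem map_Phi {z y : Plane} (hz : z ∉ lattice)
    (h : ∀ z' ∉ lattice, (z' - z ∈ lattice ∨ z' + z ∈ lattice) →
      c.Phi (hatMap c.δ c.ε c.ψ c.ξ z') = y) : c.map (c.Phi z) = y := by
  have hex : ∃ z', z' ∉ lattice ∧ straighten c.κ c.β (c.p z') = c.Phi z := ⟨z, hz, rfl⟩
  rw [map, checkMap, dif_pos hex]
  obtain ⟨h1, h2⟩ := hex.choose_spec
  exact h _ h1 ((c.Phi_eq_iff h1 hz).1 h2)

theorem hatMap_of_mem_hat {z : Plane} (hz : z ∈ c.hat) :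
    hatMap c.δ c.ε c.ψ c.ξ z = c.up (anosov (c.down z)) :=
  if_pos hz

theorem anosov_not_mem {w : Plane} (hw : w ∉ halfLattice) : anosov w ∉ halfLattice :=
  fun h => hw (anosov_mem_halfLattice_iff.1 h)

theorem map_chi {w : Plane} (hw : w ∉ halfLattice) : c.map (c.chi w) = c.chi (anosov w) := by
  have hz := c.up_mem hw
  refine c.map_Phi (c.not_mem_lattice_of_mem_hat hz) ?_
  rintro z' - (h | h)
  · have e : z' = c.up w + (z' - c.up w) := by abel
    have hm : z' ∈ c.hat := by rw [e]; exact c.add_mem_hat (lattice_subset_halfLattice h) hz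
    rw [c.hatMap_of_mem_hat hm, e, c.down_add _ (lattice_subset_halfLattice h), c.down_up hw,
      anosov_add]
    exact c.chi_add (anosov_not_mem hw) (anosov_mem_lattice h)
  · have e : z' = -c.up w + (z' + c.up w) := by abel
    have hm : z' ∈ c.hat := by
      rw [e]; exact c.add_mem_hat (lattice_subset_halfLattice h) (c.neg_mem_hat hz)
    rw [c.hatMap_of_mem_hat hm, e, c.down_add _ (lattice_subset_halfLattice h), c.down_neg,
      c.down_up hw, anosov_add, anosov_neg]
    have hn : -anosov w ∉ halfLattice :=
      fun h' => anosov_not_mem hw (by simpa using neg_mem_halfLattice h')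
    have := c.chi_add hn (anosov_mem_lattice h)
    rw [c.chi_neg (anosov_not_mem hw)] at this
    exact this

end Choices

end StochasticIsland
end

noncomputable section

namespace StochasticIsland

open Filter Set

/-! ### The flow near the boundary circles -/

/-- The linear flow with time-`sigma` map the Anosov map. -/
def linFlow (z : Plane) (t : ℝ) : Plane :=
  (Real.exp t * uC z) • eU + (Real.exp (-t) * vC z) • eS

theorem uC_linFlow (z : Plane) (t : ℝ) : uC (linFlow z t) = Real.exp t * uC z := by
  simp [linFlow, uC_add, uC_smul, uC_eU, uC_eS]

theorem vC_linFlow (z : Plane) (t : ℝ) : vC (linFlow z t) = Real.exp (-t) * vC z := by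
  simp [linFlow, vC_add, vC_smul, vC_eU, vC_eS]

theorem linFlow_zero (z : Plane) : linFlow z 0 = z :=
  frame_ext (by simp [uC_linFlow]) (by simp [vC_linFlow])

theorem linFlow_sigma (z : Plane) : linFlow z sigma = anosov z :=
  frame_ext (by rw [uC_linFlow, uC_anosov]) (by rw [vC_linFlow, vC_anosov])

theorem linFlow_ne_zero {z : Plane} (hz : z ≠ 0) (t : ℝ) : linFlow z t ≠ 0 := by
  intro h
  apply hz
  have hu := uC_linFlow z t
  have hv := vC_linFlow z t
  rw [h] at hu hv
  have z1 : uC (0 : Plane) = 0 := inner_zero_right _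
  have z2 : vC (0 : Plane) = 0 := inner_zero_right _
  rw [z1, eq_comm, mul_eq_zero] at hu
  rw [z2, eq_comm, mul_eq_zero] at hv
  refine frame_ext ?_ ?_
  · rw [z1]; exact hu.resolve_left (Real.exp_pos _).ne'
  · rw [z2]; exact hv.resolve_left (Real.exp_pos _).ne'

theorem hasDerivAt_linFlow (z : Plane) (t : ℝ) :
    HasDerivAt (linFlow z) (uC (linFlow z t) • eU - vC (linFlow z t) • eS) t := by
  have h1 := ((Real.hasDerivAt_exp t).mul_const (uC z)).smul_const eU
  have h2 := (((hasDerivAt_neg t).exp).mul_const (vC z)).smul_const eS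
  refine (h1.add h2).congr_deriv ?_
  rw [uC_linFlow, vC_linFlow]
  simp [sub_eq_add_neg]

theorem hasDerivAt_norm_sq_linFlow (z : Plane) (t : ℝ) :
    HasDerivAt (fun t => ‖linFlow z t‖ ^ 2)
      (2 * (uC (linFlow z t) ^ 2 - vC (linFlow z t) ^ 2)) t := by
  have h1 := ((Real.hasDerivAt_exp t).mul_const (uC z)).pow 2
  have h2 := (((hasDerivAt_neg t).exp).mul_const (vC z)).pow 2
  have e : (fun t => ‖linFlow z t‖ ^ 2) =
      (fun t => (Real.exp t * uC z) ^ 2 + (Real.exp (-t) * vC z) ^ 2) := by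
    ext t; rw [norm_sq_frame, uC_linFlow, vC_linFlow]
  rw [e]
  refine (h1.add h2).congr_deriv ?_
  rw [uC_linFlow, vC_linFlow]
  ring

/-- The Hamiltonian vector field where the cut-off function is one. -/
def outerField (δ : ℝ) (z : Plane) : Plane :=
  uC z • eU - vC z • eS - (δ ^ 2 * (uC z ^ 2 - vC z ^ 2) / (‖z‖ ^ 2) ^ 2) • z

/-- The trajectories of `outerField`. -/
def outerFlow (δ : ℝ) (z : Plane) (t : ℝ) : Plane :=
  Real.sqrt (1 - δ ^ 2 / ‖z‖ ^ 2 + δ ^ 2 / ‖linFlow z t‖ ^ 2) • linFlow z t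

theorem outer_ne_zero {δ : ℝ} {z : Plane} (hδ : 0 < δ) (hz : δ ≤ ‖z‖) : z ≠ 0 := norm_pos_iff.1 (hδ.trans_le hz)

theorem outer_coeff_nonneg {δ : ℝ} {z : Plane} (hδ : 0 < δ) (hz : δ ≤ ‖z‖) : 0 ≤ 1 - δ ^ 2 / ‖z‖ ^ 2 := by
  have h := hδ.trans_le hz
  rw [sub_nonneg, div_le_one (by positivity)]
  exact pow_le_pow_left₀ hδ.le hz 2

theorem outer_root_pos {δ : ℝ} {z : Plane} (hδ : 0 < δ) (hz : δ ≤ ‖z‖) (t : ℝ) :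
    0 < 1 - δ ^ 2 / ‖z‖ ^ 2 + δ ^ 2 / ‖linFlow z t‖ ^ 2 := by
  have h1 := norm_pos_iff.2 (linFlow_ne_zero (outer_ne_zero hδ hz) t)
  have h2 := outer_coeff_nonneg hδ hz
  positivity

/-- `outerFlow` is `linFlow` conjugated by the radial map that subtracts `δ² / 2` from `ρ`. The
factor `1 - δ² / ‖z‖²` is the squared ratio of radii under that map; it vanishes on the circle of
radius `δ`, which is therefore invariant. -/
theorem norm_sq_outerFlow {δ : ℝ} {z : Plane} (hδ : 0 < δ) (hz : δ ≤ ‖z‖) (t : ℝ) :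
    ‖outerFlow δ z t‖ ^ 2 = δ ^ 2 + (1 - δ ^ 2 / ‖z‖ ^ 2) * ‖linFlow z t‖ ^ 2 := by
  have h1 := norm_pos_iff.2 (linFlow_ne_zero (outer_ne_zero hδ hz) t)
  rw [outerFlow, norm_smul, mul_pow, Real.norm_eq_abs, sq_abs,
    Real.sq_sqrt (outer_root_pos hδ hz t).le]
  field_simp
  ring

theorem outerFlow_zero (δ : ℝ) (z : Plane) : outerFlow δ z 0 = z := by
  rw [outerFlow, linFlow_zero]
  simp

theorem hasDerivAt_outerFlow {δ : ℝ} {z : Plane} (hδ : 0 < δ) (hz : δ ≤ ‖z‖) (t : ℝ) :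
    HasDerivAt (outerFlow δ z) (outerField δ (outerFlow δ z t)) t := by
  have hN := norm_pos_iff.2 (linFlow_ne_zero (outer_ne_zero hδ hz) t)
  have hq := outer_root_pos hδ hz t
  have hn := norm_sq_outerFlow hδ hz t
  set w := linFlow z t with hw
  set g := Real.sqrt (1 - δ ^ 2 / ‖z‖ ^ 2 + δ ^ 2 / ‖w‖ ^ 2) with hg
  have hg0 : 0 < g := Real.sqrt_pos.2 hq
  have hg2 : g ^ 2 = 1 - δ ^ 2 / ‖z‖ ^ 2 + δ ^ 2 / ‖w‖ ^ 2 := Real.sq_sqrt hq.le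
  have hn' : ‖outerFlow δ z t‖ ^ 2 = g ^ 2 * ‖w‖ ^ 2 := by
    rw [hn, hg2]; field_simp; ring
  have hd := (((hasDerivAt_const t (δ ^ 2)).div (hasDerivAt_norm_sq_linFlow z t)
    (by positivity)).const_add (1 - δ ^ 2 / ‖z‖ ^ 2)).sqrt hq.ne'
  refine (hd.smul (hasDerivAt_linFlow z t)).congr_deriv ?_
  have hof : outerFlow δ z t = g • w := rfl
  rw [outerField, hn', hof, uC_smul, vC_smul]
  rw [← hw]
  have hw0 : ‖w‖ ≠ 0 := hN.ne'
  have e : (0 * ‖w‖ ^ 2 - δ ^ 2 * (2 * (uC w ^ 2 - vC w ^ 2))) / (‖w‖ ^ 2) ^ 2 / (2 * g) =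
      -(δ ^ 2 * ((g * uC w) ^ 2 - (g * vC w) ^ 2) / (g ^ 2 * ‖w‖ ^ 2) ^ 2) * g := by
    field_simp
    ring
  have hc : Real.sqrt (1 - δ ^ 2 / ‖z‖ ^ 2 +
      ((fun _ => δ ^ 2 : ℝ → ℝ) / fun t => ‖linFlow z t‖ ^ 2) t) = g := rfl
  rw [hc, e]
  module

/-- Multiplication by a bump function equal to one on the `R`-ball makes the field compactly
supported, hence bounded, Lipschitz and complete. Curves that stay in the ball do not notice the
change. The modified field `Y` is part of the conclusion, as a source of global trajectories. -/
theorem exists_contDiff_timeMap_of_bounded {E : Type} [NormedAddCommGroup E] [NormedSpace ℝ E]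
    [FiniteDimensional ℝ E] {X : E → E} (hX : ContDiff ℝ 2 X) {T : ℝ} (hT : 0 ≤ T) {R : ℝ}
    (hR : 0 < R) :
    ∃ S : E → E, ContDiff ℝ 2 S ∧ (∀ γ : ℝ → E, (∀ t ∈ Icc 0 T, HasDerivAt γ (X (γ t)) t) →
      (∀ t ∈ Icc 0 T, ‖γ t‖ ≤ R) → γ T = S (γ 0)) ∧
      ∃ Y : E → E, (∃ K, LipschitzWith K Y) ∧ (∀ x, ‖x‖ ≤ R → Y x = X x) ∧
        ∀ z, ∃ γ : ℝ → E, γ 0 = z ∧ ∀ t, HasDerivAt γ (Y (γ t)) t := by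
  have : ProperSpace E := FiniteDimensional.proper_real E
  let b : ContDiffBump (0 : E) := ⟨R, R + 1, hR, by linarith⟩
  let Y : E → E := fun x => b x • X x
  have hY : ContDiff ℝ 2 Y := b.contDiff.smul hX
  have hc : HasCompactSupport Y := b.hasCompactSupport.smul_right
  obtain ⟨K, hK⟩ := hY.lipschitzWith_of_hasCompactSupport hc two_ne_zero
  obtain ⟨B, hB⟩ := hc.exists_bound_of_continuous hY.continuous
  have hB0 : 0 ≤ B := (norm_nonneg _).trans (hB 0)
  have hYX : ∀ x, ‖x‖ ≤ R → Y x = X x := by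
    intro x hx
    have : b x = 1 := b.one_of_mem_closedBall (by simpa using hx)
    simp [Y, this]
  have htraj := fun z => exists_trajectory hK (B := ⟨B, hB0⟩) hB z
  obtain ⟨S, hS, hS'⟩ := exists_contDiff_timeMap (n := 2) hY two_ne_zero hK hT
  refine ⟨S, hS, fun γ hγ hb => ?_, Y, ⟨K, hK⟩, hYX, htraj⟩
  obtain ⟨α, h0, hα⟩ := htraj (γ 0)
  have := ODE_solution_unique (v := fun _ => Y) (K := K) (f := γ) (g := α) (a := 0) (b := T)
    (fun _ => hK) (fun t ht => (hγ t ht).continuousAt.continuousWithinAt)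
    (fun t ht => by
      rw [hYX _ (hb t (Ico_subset_Icc_self ht))]
      exact (hγ t (Ico_subset_Icc_self ht)).hasDerivWithinAt)
    (fun t _ => (hα t).continuousAt.continuousWithinAt) (fun t _ => (hα t).hasDerivWithinAt) h0.symm
  rw [this (right_mem_Icc.2 hT), hS' α hα, h0]

theorem eq_of_trajectories {E : Type} [NormedAddCommGroup E] [NormedSpace ℝ E]
    [FiniteDimensional ℝ E] {X : E → E} (hX : ContDiff ℝ 2 X) {T : ℝ} (hT : 0 ≤ T)
    {γ γ' : ℝ → E} (hγ : ∀ t ∈ Icc 0 T, HasDerivAt γ (X (γ t)) t)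
    (hγ' : ∀ t ∈ Icc 0 T, HasDerivAt γ' (X (γ' t)) t) (h : γ 0 = γ' 0) : γ T = γ' T := by
  obtain ⟨B, hB⟩ := (isCompact_Icc (a := (0 : ℝ)) (b := T)).exists_bound_of_continuousOn
    (f := γ) fun t ht => (hγ t ht).continuousAt.continuousWithinAt
  obtain ⟨B', hB'⟩ := (isCompact_Icc (a := (0 : ℝ)) (b := T)).exists_bound_of_continuousOn
    (f := γ') fun t ht => (hγ' t ht).continuousAt.continuousWithinAt
  obtain ⟨S, -, hS, -⟩ := exists_contDiff_timeMap_of_bounded hX hT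
    (R := max 1 (max B B')) (lt_max_of_lt_left one_pos)
  rw [hS γ hγ fun t ht => (hB t ht).trans ((le_max_left _ _).trans (le_max_right _ _)),
    hS γ' hγ' fun t ht => (hB' t ht).trans ((le_max_right _ _).trans (le_max_right _ _)), h]

theorem hamField_eq (H : Plane → ℝ) (z : Plane) :
    hamField H z = toPlane (fderiv ℝ H z !₂[0, 1], -fderiv ℝ H z !₂[1, 0]) := by
  rw [toPlane_apply]; rfl

theorem contDiff_hamField {H : Plane → ℝ} (hH : ContDiff ℝ ∞ H) : ContDiff ℝ ∞ (hamField H) := by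
  have h : ContDiff ℝ ∞ (fderiv ℝ H) := hH.fderiv_right (by simp)
  have e : hamField H = fun z => toPlane (fderiv ℝ H z !₂[0, 1], -fderiv ℝ H z !₂[1, 0]) :=
    funext (hamField_eq H)
  rw [e]
  exact toPlane.contDiff.comp ((h.clm_apply contDiff_const).prodMk (h.clm_apply contDiff_const).neg)

/-! ### The Hamiltonian field of the construction and its time map. -/

namespace Choices

variable (c : Choices)

/-- The only singularity, from `δ² / ‖z‖²` at the origin, lies where the cut-off vanishes
identically. -/
theorem contDiff_hamiltonian : ContDiff ℝ ∞ (hamiltonian c.δ c.ξ) := by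
  refine contDiff_iff_contDiffAt.2 fun z => ?_
  by_cases hz : z = 0
  · have hev : hamiltonian c.δ c.ξ =ᶠ[𝓝 z] fun _ => 0 := by
      have : ∀ᶠ y in 𝓝 z, ‖y‖ < c.r :=
        (continuous_norm.tendsto z).eventually_lt_const (by rw [hz, norm_zero]; exact c.r_pos)
      filter_upwards [this] with y hy
      have h0 : c.ξ (rho y) = 0 := by
        refine c.ξ_zero _ ⟨by rw [rho]; positivity, ?_⟩
        rw [rho]
        have := pow_le_pow_left₀ (norm_nonneg y) hy.le 2
        linarith
      rw [hamiltonian, h0, mul_zero]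
    exact contDiffAt_const.congr_of_eventuallyEq hev
  · have h1 : ContDiffAt ℝ ∞ (fun z : Plane => ‖z‖ ^ 2) z := (contDiff_norm_sq ℝ).contDiffAt
    have h2 : ContDiffAt ℝ ∞ (fun z : Plane => inner ℝ eU z) z := (innerSL ℝ eU).contDiff.contDiffAt
    have h3 : ContDiffAt ℝ ∞ (fun z : Plane => inner ℝ eS z) z := (innerSL ℝ eS).contDiff.contDiffAt
    have h4 : ‖z‖ ^ 2 ≠ 0 := by
      have := norm_pos_iff.2 hz
      positivity
    exact ((contDiffAt_const.sub (contDiffAt_const.div h1 h4)).mul (h2.mul h3)).mul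
      (c.ξ_smooth.contDiffAt.comp z contDiff_rho.contDiffAt)

/-- The Hamiltonian vector field of the construction. -/
def field : Plane → Plane := hamField (hamiltonian c.δ c.ξ)

theorem contDiff_field : ContDiff ℝ ∞ c.field := contDiff_hamField c.contDiff_hamiltonian

theorem hamiltonian_neg (z : Plane) : hamiltonian c.δ c.ξ (-z) = hamiltonian c.δ c.ξ z := by
  simp only [hamiltonian, norm_neg, inner_neg_right, rho_neg, neg_mul_neg]

theorem field_neg (z : Plane) : c.field (-z) = -c.field z := by
  have hd := (c.contDiff_hamiltonian.differentiable (by simp) (-z)).hasFDerivAt.comp z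
    (hasFDerivAt_id z).neg
  have e : hamiltonian c.δ c.ξ ∘ (fun z => -id z) = hamiltonian c.δ c.ξ :=
    funext fun z => c.hamiltonian_neg z
  have h := hd.fderiv
  change fderiv ℝ (hamiltonian c.δ c.ξ ∘ (fun z => -id z)) z = _ at h
  rw [e] at h
  rw [field, hamField_eq, hamField_eq, h, ← map_neg toPlane]
  congr 1
  simp

theorem field_eq_of_lt {z : Plane} (hz : c.δ < ‖z‖) : c.field z = outerField c.δ z := by
  have hz0 : 0 < ‖z‖ := c.δ_pos.trans hz
  have hev : hamiltonian c.δ c.ξ =ᶠ[𝓝 z]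
      fun y => (1 - c.δ ^ 2 / ‖y‖ ^ 2) * (inner ℝ eU y * inner ℝ eS y) := by
    filter_upwards [(continuous_norm.tendsto z).eventually_const_lt hz] with y hy
    have h1 : c.ξ (rho y) = 1 := by
      refine c.ξ_one _ ?_
      rw [rho]
      have := pow_le_pow_left₀ c.δ_pos.le hy.le 2
      linarith
    rw [hamiltonian, h1, mul_one]
  have h1 := (hasStrictFDerivAt_norm_sq z).hasFDerivAt
  have h2 := ((hasFDerivAt_const (c.δ ^ 2) z).mul
    ((hasDerivAt_inv (x := ‖z‖ ^ 2) (by positivity)).comp_hasFDerivAt z h1)).const_sub 1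
  have h3 := h2.mul (((innerSL ℝ eU).hasFDerivAt (x := z)).mul ((innerSL ℝ eS).hasFDerivAt (x := z)))
  have hd : ∀ v, fderiv ℝ (hamiltonian c.δ c.ξ) z v =
      (2 * c.δ ^ 2 * inner ℝ z v / (‖z‖ ^ 2) ^ 2) * (uC z * vC z) +
        (1 - c.δ ^ 2 / ‖z‖ ^ 2) * (uC v * vC z + uC z * vC v) := by
    intro v
    have h4 : HasFDerivAt (hamiltonian c.δ c.ξ) _ z := h3.congr_of_eventuallyEq hev
    rw [h4.fderiv]
    simp [uC, vC]
    ring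
  have hx : ∀ v : Plane, inner ℝ z v = uC z * uC v + vC z * vC v := by
    intro v
    rw [inner_plane, uC_eq, uC_eq, vC_eq, vC_eq]
    linear_combination (-(z 0 * v 0 + z 1 * v 1)) * eU_sq
  have n2 : ‖z‖ ^ 2 = uC z ^ 2 + vC z ^ 2 := norm_sq_frame z
  have n0 : uC z ^ 2 + vC z ^ 2 ≠ 0 := by rw [← n2]; positivity
  have u0 : uC !₂[1, 0] = eU 0 := by rw [uC_eq]; simp
  have u1 : uC !₂[0, 1] = eU 1 := by rw [uC_eq]; simp
  have v0 : vC !₂[1, 0] = -eU 1 := by rw [vC_eq]; simp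
  have v1 : vC !₂[0, 1] = eU 0 := by rw [vC_eq]; simp
  have hcomp : c.field z = !₂[fderiv ℝ (hamiltonian c.δ c.ξ) z !₂[0, 1],
    -fderiv ℝ (hamiltonian c.δ c.ξ) z !₂[1, 0]] := rfl
  rw [hcomp, hd, hd, hx, hx, n2, u0, u1, v0, v1, outerField, n2]
  refine frame_ext ?_ ?_
  · rw [uC_sub, uC_sub, uC_smul, uC_smul, uC_smul, uC_eU, uC_eS, uC_eq]
    simp only [Matrix.cons_val_zero, Matrix.cons_val_one]
    generalize uC z = u at *
    generalize vC z = v at *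
    field_simp
    linear_combination (u * (u ^ 2 + v ^ 2) ^ 2 - c.δ ^ 2 * u * (u ^ 2 - v ^ 2)) * eU_sq
  · rw [vC_sub, vC_sub, vC_smul, vC_smul, vC_smul, vC_eU, vC_eS, vC_eq]
    simp only [Matrix.cons_val_zero, Matrix.cons_val_one]
    generalize uC z = u at *
    generalize vC z = v at *
    field_simp
    linear_combination (-v * (u ^ 2 + v ^ 2) ^ 2 - c.δ ^ 2 * v * (u ^ 2 - v ^ 2)) * eU_sq


/-- On the circle itself the cut-off is known to equal one only on the outer side, so the identity
is obtained as a limit along the outward ray. -/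
theorem field_eq {z : Plane} (hz : c.δ ≤ ‖z‖) : c.field z = outerField c.δ z := by
  rcases hz.lt_or_eq with h | h
  · exact c.field_eq_of_lt h
  have hz0 : z ≠ 0 := outer_ne_zero c.δ_pos hz
  have hcl : ∀ᶠ t : ℝ in 𝓝[>] 1, c.field (t • z) = outerField c.δ (t • z) := by
    filter_upwards [self_mem_nhdsWithin] with t ht
    refine c.field_eq_of_lt ?_
    have ht' : (1 : ℝ) < t := ht
    rw [norm_smul, Real.norm_of_nonneg (by linarith), ← h]
    nlinarith [c.δ_pos]
  have h1 : Tendsto (fun t : ℝ => t • z) (𝓝[>] 1) (𝓝 z) := by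
    have : Continuous fun t : ℝ => t • z := by fun_prop
    simpa using (this.tendsto 1).mono_left nhdsWithin_le_nhds
  have h2 : ContinuousAt (outerField c.δ) z := by
    have hu : Continuous uC := continuous_const.inner continuous_id
    have hv : Continuous vC := continuous_const.inner continuous_id
    have : (‖z‖ ^ 2) ^ 2 ≠ 0 := by
      have := norm_pos_iff.2 hz0
      positivity
    exact (((hu.smul continuous_const).sub (hv.smul continuous_const)).continuousAt).sub
      (((continuous_const.mul ((hu.pow 2).sub (hv.pow 2))).continuousAt.div
        ((continuous_norm.pow 2).pow 2).continuousAt this).smul continuousAt_id)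
  exact tendsto_nhds_unique_of_eventuallyEq ((c.contDiff_field.continuous.tendsto z).comp h1)
    (h2.tendsto.comp h1) hcl

theorem contDiff_field_two : ContDiff ℝ 2 c.field :=
  c.contDiff_field.of_le (WithTop.coe_le_coe.2 (le_top : (2 : ℕ∞) ≤ ⊤))

theorem delta_le_norm_outerFlow {z : Plane} (hz : c.δ ≤ ‖z‖) (t : ℝ) :
    c.δ ≤ ‖outerFlow c.δ z t‖ := by
  have h := norm_sq_outerFlow c.δ_pos hz t
  have h2 := outer_coeff_nonneg c.δ_pos hz
  refine le_of_pow_le_pow_left₀ two_ne_zero (norm_nonneg _) ?_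
  rw [h]
  nlinarith [mul_nonneg h2 (sq_nonneg ‖linFlow z t‖)]

theorem norm_outerFlow_of_eq {z : Plane} (hz : ‖z‖ = c.δ) (t : ℝ) :
    ‖outerFlow c.δ z t‖ = c.δ := by
  have h := norm_sq_outerFlow c.δ_pos hz.ge t
  have hδ := c.δ_pos
  rw [hz, div_self (by positivity), sub_self, zero_mul, add_zero] at h
  exact (pow_left_inj₀ (norm_nonneg _) hδ.le two_ne_zero).1 h

theorem hasDerivAt_outerFlow_field {z : Plane} (hz : c.δ ≤ ‖z‖) (t : ℝ) :
    HasDerivAt (outerFlow c.δ z) (c.field (outerFlow c.δ z t)) t := by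
  rw [c.field_eq (c.delta_le_norm_outerFlow hz t)]
  exact hasDerivAt_outerFlow c.δ_pos hz t

theorem norm_outerFlow_le {z : Plane} (hz : c.δ ≤ ‖z‖) (hz' : ‖z‖ ≤ 2 * c.δ) {t : ℝ}
    (ht : t ∈ Icc 0 sigma) : ‖outerFlow c.δ z t‖ ≤ c.δ + 4 * Real.exp sigma * c.δ := by
  have hδ := c.δ_pos
  have h := norm_sq_outerFlow c.δ_pos hz t
  have h2 : 1 - c.δ ^ 2 / ‖z‖ ^ 2 ≤ 1 := by
    have : 0 ≤ c.δ ^ 2 / ‖z‖ ^ 2 := by positivity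
    linarith
  have h3 : ‖linFlow z t‖ ≤ 4 * Real.exp sigma * c.δ := by
    refine (norm_le_abs_add_abs _).trans ?_
    rw [uC_linFlow, vC_linFlow, abs_mul, abs_mul, Real.abs_exp, Real.abs_exp]
    have e1 : Real.exp t ≤ Real.exp sigma := Real.exp_le_exp.2 ht.2
    have e2 : Real.exp (-t) ≤ Real.exp sigma := Real.exp_le_exp.2 (by linarith [ht.1, sigma_pos])
    have := mul_le_mul e1 ((abs_uC_le z).trans hz') (abs_nonneg _) (Real.exp_pos _).le
    have := mul_le_mul e2 ((abs_vC_le z).trans hz') (abs_nonneg _) (Real.exp_pos _).le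
    linarith
  have h4 : 0 ≤ 4 * Real.exp sigma * c.δ := (norm_nonneg _).trans h3
  refine le_of_pow_le_pow_left₀ two_ne_zero (by linarith) ?_
  rw [h]
  have := mul_le_mul h2 (pow_le_pow_left₀ (norm_nonneg _) h3 2) (by positivity) one_pos.le
  nlinarith

/-- Inside the disc the required map is the Hamiltonian time map, outside it is the explicit
`outerFlow`. Both are restrictions of the time map of one smooth field, cut off far away, so they
fit together as a C² map across the circle. Oddness of the field passes to the time map. -/
theorem exists_timeMap : ∃ S : Plane → Plane, ContDiff ℝ 2 S ∧
    (∀ z, ‖z‖ ≤ c.δ → timeMap c.field sigma z = S z ∧ ‖S z‖ ≤ c.δ ∧ S (-z) = -S z) ∧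
    ∀ z, c.δ ≤ ‖z‖ → ‖z‖ ≤ 2 * c.δ → S z = outerFlow c.δ z sigma := by
  have hδ := c.δ_pos
  -- This radius is the bound of `norm_outerFlow_le`, so trajectories that start in `δ ≤ ‖z‖ ≤ 2δ`
  -- stay where the cut-off field is the original one.
  have hR : c.δ ≤ c.δ + 4 * Real.exp sigma * c.δ := by
    have := Real.exp_pos sigma
    nlinarith [mul_pos this hδ]
  obtain ⟨S, hS, hS', Y, ⟨K, hK⟩, hYX, htraj⟩ := exists_contDiff_timeMap_of_bounded
    c.contDiff_field_two sigma_pos.le (hδ.trans_le hR)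
  have inner : ∀ z, ‖z‖ ≤ c.δ → ∃ γ : ℝ → Plane, γ 0 = z ∧ (∀ t, ‖γ t‖ ≤ c.δ) ∧
      ∀ t, HasDerivAt γ (c.field (γ t)) t := by
    intro z hz
    obtain ⟨γ, h0, hγ⟩ := htraj z
    have hb : ∀ t, ‖γ t‖ ≤ c.δ := by
      intro t
      by_contra! hlt
      have hcont : Continuous fun t => ‖γ t‖ :=
        (continuous_iff_continuousAt.2 fun t => (hγ t).continuousAt).norm
      -- A trajectory that leaves the disc meets the circle; by uniqueness it then coincides with a
      -- trajectory that stays on the circle for all time.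
      obtain ⟨t₁, ht₁⟩ : c.δ ∈ range fun t => ‖γ t‖ :=
        mem_range_of_exists_le_of_exists_ge hcont ⟨0, by rwa [h0]⟩ ⟨t, hlt.le⟩
      have h1 : ∀ s, HasDerivAt (fun s => outerFlow c.δ (γ t₁) (s - t₁))
          (Y (outerFlow c.δ (γ t₁) (s - t₁))) s := by
        intro s
        rw [hYX _ (by rw [c.norm_outerFlow_of_eq ht₁]; exact hR)]
        exact (c.hasDerivAt_outerFlow_field ht₁.ge (s - t₁)).comp_sub_const s t₁
      have h2 := trajectory_unique hK hγ h1 (t₀ := t₁) (by rw [sub_self, outerFlow_zero])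
      rw [h2, c.norm_outerFlow_of_eq ht₁] at hlt
      exact lt_irrefl _ hlt
    refine ⟨γ, h0, hb, fun t => ?_⟩
    rw [← hYX _ ((hb t).trans hR)]
    exact hγ t
  refine ⟨S, hS, fun z hz => ?_, fun z hz hz' => ?_⟩
  · obtain ⟨γ, h0, hb, hγ⟩ := inner z hz
    have e : S z = γ sigma := by
      rw [← h0]; exact (hS' γ (fun t _ => hγ t) fun t _ => (hb t).trans hR).symm
    refine ⟨?_, e ▸ hb _, ?_⟩
    · have hex : ∃ γ : ℝ → Plane, γ 0 = z ∧ ∀ t, HasDerivAt γ (c.field (γ t)) t := ⟨γ, h0, hγ⟩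
      rw [timeMap, dif_pos hex, e]
      exact eq_of_trajectories c.contDiff_field_two sigma_pos.le
        (fun t _ => hex.choose_spec.2 t) (fun t _ => hγ t) (by rw [hex.choose_spec.1, h0])
    · rw [e]
      have := hS' (fun t => -γ t) (fun t _ => by rw [c.field_neg]; exact (hγ t).neg)
        (fun t _ => by rw [norm_neg]; exact (hb t).trans hR)
      simpa [h0] using this.symm
  · have := hS' (outerFlow c.δ z) (fun t _ => c.hasDerivAt_outerFlow_field hz t)
      (fun t ht => c.norm_outerFlow_le hz hz' ht)
    rw [this, outerFlow_zero]

/-- A smooth extension of the return map near the circle of radius `δ`. -/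
def ringMap : Plane → Plane := c.exists_timeMap.choose

theorem contDiff_ringMap : ContDiff ℝ 2 c.ringMap := c.exists_timeMap.choose_spec.1

theorem ringMap_inner {z : Plane} (hz : ‖z‖ ≤ c.δ) :
    timeMap c.field sigma z = c.ringMap z ∧ ‖c.ringMap z‖ ≤ c.δ ∧
      c.ringMap (-z) = -c.ringMap z :=
  c.exists_timeMap.choose_spec.2.1 z hz

theorem ringMap_outer {z : Plane} (hz : c.δ ≤ ‖z‖) (hz' : ‖z‖ ≤ 2 * c.δ) :
    c.ringMap z = outerFlow c.δ z sigma :=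
  c.exists_timeMap.choose_spec.2.2 z hz hz'

theorem norm_ringMap {z : Plane} (hz : ‖z‖ = c.δ) : ‖c.ringMap z‖ = c.δ := by
  rw [c.ringMap_outer hz.ge (by linarith [c.δ_pos]), c.norm_outerFlow_of_eq hz]

theorem add_not_mem_halfLattice {a p : Plane} (ha : a ∈ halfLattice) (hp : p ≠ 0)
    (hp' : ‖p‖ < 1 / 4) : a + p ∉ halfLattice := by
  intro h
  rw [← centerDist_eq_zero_iff, centerDist_add_of_lt ha hp', norm_eq_zero] at h
  exact hp h

theorem Phi_anosov {a y : Plane} (ha : a ∈ halfLattice) (hy : a + y ∉ lattice) :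
    c.Phi (anosov a + y) = c.Phi (a + y) := by
  rw [← c.Phi_add hy (anosov_sub_mem_lattice ha)]
  congr 1
  abel

theorem map_Phi_inner {i : Fin 4} {z : Plane} (hz : ‖z‖ ≤ c.δ) (hz0 : z ≠ 0)
    (hz' : c.ringMap z ≠ 0) : c.map (c.Phi (Omega i + z)) = c.Phi (Omega i + c.ringMap z) := by
  have hδ := c.δ_lt
  have hε := c.ε_lt
  obtain ⟨h1, h2, h3⟩ := c.ringMap_inner hz
  have hO := Omega_mem_halfLattice i
  have hno : ∀ {y : Plane}, y ≠ 0 → ‖y‖ ≤ c.δ → ∀ {a}, a ∈ halfLattice → a + y ∉ lattice :=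
    fun hy hy' a ha h => add_not_mem_halfLattice ha hy (by linarith) (lattice_subset_halfLattice h)
  have hhat : ∀ {a y : Plane}, a ∈ halfLattice → ‖y‖ ≤ c.δ →
      hatMap c.δ c.ε c.ψ c.ξ (a + y) = anosov a + timeMap c.field sigma y := by
    intro a y ha hy
    have hn : a + y ∉ hatIsland c.δ := by
      change a + y ∉ c.hat
      rw [mem_hat, centerDist_add_of_lt ha (by linarith)]
      exact not_lt.2 hy
    rw [hatMap, if_neg hn, center_add ha (by linarith), add_sub_cancel_left]
    rfl
  refine c.map_Phi (hno hz0 hz hO) ?_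
  rintro z' - (h | h)
  · have e : z' = (Omega i + (z' - (Omega i + z))) + z := by abel
    have ha : Omega i + (z' - (Omega i + z)) ∈ halfLattice :=
      add_mem_halfLattice hO (lattice_subset_halfLattice h)
    rw [e, hhat ha hz, h1, c.Phi_anosov ha (hno hz' h2 ha), add_right_comm,
      c.Phi_add (hno hz' h2 hO) h]
  · have e : z' = (-Omega i + (z' + (Omega i + z))) + -z := by abel
    have ha : -Omega i + (z' + (Omega i + z)) ∈ halfLattice :=
      add_mem_halfLattice (neg_mem_halfLattice hO) (lattice_subset_halfLattice h)
    have hz'' : ‖-z‖ ≤ c.δ := by rwa [norm_neg]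
    have hn1 : -c.ringMap z ≠ 0 := neg_ne_zero.2 hz'
    have hn2 : ‖-c.ringMap z‖ ≤ c.δ := by rwa [norm_neg]
    rw [e, hhat ha hz'', (c.ringMap_inner hz'').1, h3, c.Phi_anosov ha (hno hn1 hn2 ha),
      add_right_comm, c.Phi_add (hno hn1 hn2 (neg_mem_halfLattice hO)) h, ← neg_add,
      c.Phi_neg (hno hz' h2 hO)]

/-- The two smallness conditions keep `z` and its image in the annulus where the blow-down map
subtracts `δ² / 2` from `ρ`. There `up ∘ anosov ∘ down` is the time-`sigma` map of `outerFlow`, up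
to a lattice translation. -/
theorem map_Phi_outer {i : Fin 4} {z : Plane} (hz : c.δ < ‖z‖) (hz' : ‖z‖ ≤ 2 * c.δ)
    (h1 : |rho z - c.δ ^ 2 / 2| < c.s₀)
    (h2 : (1 - c.δ ^ 2 / ‖z‖ ^ 2) * ‖anosov z‖ ^ 2 / 2 < c.s₀) :
    c.map (c.Phi (Omega i + z)) = c.Phi (Omega i + c.ringMap z) := by
  have hδ := c.δ_pos
  have hO := Omega_mem_halfLattice i
  have hz0 : z ≠ 0 := outer_ne_zero c.δ_pos hz.le
  have hk : 0 < 1 - c.δ ^ 2 / ‖z‖ ^ 2 := by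
    rw [sub_pos, div_lt_one (by positivity)]
    exact pow_lt_pow_left₀ hz hδ.le two_ne_zero
  set k := 1 - c.δ ^ 2 / ‖z‖ ^ 2 with hkd
  have hzε : ‖z‖ < c.ε := by
    have h3 := (abs_lt.1 h1).2
    have h4 := c.s₀_lt
    rw [rho] at h3
    exact lt_of_pow_lt_pow_left₀ 2 c.ε_pos.le (by linarith)
  have hAz : anosov z ≠ 0 := by
    rw [← linFlow_sigma]; exact linFlow_ne_zero hz0 _
  have hN : 0 < ‖anosov z‖ := norm_pos_iff.2 hAz
  have hhat : Omega i + z ∈ c.hat := by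
    rw [mem_hat, centerDist_add_of_lt hO (hzε.trans c.ε_lt)]; exact hz
  have hdown : c.down (Omega i + z) = Omega i + Real.sqrt k • z := by
    rw [c.down_near hO hzε.le, c.radial_eq h1]
  have hw : c.down (Omega i + z) ∉ halfLattice := c.mapsTo_down hhat
  have hup := c.up_near (a := anosov (Omega i)) (e := ‖anosov z‖⁻¹ • anosov z)
    (anosov_mem_halfLattice_iff.2 hO)
    (by rw [norm_smul, norm_inv, norm_norm, inv_mul_cancel₀ hN.ne'])
    (s := k * ‖anosov z‖ ^ 2 / 2) (by positivity) h2
  have e1 : Real.sqrt (2 * (k * ‖anosov z‖ ^ 2 / 2)) • ‖anosov z‖⁻¹ • anosov z =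
      Real.sqrt k • anosov z := by
    rw [mul_div_cancel₀ _ two_ne_zero, Real.sqrt_mul hk.le, Real.sqrt_sq hN.le, smul_smul,
      mul_assoc, mul_inv_cancel₀ hN.ne', mul_one]
  have e2 : Real.sqrt (c.δ ^ 2 + 2 * (k * ‖anosov z‖ ^ 2 / 2)) • ‖anosov z‖⁻¹ • anosov z =
      c.ringMap z := by
    rw [c.ringMap_outer hz.le hz', outerFlow, linFlow_sigma, smul_smul]
    congr 1
    have : c.δ ^ 2 + 2 * (k * ‖anosov z‖ ^ 2 / 2) =
        (k + c.δ ^ 2 / ‖anosov z‖ ^ 2) * ‖anosov z‖ ^ 2 := by field_simp; ring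
    rw [this, Real.sqrt_mul' _ (by positivity), Real.sqrt_sq hN.le, mul_assoc,
      mul_inv_cancel₀ hN.ne', mul_one]
  rw [e1, e2] at hup
  have hmem : anosov (Omega i) + Real.sqrt k • anosov z ∉ halfLattice := by
    rw [← anosov_smul, ← anosov_add, ← hdown]
    exact anosov_not_mem hw
  have hl := c.up_mem hmem
  rw [hup] at hl
  rw [← c.chi_down hhat, c.map_chi hw, hdown, anosov_add, anosov_smul, chi, hup,
    c.Phi_anosov hO]
  intro h'
  apply c.not_mem_lattice_of_mem_hat hl
  have := add_mem_lattice h' (anosov_sub_mem_lattice hO)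
  convert this using 1
  abel

/-- Both definitions of the torus map are given near the circle by the same C² map `ringMap`; this
is what makes `c.map` C² across its boundary circles. -/
theorem map_Phi_near (i : Fin 4) {z₀ : Plane} (hz : ‖z₀‖ = c.δ) :
    ∀ᶠ z in 𝓝 z₀, c.map (c.Phi (Omega i + z)) = c.Phi (Omega i + c.ringMap z) := by
  have hδ := c.δ_pos
  have h0 : z₀ ≠ 0 := outer_ne_zero hδ hz.ge
  have hS0 : c.ringMap z₀ ≠ 0 := outer_ne_zero hδ (c.norm_ringMap hz).ge
  have hn : ContinuousAt (fun z : Plane => ‖z‖) z₀ := continuous_norm.continuousAt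
  have hA : Continuous anosov := by
    have : anosov = anosovL := funext fun z => (anosovL_apply z).symm
    rw [this]; exact anosovL.continuous
  have h1 : ∀ᶠ z in 𝓝 z₀, |rho z - c.δ ^ 2 / 2| < c.s₀ := by
    refine ((((contDiff_rho (n := 0)).continuous.sub continuous_const).abs).tendsto
      z₀).eventually_lt_const ?_
    change |‖z₀‖ ^ 2 / 2 - c.δ ^ 2 / 2| < c.s₀
    rw [hz, sub_self, abs_zero]
    exact c.s₀_pos
  have h2 : ∀ᶠ z in 𝓝 z₀, (1 - c.δ ^ 2 / ‖z‖ ^ 2) * ‖anosov z‖ ^ 2 / 2 < c.s₀ := by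
    have hc : ContinuousAt (fun z => (1 - c.δ ^ 2 / ‖z‖ ^ 2) * ‖anosov z‖ ^ 2 / 2) z₀ :=
      ((continuousAt_const.sub (continuousAt_const.div (hn.pow 2)
        (by change ‖z₀‖ ^ 2 ≠ 0; rw [hz]; positivity))).mul (hA.norm.pow 2).continuousAt).div_const 2
    refine hc.tendsto.eventually_lt_const ?_
    rw [hz, div_self (by positivity), sub_self, zero_mul, zero_div]
    exact c.s₀_pos
  filter_upwards [h1, h2, hn.eventually_lt_const (by rw [hz]; linarith : ‖z₀‖ < 2 * c.δ),
    eventually_ne_nhds h0, c.contDiff_ringMap.continuous.continuousAt.eventually_ne hS0]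
    with z a1 a2 a3 a4 a5
  rcases le_or_gt ‖z‖ c.δ with h | h
  · exact c.map_Phi_inner h a4 a5
  · exact c.map_Phi_outer h a3.le a1 a2

theorem ring_not_mem (i : Fin 4) {z : Plane} (hz : ‖z‖ = c.δ) : Omega i + z ∉ halfLattice :=
  add_not_mem_halfLattice (Omega_mem_halfLattice i) (outer_ne_zero c.δ_pos hz.ge)
    (by linarith [c.δ_lt, c.ε_lt])

theorem contDiffAt_Phi_add (i : Fin 4) {z : Plane} (hz : Omega i + z ∉ halfLattice) :
    ContDiffAt ℝ 2 (fun y => c.Phi (Omega i + y)) z ∧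
      (fderiv ℝ (fun y => c.Phi (Omega i + y)) z).IsInvertible := by
  obtain ⟨h1, h2⟩ := c.Phi_smooth hz
  refine ⟨ContDiffAt.comp (g := c.Phi) z h1 (contDiffAt_const.add contDiffAt_id), ?_⟩
  rwa [fderiv_comp_add_left]

theorem contDiffAt_map_ring (i : Fin 4) {z : Plane} (hz : ‖z‖ = c.δ) :
    ContDiffAt ℝ 2 c.map (c.Phi (Omega i + z)) := by
  obtain ⟨h1, h2⟩ := c.contDiffAt_Phi_add i (c.ring_not_mem i hz)
  exact contDiffAt_of_comp (f := fun y => c.Phi (Omega i + y)) h1 two_ne_zero h2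
    (ContDiffAt.comp (g := fun y => c.Phi (Omega i + y)) z (c.contDiffAt_Phi_add i (c.ring_not_mem i (c.norm_ringMap hz))).1
      c.contDiff_ringMap.contDiffAt) (c.map_Phi_near i hz)

theorem contDiffAt_map_chi {w : Plane} (hw : w ∉ halfLattice) :
    ContDiffAt ℝ 2 c.map (c.chi w) := by
  obtain ⟨h1, h2⟩ := c.chi_smooth hw
  have hA : ContDiffAt ℝ 2 (fun x => c.chi (anosovL x)) w :=
    ContDiffAt.comp (g := c.chi) w (by rw [anosovL_apply]; exact (c.chi_smooth (anosov_not_mem hw)).1)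
      anosovL.contDiff.contDiffAt
  refine contDiffAt_of_comp h1 two_ne_zero h2 hA ?_
  filter_upwards [isClosed_halfLattice.isOpen_compl.mem_nhds hw] with x hx
  rw [c.map_chi hx, anosovL_apply]

end Choices

end StochasticIsland
end

noncomputable section

namespace StochasticIsland

open Filter Set

/-! ### Polar charts, the island of the model map and its boundary -/

theorem eAngle_add_int_mul_pi (t : ℝ) (k : ℤ) :
    eAngle (t + k * Real.pi) = eAngle t ∨ eAngle (t + k * Real.pi) = -eAngle t := by
  rcases Int.even_or_odd' k with ⟨m, h | h⟩
  · left
    rw [eq_comm, eAngle_eq_iff]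
    exact ⟨m, by rw [h]; push_cast; ring⟩
  · right
    rw [← eAngle_add_pi, eq_comm, eAngle_eq_iff]
    exact ⟨m, by rw [h]; push_cast; ring⟩

theorem exp_sigma_gt : 17 < Real.exp sigma := by
  rw [exp_sigma]; linarith [two_lt_sqrt_five]

theorem exp_neg_sigma_lt : Real.exp (-sigma) < 1 / 17 := by
  rw [Real.exp_neg, inv_lt_comm₀ (Real.exp_pos _) (by norm_num)]
  linarith [exp_sigma_gt]

theorem anosov_ne_self {z : Plane} (hz : z ≠ 0) : anosov z ≠ z ∧ anosov z ≠ -z := by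
  have h1 := exp_sigma_gt
  have h2 := exp_neg_sigma_lt
  have h3 := Real.exp_pos (-sigma)
  have z1 : uC (0 : Plane) = 0 := inner_zero_right _
  have z2 : vC (0 : Plane) = 0 := inner_zero_right _
  constructor
  · intro h
    have hu := uC_anosov z
    have hv := vC_anosov z
    rw [h] at hu hv
    apply hz
    refine frame_ext ?_ ?_
    · rw [z1]
      have : (Real.exp sigma - 1) * uC z = 0 := by linarith
      exact (mul_eq_zero.1 this).resolve_left (by linarith)
    · rw [z2]
      have : (Real.exp (-sigma) - 1) * vC z = 0 := by linarith
      exact (mul_eq_zero.1 this).resolve_left (by linarith)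
  · intro h
    have hu := uC_anosov z
    have hv := vC_anosov z
    rw [h, uC_neg] at hu
    rw [h, vC_neg] at hv
    apply hz
    refine frame_ext ?_ ?_
    · rw [z1]
      have : (Real.exp sigma + 1) * uC z = 0 := by linarith
      exact (mul_eq_zero.1 this).resolve_left (by linarith)
    · rw [z2]
      have : (Real.exp (-sigma) + 1) * vC z = 0 := by linarith
      exact (mul_eq_zero.1 this).resolve_left (by linarith)

namespace Choices

variable (c : Choices)

/-- Symplectic polar coordinates about the origin, the radial one being shifted by `δ² / 2`. -/
def ringPt (q : ℝ × ℝ) : Plane := Real.sqrt (c.δ ^ 2 + 2 * q.1) • eAngle q.2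

theorem ring_pos {s : ℝ} (hs : |s| < c.s₀) : 0 < c.δ ^ 2 + 2 * s := by
  have h1 := c.s₀_lt'
  have h2 := (abs_lt.1 hs).1
  have := c.δ_pos
  nlinarith [sq_nonneg c.δ]

theorem norm_ringPt (q : ℝ × ℝ) : ‖c.ringPt q‖ = Real.sqrt (c.δ ^ 2 + 2 * q.1) := by
  rw [ringPt, norm_smul, norm_eAngle, mul_one, Real.norm_of_nonneg (Real.sqrt_nonneg _)]

theorem norm_ringPt_lt {q : ℝ × ℝ} (hq : |q.1| < c.s₀) : ‖c.ringPt q‖ < 1 / 4 := by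
  refine lt_trans ?_ c.ε_lt
  rw [norm_ringPt, Real.sqrt_lt' c.ε_pos]
  linarith [c.s₀_lt, (abs_lt.1 hq).2]

theorem ringPt_ne_zero {q : ℝ × ℝ} (hq : |q.1| < c.s₀) : c.ringPt q ≠ 0 := by
  rw [← norm_pos_iff, norm_ringPt]
  exact Real.sqrt_pos.2 (c.ring_pos hq)

theorem contDiffAt_ringPt {q : ℝ × ℝ} (hq : |q.1| < c.s₀) :
    ContDiffAt ℝ 2 c.ringPt q ∧ (fderiv ℝ c.ringPt q).IsInvertible := by
  have hp := c.ring_pos hq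
  have h0 : 0 < Real.sqrt (c.δ ^ 2 + 2 * q.1) := Real.sqrt_pos.2 hp
  have h1 : ContDiffAt ℝ 2 (fun q : ℝ × ℝ => Real.sqrt (c.δ ^ 2 + 2 * q.1)) q :=
    (contDiffAt_const.add (contDiffAt_const.mul contDiffAt_fst)).sqrt hp.ne'
  refine ⟨h1.smul (contDiff_eAngle.contDiffAt.comp q contDiffAt_snd), ?_⟩
  have d1 : HasFDerivAt (fun q : ℝ × ℝ => Real.sqrt (c.δ ^ 2 + 2 * q.1)) _ q :=
    ((Real.hasDerivAt_sqrt hp.ne').comp_hasFDerivAt q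
      (((ContinuousLinearMap.fst ℝ ℝ ℝ).hasFDerivAt.const_mul 2).const_add (c.δ ^ 2)))
  have d2 := (hasDerivAt_eAngle q.2).hasFDerivAt.comp q
    (ContinuousLinearMap.snd ℝ ℝ ℝ).hasFDerivAt
  have d3 : HasFDerivAt c.ringPt _ q := d1.smul d2
  rw [d3.fderiv]
  refine isInvertible_of_injective (by simp) fun v hv => ?_
  have hu := congrArg (fun z => uC z) hv
  have hw := congrArg (fun z => vC z) hv
  have z1 : uC (0 : Plane) = 0 := inner_zero_right _
  have z2 : vC (0 : Plane) = 0 := inner_zero_right _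
  simp [uC_add, uC_smul, uC_eAngle, vC_add, vC_smul, vC_eAngle, Real.cos_add_pi_div_two,
    Real.sin_add_pi_div_two, z1, z2] at hu hw
  set r := Real.sqrt (c.δ ^ 2 + 2 * q.1) with hr
  have e1 : r⁻¹ * v.1 = 0 := by
    linear_combination Real.cos q.2 * hu + Real.sin q.2 * hw -
      (r⁻¹ * v.1) * Real.sin_sq_add_cos_sq q.2
  have e2 : r * v.2 = 0 := by
    linear_combination -Real.sin q.2 * hu + Real.cos q.2 * hw -
      (r * v.2) * Real.sin_sq_add_cos_sq q.2
  refine Prod.ext ?_ ?_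
  · exact (mul_eq_zero.1 e1).resolve_left (inv_ne_zero h0.ne')
  · exact (mul_eq_zero.1 e2).resolve_left (ne_of_gt h0)

/-- The chart near the `i`-th circle. -/
def polar (i : Fin 4) (q : ℝ × ℝ) : Plane := c.Phi (Omega i + c.ringPt q)

theorem polar_not_mem (i : Fin 4) {q : ℝ × ℝ} (hq : |q.1| < c.s₀) :
    Omega i + c.ringPt q ∉ halfLattice :=
  add_not_mem_halfLattice (Omega_mem_halfLattice i) (c.ringPt_ne_zero hq) (c.norm_ringPt_lt hq)

theorem polar_smooth (i : Fin 4) {q : ℝ × ℝ} (hq : |q.1| < c.s₀) :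
    ContDiffAt ℝ 2 (c.polar i) q ∧ (fderiv ℝ (c.polar i) q).IsInvertible := by
  obtain ⟨h1, h2⟩ := c.contDiffAt_ringPt hq
  obtain ⟨h3, h4⟩ := c.contDiffAt_Phi_add i (c.polar_not_mem i hq)
  refine ⟨ContDiffAt.comp (g := fun y => c.Phi (Omega i + y)) q h3 h1, ?_⟩
  have : fderiv ℝ (c.polar i) q = _ := fderiv_comp (g := fun y => c.Phi (Omega i + y)) q
    (h3.differentiableAt two_ne_zero) (h1.differentiableAt two_ne_zero)
  rw [this]
  exact h4.comp h2

theorem Phi_Omega_neg (i : Fin 4) {z : Plane} (hz : Omega i + z ∉ lattice) :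
    c.Phi (Omega i + -z) = c.Phi (Omega i + z) := by
  have hn : -(Omega i + z) ∉ lattice := fun h => hz (by simpa using neg_mem_lattice h)
  rw [← c.Phi_neg hz, ← c.Phi_add hn (two_smul_Omega i)]
  congr 1
  abel

theorem polar_eq_of_angle (i : Fin 4) {s t : ℝ} (hs : |s| < c.s₀) (k : ℤ) :
    c.polar i (s, t + k * Real.pi) = c.polar i (s, t) := by
  have hl : Omega i + c.ringPt (s, t) ∉ lattice :=
    fun h => c.polar_not_mem i hs (lattice_subset_halfLattice h)
  rcases eAngle_add_int_mul_pi t k with h | h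
  · simp only [polar, ringPt, h]
  · rw [polar, polar, ← c.Phi_Omega_neg i hl]
    simp only [ringPt, h, smul_neg]

/-- The discs of radius `1 / 4` about the half lattice are disjoint, so the sign and lattice
translation that identify two such points must also match their centres. -/
theorem Phi_Omega_eq {i j : Fin 4} {z w : Plane} (hz : z ≠ 0) (hz' : ‖z‖ < 1 / 4) (hw : w ≠ 0)
    (hw' : ‖w‖ < 1 / 4) (h : c.Phi (Omega i + z) = c.Phi (Omega j + w)) :
    i = j ∧ (z = w ∨ z = -w) := by
  have hi := Omega_mem_halfLattice i
  have hj := Omega_mem_halfLattice j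
  have no : ∀ {k y}, y ≠ 0 → ‖y‖ < 1 / 4 → Omega k + y ∉ lattice := fun hy hy' h =>
    add_not_mem_halfLattice (Omega_mem_halfLattice _) hy hy' (lattice_subset_halfLattice h)
  rcases (c.Phi_eq_iff (no hz hz') (no hw hw')).1 h with h | h
  · set l := Omega i + z - (Omega j + w) with hl
    have e : Omega i + z = (Omega j + l) + w := by rw [hl]; abel
    have h1 := center_add hi hz'
    rw [e, center_add (add_mem_halfLattice hj (lattice_subset_halfLattice h)) hw'] at h1
    have hij : i = j := Omega_inj (by rw [← h1, add_sub_cancel_left]; exact h)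
    subst hij
    refine ⟨rfl, Or.inl ?_⟩
    rw [h1] at e
    exact add_left_cancel e
  · set l := Omega i + z + (Omega j + w) with hl
    have e : Omega i + z = (-Omega j + l) + -w := by rw [hl]; abel
    have h1 := center_add hi hz'
    rw [e, center_add (add_mem_halfLattice (neg_mem_halfLattice hj)
      (lattice_subset_halfLattice h)) (by rwa [norm_neg])] at h1
    have hij : i = j := Omega_inj (by
      have h2 := sub_mem_lattice h (two_smul_Omega j)
      rw [← h1]
      convert h2 using 1
      abel)
    subst hij
    refine ⟨rfl, Or.inr ?_⟩
    rw [h1] at e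
    exact add_left_cancel e

theorem polar_inj {i j : Fin 4} {q q' : ℝ × ℝ} (hq : |q.1| < c.s₀) (hq' : |q'.1| < c.s₀)
    (h : c.polar i q = c.polar j q') : i = j ∧ q.1 = q'.1 ∧ ∃ k : ℤ, q'.2 = q.2 + k * Real.pi := by
  obtain ⟨hij, h1⟩ := c.Phi_Omega_eq (c.ringPt_ne_zero hq) (c.norm_ringPt_lt hq)
    (c.ringPt_ne_zero hq') (c.norm_ringPt_lt hq') h
  have hn : ‖c.ringPt q‖ = ‖c.ringPt q'‖ := by
    rcases h1 with h1 | h1 <;> rw [h1]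
    rw [norm_neg]
  rw [norm_ringPt, norm_ringPt] at hn
  have hs : q.1 = q'.1 := by
    have := congrArg (fun x => x ^ 2) hn
    simp only [Real.sq_sqrt (c.ring_pos hq).le, Real.sq_sqrt (c.ring_pos hq').le] at this
    linarith
  refine ⟨hij, hs, eAngle_eq_or_neg ?_⟩
  have h0 : Real.sqrt (c.δ ^ 2 + 2 * q'.1) ≠ 0 := (Real.sqrt_pos.2 (c.ring_pos hq')).ne'
  rw [ringPt, ringPt, hn, ← smul_neg] at h1
  exact h1.imp (fun h => smul_right_injective _ h0 h) (fun h => smul_right_injective _ h0 h)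

theorem circle_eq (i : Fin 4) (t : ℝ) : c.circle i t = c.polar i (0, t) := by
  simp only [circle, polar, ringPt, Phi, mul_zero, add_zero, Real.sqrt_sq c.δ_pos.le]

theorem chi_polar (i : Fin 4) {s : ℝ} (hs : 0 < s) (hs' : s < c.s₀) (t : ℝ) :
    c.chi (Omega i + Real.sqrt (2 * s) • eAngle t) = c.polar i (s, t) := by
  rw [chi, c.up_near (Omega_mem_halfLattice i) (norm_eAngle t) hs hs']
  rfl

/-- The island of the model map. -/
def isl : Set Plane := c.chi '' halfLatticeᶜ

/-- The closure of the island of the model map. -/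
def clIsl : Set Plane := c.isl ∪ ⋃ i, range (c.circle i)

theorem isl_eq : c.isl = c.Phi '' c.hat := by
  ext x
  constructor
  · rintro ⟨w, hw, rfl⟩
    exact ⟨c.up w, c.up_mem hw, rfl⟩
  · rintro ⟨z, hz, rfl⟩
    exact ⟨c.down z, c.mapsTo_down hz, c.chi_down hz⟩

theorem mem_hat_of_Phi_mem {z : Plane} (hz : z ∉ lattice) (h : c.Phi z ∈ c.isl) : z ∈ c.hat := by
  rw [isl_eq] at h
  obtain ⟨y, hy, he⟩ := h
  rcases (c.Phi_eq_iff hz (c.not_mem_lattice_of_mem_hat hy)).1 he.symm with h | h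
  · have := c.add_mem_hat (lattice_subset_halfLattice h) hy
    rwa [add_sub_cancel] at this
  · have := c.add_mem_hat (lattice_subset_halfLattice h) (c.neg_mem_hat hy)
    rwa [add_comm z y, neg_add_cancel_left] at this

theorem pos_of_polar_mem {i : Fin 4} {q : ℝ × ℝ} (hq : |q.1| < c.s₀) (h : c.polar i q ∈ c.isl) :
    0 < q.1 := by
  have := c.mem_hat_of_Phi_mem
    (fun h => c.polar_not_mem i hq (lattice_subset_halfLattice h)) h
  rw [mem_hat, centerDist_add_of_lt (Omega_mem_halfLattice i) (c.norm_ringPt_lt hq), norm_ringPt,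
    Real.lt_sqrt c.δ_pos.le] at this
  linarith

theorem polar_mem {i : Fin 4} {q : ℝ × ℝ} (hq : 0 < q.1) (hq' : q.1 < c.s₀) :
    c.polar i q ∈ c.isl := by
  refine ⟨_, ?_, c.chi_polar i hq hq' q.2⟩
  refine add_not_mem_halfLattice (Omega_mem_halfLattice i) ?_ ?_
  · rw [← norm_pos_iff, norm_smul, norm_eAngle, mul_one, Real.norm_of_nonneg (Real.sqrt_nonneg _)]
    exact Real.sqrt_pos.2 (by linarith)
  · rw [norm_smul, norm_eAngle, mul_one, Real.norm_of_nonneg (Real.sqrt_nonneg _)]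
    refine lt_trans ?_ c.ε_lt
    rw [Real.sqrt_lt' c.ε_pos]
    nlinarith [c.s₀_lt, c.δ_pos]

/-- The set `δ ≤ centerDist` is closed and periodic, and the ball contains a fundamental domain;
this exhibits the closed island as the image of a compact set. -/
theorem clIsl_eq : c.clIsl = c.Phi '' ({z | c.δ ≤ centerDist z} ∩ Metric.closedBall 0 2) := by
  have hδ := c.δ_pos
  have hnl : ∀ {z}, c.δ ≤ centerDist z → z ∉ lattice := fun hz h => by
    rw [centerDist_eq_zero_iff.2 (lattice_subset_halfLattice h)] at hz
    linarith
  ext x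
  constructor
  · intro hx
    obtain ⟨z, hz, rfl⟩ : ∃ z, c.δ ≤ centerDist z ∧ c.Phi z = x := by
      rcases hx with hx | hx
      · rw [isl_eq] at hx
        obtain ⟨z, hz, rfl⟩ := hx
        exact ⟨z, (c.mem_hat.1 hz).le, rfl⟩
      · obtain ⟨i, t, rfl⟩ := mem_iUnion.1 hx
        refine ⟨Omega i + c.δ • eAngle t, ?_, rfl⟩
        have hn : ‖c.δ • eAngle t‖ = c.δ := by
          rw [norm_smul, norm_eAngle, mul_one, Real.norm_of_nonneg hδ.le]
        rw [centerDist_add_of_lt (Omega_mem_halfLattice i)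
          (by rw [hn]; linarith [c.δ_lt, c.ε_lt]), hn]
    obtain ⟨w, hw, l, hl, rfl⟩ := exists_mem_closedBall z
    rw [centerDist_add _ (lattice_subset_halfLattice hl)] at hz
    exact ⟨w, ⟨hz, hw⟩, (c.Phi_add (hnl hz) hl).symm⟩
  · rintro ⟨z, ⟨hz, -⟩, rfl⟩
    rcases (show c.δ ≤ centerDist z from hz).lt_or_eq with h | h
    · left
      rw [isl_eq]
      exact ⟨z, h, rfl⟩
    · right
      obtain ⟨i, l, hl, hO⟩ := exists_Omega_add (center_mem_halfLattice z)
      have h0 : z - center z ≠ 0 := by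
        rw [← norm_pos_iff]; change 0 < centerDist z; rw [← h]; exact hδ
      obtain ⟨t, ht⟩ := exists_eAngle_eq h0
      refine mem_iUnion.2 ⟨i, t, ?_⟩
      have e : z = (Omega i + c.δ • eAngle t) + l := by
        have : ‖z - center z‖ = c.δ := h.symm
        rw [this, hO] at ht
        rw [← ht]
        abel
      rw [circle]
      change c.Phi _ = _
      rw [← c.Phi_add _ hl, ← e]
      intro h'
      exact hnl hz (by rw [e]; exact add_mem_lattice h' hl)

theorem isCompact_clIsl : IsCompact c.clIsl := by
  rw [clIsl_eq]
  have hcl : IsClosed {z | c.δ ≤ centerDist z} := isClosed_le continuous_const continuous_centerDist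
  refine ((isCompact_closedBall _ _).inter_left hcl).image_of_continuousOn ?_
  intro z hz
  refine (c.Phi_smooth ?_).1.continuousAt.continuousWithinAt
  intro h
  have := hz.1
  rw [mem_ofPred_eq, centerDist_eq_zero_iff.2 h] at this
  linarith [c.δ_pos]

theorem isOpen_isl : IsOpen c.isl := by
  refine isOpen_iff_mem_nhds.2 ?_
  rintro _ ⟨w, hw, rfl⟩
  obtain ⟨h1, h2⟩ := c.chi_smooth hw
  exact image_mem_nhds_of_isInvertible (h1.of_le (by norm_num)) h2
    (isClosed_halfLattice.isOpen_compl.mem_nhds hw)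

/-- The plane minus the countable half lattice is path connected, and `chi` is continuous on it. -/
theorem isConnected_isl : IsConnected c.isl := by
  refine (IsPathConnected.isConnected ?_).image _ fun w hw =>
    (c.chi_smooth hw).1.continuousAt.continuousWithinAt
  refine countable_halfLattice.isPathConnected_compl_of_one_lt_rank ?_
  rw [← Module.finrank_eq_rank, finrank_euclideanSpace_fin]
  norm_num

theorem circle_not_mem_isl (i : Fin 4) (t : ℝ) : c.circle i t ∉ c.isl := by
  rw [circle_eq]
  intro h
  exact lt_irrefl _ (c.pos_of_polar_mem (by simpa using c.s₀_pos) h)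

theorem closure_isl : closure c.isl = c.clIsl := by
  refine (closure_minimal subset_union_left c.isCompact_clIsl.isClosed).antisymm ?_
  refine union_subset subset_closure (iUnion_subset fun i => ?_)
  rintro _ ⟨t, rfl⟩
  rw [circle_eq]
  have h1 : Tendsto (fun s : ℝ => c.polar i (s, t)) (𝓝[>] 0) (𝓝 (c.polar i (0, t))) := by
    have h2 := (c.polar_smooth i (q := (0, t)) (by simpa using c.s₀_pos)).1.continuousAt
    have h3 : Tendsto (fun s : ℝ => (s, t)) (𝓝[>] 0) (𝓝 (0, t)) :=
      ((Continuous.prodMk_left t).tendsto 0).mono_left nhdsWithin_le_nhds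
    exact h2.tendsto.comp h3
  refine mem_closure_of_tendsto h1 ?_
  filter_upwards [Ioo_mem_nhdsGT c.s₀_pos] with s hs using c.polar_mem hs.1 hs.2

theorem frontier_isl : frontier c.isl = ⋃ i, range (c.circle i) := by
  rw [frontier, c.closure_isl, c.isOpen_isl.interior_eq, clIsl, union_sdiff_left]
  refine sdiff_eq_left.2 (disjoint_left.2 fun x hx hx' => ?_)
  obtain ⟨i, t, rfl⟩ := mem_iUnion.1 hx
  exact c.circle_not_mem_isl i t hx'

theorem circle_eq_Phi (i : Fin 4) (t : ℝ) : c.circle i t = c.Phi (Omega i + c.δ • eAngle t) := rfl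

theorem norm_delta_smul (t : ℝ) : ‖c.δ • eAngle t‖ = c.δ := by
  rw [norm_smul, norm_eAngle, mul_one, Real.norm_of_nonneg c.δ_pos.le]

theorem contDiffAt_map {x : Plane} (hx : x ∈ c.clIsl) : ContDiffAt ℝ 2 c.map x := by
  rcases hx with ⟨w, hw, rfl⟩ | hx
  · exact c.contDiffAt_map_chi hw
  · obtain ⟨i, t, rfl⟩ := mem_iUnion.1 hx
    exact c.contDiffAt_map_ring i (c.norm_delta_smul t)

/-- Such a point is a limit of points of the open complement of the disc, where the map is locally
the identity; C² smoothness at the point lets the value and the derivative pass to the limit. -/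
theorem map_eq_of_not_mem_interior {x : Plane} (hx : x ∈ c.clIsl) (hi : x ∉ interior disc) :
    c.map x = x ∧ fderiv ℝ c.map x = .id ℝ Plane := by
  have hcl : x ∈ closure discᶜ := by rwa [closure_compl, mem_compl_iff]
  have ho : IsOpen discᶜ := Metric.isClosed_closedBall.isOpen_compl
  have hne : (𝓝[discᶜ] x).NeBot := mem_closure_iff_nhdsWithin_neBot.1 hcl
  have h := c.contDiffAt_map hx
  constructor
  · refine tendsto_nhds_unique_of_eventuallyEq (l := 𝓝[discᶜ] x)
      (h.continuousAt.tendsto.mono_left nhdsWithin_le_nhds)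
      (tendsto_id.mono_left nhdsWithin_le_nhds) ?_
    filter_upwards [self_mem_nhdsWithin] with y hy using c.κ_disc y hy
  · have hf : ContinuousAt (fderiv ℝ c.map) x :=
      (h.fderiv_right (m := 1) (by norm_num)).continuousAt
    refine tendsto_nhds_unique_of_eventuallyEq (l := 𝓝[discᶜ] x)
      (hf.tendsto.mono_left nhdsWithin_le_nhds) tendsto_const_nhds ?_
    filter_upwards [self_mem_nhdsWithin] with y hy
    have : c.map =ᶠ[𝓝 y] id := by
      filter_upwards [ho.mem_nhds hy] with z hz using c.κ_disc z hz
    rw [this.fderiv_eq, fderiv_id]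

/-- Otherwise the map fixes `chi w` with identity derivative. Then `anosov w` equals `w` or `-w`
modulo the lattice, and comparing derivatives forces `anosov` to be `id` or `-id` on vectors, which
fails on `eU`. -/
theorem isl_subset_interior : c.isl ⊆ interior disc := by
  rintro _ ⟨w, hw, rfl⟩
  by_contra hi
  obtain ⟨h1, h2⟩ := c.map_eq_of_not_mem_interior (Or.inl ⟨w, hw, rfl⟩) hi
  have hA := anosov_not_mem hw
  obtain ⟨s1, i1⟩ := c.chi_smooth hw
  have hm := c.contDiffAt_map_chi hw
  have s2 := (c.chi_smooth hA).1
  have e1 : HasFDerivAt (fun x => c.map (c.chi x)) (fderiv ℝ c.chi w) w := by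
    have := (hm.differentiableAt two_ne_zero).hasFDerivAt.comp w
      (s1.differentiableAt two_ne_zero).hasFDerivAt
    rw [h2] at this
    exact this.congr_fderiv (by ext; simp)
  have e2 : HasFDerivAt (fun x => c.chi (anosovL x)) ((fderiv ℝ c.chi (anosov w)).comp anosovL) w :=
    HasFDerivAt.comp (g := c.chi) w
      (by rw [anosovL_apply]; exact (s2.differentiableAt two_ne_zero).hasFDerivAt)
      anosovL.hasFDerivAt
  have hev : (fun x => c.map (c.chi x)) =ᶠ[𝓝 w] fun x => c.chi (anosovL x) := by
    filter_upwards [isClosed_halfLattice.isOpen_compl.mem_nhds hw] with x hx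
    rw [c.map_chi hx, anosovL_apply]
  have e3 := DFunLike.congr_fun (e1.unique (e2.congr_of_eventuallyEq hev)) eU
  simp only [ContinuousLinearMap.comp_apply, anosovL_apply] at e3
  have hU : eU ≠ 0 := by
    intro h
    have := uC_eU
    rw [h] at this
    simp [uC] at this
  rw [c.map_chi hw, c.chi_eq_iff hA hw] at h1
  have hinj : ∀ v v' : Plane, fderiv ℝ c.chi w v = fderiv ℝ c.chi w v' → v = v' := by
    intro v v' h
    rw [← sub_eq_zero, ← map_sub] at h
    exact sub_eq_zero.1 (isInvertible_ker i1 h)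
  rcases h1 with h | h
  · have := c.fderiv_chi_add hw h
    rw [add_sub_cancel] at this
    rw [this] at e3
    exact (anosov_ne_self hU).1 (hinj _ _ e3).symm
  · have hn : -w ∉ halfLattice := fun h => hw (by simpa using neg_mem_halfLattice h)
    have := c.fderiv_chi_add hn h
    rw [add_comm (anosov w), neg_add_cancel_left, c.fderiv_chi_neg hw] at this
    rw [this, neg_apply, ← map_neg] at e3
    have h3 := hinj _ _ e3
    exact (anosov_ne_self hU).2 (eq_neg_of_add_eq_zero_right (by nth_rewrite 1 [h3]; exact neg_add_cancel _))

/-- Otherwise `ringMap` sends `z` to `±z` with derivative `±id` of the same sign. The outward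
derivative of `‖ringMap‖²` at `z` is then that of the identity, but `outerFlow` computes it from
`‖anosov z‖²`. Hence `‖anosov z‖ = ‖z‖`, so `ringMap z = anosov z`, which cannot be `±z`. -/
theorem circle_mem_interior (i : Fin 4) (t : ℝ) : c.circle i t ∈ interior disc := by
  by_contra hi
  set z := c.δ • eAngle t with hz
  have hδ := c.δ_pos
  have hn : ‖z‖ = c.δ := c.norm_delta_smul t
  have hz0 : z ≠ 0 := outer_ne_zero hδ hn.ge
  have hlt : c.δ < 1 / 4 := c.δ_lt.trans c.ε_lt
  obtain ⟨h1, h2⟩ := c.map_eq_of_not_mem_interior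
    (Or.inr (mem_iUnion.2 ⟨i, t, rfl⟩) : c.circle i t ∈ c.clIsl) hi
  rw [circle_eq_Phi, ← hz] at h1 h2
  let f : Plane → Plane := fun y => c.Phi (Omega i + y)
  have hS : ‖c.ringMap z‖ = c.δ := c.norm_ringMap hn
  have s1 := (c.contDiffAt_Phi_add i (c.ring_not_mem i hn))
  have s2 := (c.contDiffAt_Phi_add i (c.ring_not_mem i hS)).1
  have hd : HasFDerivAt c.ringMap (fderiv ℝ c.ringMap z) z :=
    (c.contDiff_ringMap.differentiable two_ne_zero z).hasFDerivAt
  have e1 : HasFDerivAt (fun x => c.map (f x)) (fderiv ℝ f z) z := by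
    have := ((c.contDiffAt_map_ring i hn).differentiableAt two_ne_zero).hasFDerivAt.comp z
      (s1.1.differentiableAt two_ne_zero).hasFDerivAt
    rw [h2] at this
    exact this.congr_fderiv (by ext; simp [f])
  have e2 : HasFDerivAt (fun x => f (c.ringMap x))
      ((fderiv ℝ f (c.ringMap z)).comp (fderiv ℝ c.ringMap z)) z :=
    HasFDerivAt.comp (g := f) z (s2.differentiableAt two_ne_zero).hasFDerivAt hd
  have e3 := e1.unique (e2.congr_of_eventuallyEq (c.map_Phi_near i hn))
  rw [(c.map_Phi_near i hn).self_of_nhds] at h1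
  have hS0 : c.ringMap z ≠ 0 := outer_ne_zero hδ hS.ge
  have hinj : ∀ v v' : Plane, fderiv ℝ f z v = fderiv ℝ f z v' → v = v' := by
    intro v v' h
    rw [← sub_eq_zero, ← map_sub] at h
    exact sub_eq_zero.1 (isInvertible_ker s1.2 h)
  have hcase := (c.Phi_Omega_eq hS0 (by rw [hS]; exact hlt) hz0 (by rw [hn]; exact hlt) h1).2
  have key : inner ℝ (c.ringMap z) (fderiv ℝ c.ringMap z z) = c.δ ^ 2 := by
    rcases hcase with h | h
    · rw [h] at e3 ⊢
      have : z = fderiv ℝ c.ringMap z z := hinj _ _ (DFunLike.congr_fun e3 z)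
      rw [← this, real_inner_self_eq_norm_sq, hn]
    · have hodd : fderiv ℝ f (-z) = -fderiv ℝ f z := by
        have hev : (fun x => f (-x)) =ᶠ[𝓝 z] f := by
          have hc : Tendsto (fun y => Omega i + y) (𝓝 z) (𝓝 (Omega i + z)) :=
            (continuous_const.add continuous_id).tendsto z
          filter_upwards [hc.eventually
            (isClosed_halfLattice.isOpen_compl.mem_nhds (c.ring_not_mem i hn))] with y hy
          exact c.Phi_Omega_neg i fun h' => hy (lattice_subset_halfLattice h')
        have s2' : DifferentiableAt ℝ f (-z) := by
          rw [← h]; exact s2.differentiableAt two_ne_zero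
        have h3 : HasFDerivAt (fun x => f (-x)) _ z := s2'.hasFDerivAt.comp z (hasFDerivAt_id z).neg
        have h4 := h3.fderiv
        rw [hev.fderiv_eq] at h4
        rw [h4]
        ext v : 1
        simp
      rw [h, hodd] at e3
      have := DFunLike.congr_fun e3 z
      rw [ContinuousLinearMap.comp_apply, neg_apply, ← map_neg] at this
      have h5 := hinj _ _ this
      rw [h, inner_neg_left, ← inner_neg_right, ← h5, real_inner_self_eq_norm_sq, hn]
  -- The derivative is one-sided because the explicit formula for `ringMap` is available only for
  -- `‖a • z‖ ≥ δ`.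
  have d1 : HasDerivWithinAt (fun a : ℝ => ‖c.ringMap (a • z)‖ ^ 2) (2 * c.δ ^ 2) (Icc 1 2) 1 := by
    have h3 : HasDerivAt (fun a : ℝ => c.ringMap (a • z)) (fderiv ℝ c.ringMap z z) 1 := by
      have h4 := ((hasDerivAt_id (1 : ℝ)).smul_const z)
      rw [one_smul] at h4
      exact HasFDerivAt.comp_hasDerivAt (l := c.ringMap) 1 (by simpa using hd) h4
    have h5 := h3.norm_sq
    simp only [one_smul] at h5
    rw [key] at h5
    exact h5.hasDerivWithinAt
  have d2 : HasDerivWithinAt (fun a : ℝ => ‖c.ringMap (a • z)‖ ^ 2) (2 * ‖anosov z‖ ^ 2)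
      (Icc 1 2) 1 := by
    have h3 : HasDerivAt (fun a : ℝ => c.δ ^ 2 + (a ^ 2 - 1) * ‖anosov z‖ ^ 2)
        (2 * ‖anosov z‖ ^ 2) 1 := by
      have := (((hasDerivAt_pow 2 (1 : ℝ)).sub_const 1).mul_const (‖anosov z‖ ^ 2)).const_add
        (c.δ ^ 2)
      exact this.congr_deriv (by norm_num)
    refine h3.hasDerivWithinAt.congr_of_mem (fun a ha => ?_) (left_mem_Icc.2 one_le_two)
    have ha0 : 0 < a := one_pos.trans_le ha.1
    have hna : ‖a • z‖ = a * c.δ := by rw [norm_smul, hn, Real.norm_of_nonneg ha0.le]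
    have hge : c.δ ≤ ‖a • z‖ := by rw [hna]; nlinarith [ha.1]
    rw [c.ringMap_outer hge (by rw [hna]; nlinarith [ha.2]), norm_sq_outerFlow hδ hge, hna,
      linFlow_sigma, anosov_smul, norm_smul, Real.norm_of_nonneg ha0.le]
    field_simp
  have hu : UniqueDiffWithinAt ℝ (Icc (1 : ℝ) 2) 1 :=
    uniqueDiffOn_Icc one_lt_two 1 (left_mem_Icc.2 one_le_two)
  have hA : ‖anosov z‖ ^ 2 = c.δ ^ 2 := by
    have := hu.eq_deriv _ d1 d2
    linarith
  have hA' : c.ringMap z = anosov z := by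
    rw [c.ringMap_outer hn.ge (by linarith), outerFlow, linFlow_sigma, hA, hn]
    simp
  rw [hA'] at hcase
  exact hcase.elim (anosov_ne_self hz0).1 (anosov_ne_self hz0).2

theorem clIsl_subset_interior : c.clIsl ⊆ interior disc := by
  refine union_subset c.isl_subset_interior (iUnion_subset fun i => ?_)
  rintro _ ⟨t, rfl⟩
  exact c.circle_mem_interior i t

end Choices

end StochasticIsland
end

noncomputable section

namespace StochasticIsland

open Filter Set

/-! ### Straightening the bounding curves -/

section Close

variable {ι E G : Type*} [NormedAddCommGroup E] [NormedSpace ℝ E] [NormedAddCommGroup G]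
  [NormedSpace ℝ G] {l : Filter ι}

theorem Conv1.of_tendsto_zero {D : ι → E → G} {x : E}
    (hd : ∀ᶠ p in l ×ˢ 𝓝 x, DifferentiableAt ℝ (D p.1) p.2)
    (h0 : Tendsto (fun p : ι × E => ‖D p.1 p.2‖) (l ×ˢ 𝓝 x) (𝓝 0))
    (h1 : Tendsto (fun p : ι × E => ‖fderiv ℝ (D p.1) p.2‖) (l ×ˢ 𝓝 x) (𝓝 0)) :
    Conv1 l D (fun _ => 0) x := by
  refine ⟨hd, .of_forall fun _ => differentiableAt_const _,
    tendsto_zero_iff_norm_tendsto_zero.2 h0, ?_⟩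
  rw [Conv0, fderiv_fun_const]
  exact tendsto_zero_iff_norm_tendsto_zero.2 h1

theorem Conv2.of_iteratedFDeriv {D : ι → E → G} {x : E}
    (hd : ∀ᶠ p in l ×ˢ 𝓝 x, ContDiffAt ℝ 2 (D p.1) p.2)
    (h : ∀ k : ℕ, k ≤ 2 →
      Tendsto (fun p : ι × E => ‖iteratedFDeriv ℝ k (D p.1) p.2‖) (l ×ˢ 𝓝 x) (𝓝 0)) :
    Conv2 l D (fun _ => 0) x := by
  have h0 := h 0 (by norm_num)
  have h1 := h 1 (by norm_num)
  have h2 := h 2 le_rfl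
  simp only [norm_iteratedFDeriv_zero] at h0
  have e1 : ∀ f : E → G, ∀ y, ‖iteratedFDeriv ℝ 1 f y‖ = ‖fderiv ℝ f y‖ := fun f y => by
    rw [← norm_iteratedFDeriv_fderiv (n := 0), norm_iteratedFDeriv_zero]
  have e2 : ∀ f : E → G, ∀ y, ‖iteratedFDeriv ℝ 2 f y‖ = ‖fderiv ℝ (fderiv ℝ f) y‖ := fun f y => by
    rw [← norm_iteratedFDeriv_fderiv (n := 1), ← norm_iteratedFDeriv_fderiv (n := 0),
      norm_iteratedFDeriv_zero]
  simp only [e1] at h1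
  simp only [e2] at h2
  refine ⟨.of_tendsto_zero (hd.mono fun p hp => hp.differentiableAt two_ne_zero) h0 h1, ?_⟩
  have e3 : fderiv ℝ (fun _ : E => (0 : G)) = fun _ => 0 := by
    rw [fderiv_fun_const]; rfl
  rw [e3]
  exact .of_tendsto_zero (hd.mono fun p hp =>
    (hp.fderiv_right (m := 1) (by norm_num)).differentiableAt one_ne_zero) h1 h2

end Close

theorem uniqueDiffOn_disc : UniqueDiffOn ℝ disc :=
  uniqueDiffOn_convex (convex_closedBall (0 : Plane) 1)
    (by rw [disc, interior_closedBall _ one_ne_zero]; exact ⟨0, by simp⟩)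

/-- In the open disc, derivatives within the disc are ordinary ones, so the differences tend to zero
with two derivatives; adding the fixed limit gives the convergence. -/
theorem conv2_of_C2Close {F : ℕ → Plane → Plane} {G : Plane → Plane}
    (hF : ∀ n, ContDiffOn ℝ 2 (F n) disc) (hc : ∀ n : ℕ, C2Close (1 / ((n : ℝ) + 1)) (F n) G)
    {x : Plane} (hx : x ∈ interior disc) (hG : ContDiffAt ℝ 2 G x) : Conv2 atTop F G x := by
  have hD : Conv2 atTop (fun n y => F n y - G y) (fun _ => 0) x := by
    have hev : ∀ᶠ p in (atTop : Filter ℕ) ×ˢ 𝓝 x,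
        p.2 ∈ interior disc ∧ ContDiffAt ℝ 2 (fun y => F p.1 y - G y) p.2 := by
      filter_upwards [eventually_prod_of_nhds (isOpen_interior.mem_nhds hx),
        eventually_prod_of_nhds (hG.eventually (by simp))] with p hp hp'
      exact ⟨hp, ((hF p.1).contDiffAt (mem_interior_iff_mem_nhds.1 hp)).sub hp'⟩
    refine .of_iteratedFDeriv (hev.mono fun p hp => hp.2) fun k hk => ?_
    have hlim : Tendsto (fun p : ℕ × Plane => 1 / ((p.1 : ℝ) + 1)) (atTop ×ˢ 𝓝 x) (𝓝 0) :=
      tendsto_one_div_add_atTop_nhds_zero_nat.comp tendsto_fst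
    refine squeeze_zero' (.of_forall fun _ => norm_nonneg _) ?_ hlim
    filter_upwards [hev] with p ⟨h1, h2⟩
    have h3 := hc p.1 k hk p.2 (interior_subset h1)
    rw [iteratedFDerivWithin_eq_iteratedFDeriv uniqueDiffOn_disc
      (h2.of_le (by exact_mod_cast hk)) (interior_subset h1)] at h3
    exact h3.le
  refine (hD.add (.of_contDiffAt hG)).congr (.of_forall fun p => ?_) (.of_forall fun y => ?_)
  · exact sub_add_cancel _ _
  · exact zero_add _

theorem conv2_of_curve_close {γ : ℕ → ℝ → Plane} {g : ℝ → Plane} (hγ : ∀ n, ContDiff ℝ 2 (γ n))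
    (hg : ContDiff ℝ 2 g)
    (hc : ∀ n k : ℕ, k ≤ 2 → ∀ t, ‖iteratedDeriv k (fun s => γ n s - g s) t‖ < 1 / ((n : ℝ) + 1))
    (t : ℝ) : Conv2 atTop (fun n s => γ n s - g s) (fun _ => 0) t := by
  refine .of_iteratedFDeriv (.of_forall fun p => ((hγ p.1).sub hg).contDiffAt) fun k hk => ?_
  have hlim : Tendsto (fun p : ℕ × ℝ => 1 / ((p.1 : ℝ) + 1)) (atTop ×ˢ 𝓝 t) (𝓝 0) :=
    tendsto_one_div_add_atTop_nhds_zero_nat.comp tendsto_fst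
  refine squeeze_zero (fun _ => norm_nonneg _) (fun p => ?_) hlim
  rw [norm_iteratedFDeriv_eq_norm_iteratedDeriv]
  exact (hc p.1 k hk p.2).le

/-! ### Extending displacements of the circles to a change of coordinates of the plane. -/

namespace Choices

variable (c : Choices)

theorem contDiff_circle (i : Fin 4) : ContDiff ℝ 2 (c.circle i) := by
  have e : c.circle i = fun t => c.polar i (0, t) := funext fun t => c.circle_eq i t
  rw [e]
  exact contDiff_iff_contDiffAt.2 fun t => ContDiffAt.comp (g := c.polar i) t
    (c.polar_smooth i (q := (0, t)) (by simpa using c.s₀_pos)).1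
    (contDiffAt_const.prodMk contDiffAt_id)

theorem circle_periodic (i : Fin 4) : Function.Periodic (c.circle i) Real.pi := by
  intro t
  rw [circle_eq, circle_eq]
  simpa using c.polar_eq_of_angle i (s := 0) (t := t) (by simpa using c.s₀_pos) 1

/-- A cut-off function of the radial coordinate. -/
def cutoff : ContDiffBump (0 : ℝ) :=
  ⟨c.s₀ / 3, c.s₀ / 2, by linarith [c.s₀_pos], by linarith [c.s₀_pos]⟩

theorem cutoff_zero : c.cutoff 0 = 1 :=
  c.cutoff.one_of_mem_closedBall (by simpa using c.cutoff.rIn_pos.le)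

theorem cutoff_eq_zero {s : ℝ} (hs : c.s₀ / 2 ≤ |s|) : c.cutoff s = 0 :=
  c.cutoff.zero_of_le_dist (by rw [Real.dist_eq, sub_zero]; exact hs)

/-- The vector field that equals `d t` at `c.circle i t` and is cut off near the circle. -/
def spread (i : Fin 4) (d : ℝ → Plane) (x : Plane) : Plane :=
  open Classical in
  if h : ∃ q : ℝ × ℝ, |q.1| < c.s₀ ∧ c.polar i q = x then
    c.cutoff h.choose.1 • d h.choose.2
  else 0

/-- The chosen polar coordinates are unique up to a multiple of `π` in the angle, which the
periodicity of `d` absorbs. -/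
theorem spread_polar (i : Fin 4) {d : ℝ → Plane} (hd : Function.Periodic d Real.pi) {q : ℝ × ℝ}
    (hq : |q.1| < c.s₀) : c.spread i d (c.polar i q) = c.cutoff q.1 • d q.2 := by
  have h : ∃ q' : ℝ × ℝ, |q'.1| < c.s₀ ∧ c.polar i q' = c.polar i q := ⟨q, hq, rfl⟩
  rw [spread, dif_pos h]
  obtain ⟨h1, h2⟩ := h.choose_spec
  obtain ⟨-, h3, k, h4⟩ := c.polar_inj hq h1 h2.symm
  rw [← h3, h4, hd.int_mul k q.2]

/-- The compact set outside which all fields `spread i d` vanish. -/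
def band (i : Fin 4) : Set Plane :=
  c.polar i '' (Icc (-(c.s₀ / 2)) (c.s₀ / 2) ×ˢ Icc 0 Real.pi)

theorem isCompact_band (i : Fin 4) : IsCompact (c.band i) := by
  refine (isCompact_Icc.prod isCompact_Icc).image_of_continuousOn fun q hq => ?_
  refine (c.polar_smooth i ?_).1.continuousAt.continuousWithinAt
  exact (abs_le.2 hq.1).trans_lt (by linarith [c.s₀_pos])

theorem polar_mem_band {i : Fin 4} {q : ℝ × ℝ} (hq : |q.1| ≤ c.s₀ / 2) : c.polar i q ∈ c.band i := by
  have hs : |q.1| < c.s₀ := hq.trans_lt (by linarith [c.s₀_pos])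
  obtain ⟨k, hk, -⟩ := existsUnique_sub_zsmul_mem_Ico Real.pi_pos q.2 0
  refine ⟨(q.1, q.2 - k • Real.pi), ⟨abs_le.1 hq, ?_⟩, ?_⟩
  · rw [zero_add] at hk
    exact ⟨hk.1, hk.2.le⟩
  · have := c.polar_eq_of_angle i (s := q.1) (t := q.2 - k • Real.pi) hs k
    rw [zsmul_eq_mul, sub_add_cancel] at this
    rw [zsmul_eq_mul]
    exact this.symm

theorem spread_eq_zero {i : Fin 4} {d : ℝ → Plane} {x : Plane} (hx : x ∉ c.band i) :
    c.spread i d x = 0 := by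
  by_cases h : ∃ q : ℝ × ℝ, |q.1| < c.s₀ ∧ c.polar i q = x
  · rw [spread, dif_pos h]
    obtain ⟨h1, h2⟩ := h.choose_spec
    rw [c.cutoff_eq_zero, zero_smul]
    by_contra! h3
    exact hx (h2 ▸ c.polar_mem_band h3.le)
  · rw [spread, dif_neg h]

theorem spread_eventually_zero {i : Fin 4} {x : Plane} (hx : x ∉ c.band i) :
    ∀ᶠ y in 𝓝 x, ∀ d, c.spread i d y = 0 := by
  filter_upwards [(c.isCompact_band i).isClosed.isOpen_compl.mem_nhds hx] with y hy d
  exact c.spread_eq_zero hy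

/-- On the band the field is read through a local inverse of the polar chart, where it is a cut-off
times `d` of the angle. Off the band all the fields vanish on one common neighbourhood. -/
theorem conv2_spread {ι : Type*} {l : Filter ι} (i : Fin 4) {d : ι → ℝ → Plane}
    (hper : ∀ n, Function.Periodic (d n) Real.pi) (hd : ∀ t, Conv2 l d (fun _ => 0) t)
    (x : Plane) : Conv2 l (fun n => c.spread i (d n)) (fun _ => 0) x := by
  by_cases hx : x ∈ c.band i
  · obtain ⟨q, ⟨hq, -⟩, rfl⟩ := hx
    have hq' : |q.1| < c.s₀ := (abs_le.2 hq).trans_lt (by linarith [c.s₀_pos])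
    obtain ⟨h1, h2⟩ := c.polar_smooth i hq'
    obtain ⟨Q, Q1, Q2, Q3, Q4⟩ := exists_local_inverse h1 two_ne_zero h2
    have a1 : Conv2 l (fun _ y => c.cutoff (Q y).1) (fun y => c.cutoff (Q y).1) (c.polar i q) :=
      .of_contDiffAt (c.cutoff.contDiff.contDiffAt.comp _ (contDiffAt_fst.comp _ Q1))
    have a2 : Conv2 l (fun n y => d n (Q y).2) (fun _ => 0) (c.polar i q) :=
      Conv2.comp (f := fun _ y => (Q y).2) (f₀ := fun y => (Q y).2) (hd _)
        (.of_contDiffAt (contDiffAt_snd.comp _ Q1))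
    refine (a1.smul a2).congr ?_ (.of_forall fun y => smul_zero _)
    have hc : Tendsto (fun y => |(Q y).1|) (𝓝 (c.polar i q)) (𝓝 |q.1|) := by
      have := (continuous_abs.comp continuous_fst).continuousAt.tendsto.comp Q1.continuousAt.tendsto
      rw [Q2] at this
      exact this
    filter_upwards [eventually_prod_of_nhds Q3,
      eventually_prod_of_nhds (hc.eventually_lt_const hq')] with p hp hp'
    rw [← c.spread_polar i (hper p.1) hp', hp]
  · have h0 : Conv2 l (fun _ _ => (0 : Plane)) (fun _ : Plane => (0 : Plane)) x :=
      .of_contDiffAt contDiffAt_const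
    refine h0.congr ?_ (.of_forall fun _ => rfl)
    filter_upwards [eventually_prod_of_nhds (c.spread_eventually_zero hx)] with p hp
    exact (hp _).symm

/-- The sum of the fields `spread i (d i)`. -/
def spreadSum (d : Fin 4 → ℝ → Plane) (x : Plane) : Plane := ∑ i, c.spread i (d i) x

theorem spreadSum_circle {d : Fin 4 → ℝ → Plane} (hd : ∀ i, Function.Periodic (d i) Real.pi)
    (i : Fin 4) (t : ℝ) : c.spreadSum d (c.circle i t) = d i t := by
  have h0 : |((0 : ℝ), t).1| < c.s₀ := by simpa using c.s₀_pos
  rw [spreadSum, circle_eq, Finset.sum_eq_single i]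
  · rw [c.spread_polar i (hd i) h0, c.cutoff_zero, one_smul]
  · intro j _ hj
    refine c.spread_eq_zero fun h => ?_
    obtain ⟨q, ⟨hq, -⟩, he⟩ := h
    exact hj (c.polar_inj ((abs_le.2 hq).trans_lt (by linarith [c.s₀_pos])) h0 he).1
  · simp

theorem conv2_spreadSum {ι : Type*} {l : Filter ι} {d : ι → Fin 4 → ℝ → Plane}
    (hper : ∀ n i, Function.Periodic (d n i) Real.pi)
    (hd : ∀ i t, Conv2 l (fun n => d n i) (fun _ => 0) t) (x : Plane) :
    Conv2 l (fun n => c.spreadSum (d n)) (fun _ => 0) x := by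
  have := Conv2.sum Finset.univ (f := fun i n => c.spread i (d n i)) (f₀ := fun _ _ => 0) (x := x)
    (l := l) fun i _ => c.conv2_spread i (fun n => hper n i) (hd i) x
  simp only [Finset.sum_const_zero] at this
  exact this

theorem spreadSum_small {ι : Type*} {l : Filter ι} {d : ι → Fin 4 → ℝ → Plane}
    (hper : ∀ n i, Function.Periodic (d n i) Real.pi)
    (hd : ∀ i t, Conv2 l (fun n => d n i) (fun _ => 0) t) {r : ℝ} (hr : 0 < r) :
    ∀ᶠ n in l, ∀ x, DifferentiableAt ℝ (c.spreadSum (d n)) x ∧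
      ‖fderiv ℝ (c.spreadSum (d n)) x‖ ≤ r ∧ ‖c.spreadSum (d n) x‖ ≤ r := by
  have hK : IsCompact (⋃ i, c.band i) := isCompact_iUnion fun i => c.isCompact_band i
  have := eventually_forall_mem_of_isCompact hK (l := l)
    (P := fun n x => DifferentiableAt ℝ (c.spreadSum (d n)) x ∧
      ‖fderiv ℝ (c.spreadSum (d n)) x‖ ≤ r ∧ ‖c.spreadSum (d n) x‖ ≤ r) fun x _ => by
    have h := (c.conv2_spreadSum hper hd x).toConv1
    have h1 := h.conv.norm
    have h2 := h.conv_fderiv.norm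
    rw [norm_zero] at h1
    rw [fderiv_fun_const, Pi.zero_apply, norm_zero] at h2
    filter_upwards [h.diff, h1.eventually_lt_const hr, h2.eventually_lt_const hr] with p a1 a2 a3
    exact ⟨a1, a3.le, a2.le⟩
  filter_upwards [this] with n hn x
  by_cases hx : x ∈ ⋃ i, c.band i
  · exact hn x hx
  · have hev : c.spreadSum (d n) =ᶠ[𝓝 x] fun _ => 0 := by
      filter_upwards [hK.isClosed.isOpen_compl.mem_nhds hx] with y hy
      exact Finset.sum_eq_zero fun i _ => c.spread_eq_zero fun h => hy (mem_iUnion.2 ⟨i, h⟩)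
    refine ⟨(differentiableAt_const _).congr_of_eventuallyEq hev, ?_, ?_⟩
    · rw [hev.fderiv_eq]; simpa using hr.le
    · rw [hev.eq_of_nhds]; simpa using hr.le

/-- Take `τ = id + spreadSum d`, where `d` is the displacement from circle to curve. A derivative of
norm at most `1 / 2` makes `τ` a homeomorphism whose differential shrinks vectors at most by the
factor two. Convergence of `τ` and of its inverse to the identity with two derivatives then passes
to the conjugated maps. -/
theorem exists_conjugacy {ι : Type*} {l : Filter ι} [l.NeBot] {F : ι → Plane → Plane}
    {γ : ι → Fin 4 → ℝ → Plane} (hF : ∀ x ∈ c.clIsl, Conv2 l F c.map x)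
    (hper : ∀ n i, Function.Periodic (γ n i) Real.pi)
    (hd : ∀ i t, Conv2 l (fun n s => γ n i s - c.circle i s) (fun _ => 0) t) :
    ∃ τ : ι → Plane ≃ₜ Plane, (∀ᶠ n in l, (∀ i t, τ n (c.circle i t) = γ n i t) ∧
        ∀ x, DifferentiableAt ℝ (τ n) x ∧ ∀ v, ‖v‖ ≤ 2 * ‖fderiv ℝ (τ n) x v‖) ∧
      (∀ x, Conv2 l (fun n => τ n) id x) ∧
      ∀ x ∈ c.clIsl, Conv2 l (fun n y => (τ n).symm (F n (τ n y))) c.map x := by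
  set d : ι → Fin 4 → ℝ → Plane := fun n i s => γ n i s - c.circle i s with hdd
  have hper' : ∀ n i, Function.Periodic (d n i) Real.pi := fun n i t => by
    simp only [hdd, hper n i t, c.circle_periodic i t]
  have hex : ∀ᶠ n in l, ∃ e : Plane ≃ₜ Plane, ∀ x, e x = x + c.spreadSum (d n) x := by
    filter_upwards [c.spreadSum_small hper' hd one_half_pos] with n hn
    refine exists_homeomorph_add (c := 1 / 2) (by rw [← NNReal.coe_lt_coe]; norm_num) ?_
    refine lipschitzWith_of_nnnorm_fderiv_le (fun x => (hn x).1) fun x => ?_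
    rw [← NNReal.coe_le_coe]
    exact (hn x).2.1.trans (by norm_num)
  have : Nonempty (Plane ≃ₜ Plane) := ⟨.refl _⟩
  obtain ⟨τ, hτ⟩ := hex.choice
  have hτ2 : ∀ x, Conv2 l (fun n => τ n) id x := by
    intro x
    have hid : Conv2 l (fun _ => id) id x := .of_contDiffAt contDiffAt_id
    refine (hid.add (c.conv2_spreadSum hper' hd x)).congr ?_ (.of_forall fun y => add_zero y)
    filter_upwards [tendsto_fst.eventually hτ] with p hp
    exact (hp p.2).symm
  refine ⟨τ, ?_, hτ2, ?_⟩
  · filter_upwards [hτ, c.spreadSum_small hper' hd one_half_pos] with n hn hn'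
    refine ⟨fun i t => ?_, fun x => ?_⟩
    · rw [hn, c.spreadSum_circle (hper' n)]
      simp [hdd]
    · have e : (τ n : Plane → Plane) = fun x => x + c.spreadSum (d n) x := funext hn
      have h1 : HasFDerivAt (τ n) (.id ℝ Plane + fderiv ℝ (c.spreadSum (d n)) x) x := by
        rw [e]; exact (hasFDerivAt_id x).add (hn' x).1.hasFDerivAt
      refine ⟨h1.differentiableAt, fun v => ?_⟩
      rw [h1.fderiv]
      have h2 := ContinuousLinearMap.le_of_opNorm_le _ (hn' x).2.1 v
      have h3 := norm_sub_norm_le v (-(fderiv ℝ (c.spreadSum (d n)) x v))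
      rw [norm_neg, sub_neg_eq_add] at h3
      change ‖v‖ ≤ 2 * ‖v + fderiv ℝ (c.spreadSum (d n)) x v‖
      linarith
  · have hs0 : ∀ x, Conv0 l (fun n => (τ n).symm) id x := by
      intro x
      rw [Conv0, Metric.tendsto_nhds]
      intro r hr
      filter_upwards [tendsto_fst.eventually hτ,
        tendsto_fst.eventually (c.spreadSum_small hper' hd (half_pos (half_pos hr))),
        eventually_prod_of_nhds (Metric.ball_mem_nhds x (half_pos hr))] with p h1 h2 h3
      have h4 := h1 ((τ p.1).symm p.2)
      rw [Homeomorph.apply_symm_apply] at h4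
      have h5 : dist ((τ p.1).symm p.2) p.2 ≤ r / 2 / 2 := by
        rw [dist_comm, dist_eq_norm, sub_eq_of_eq_add' h4]
        exact (h2 _).2.2
      have h6 : dist p.2 (id x) < r / 2 := h3
      exact lt_of_le_of_lt (dist_triangle _ p.2 _) (by linarith)
    have hs2 : ∀ x, Conv2 l (fun n => (τ n).symm) id x := fun x =>
      (hτ2 x).of_inverse (hs0 x) (.of_forall fun p => (τ p.1).symm.continuous.continuousAt)
        (.of_forall fun p => (τ p.1).apply_symm_apply _)
    intro x hx
    have h1 : Conv2 l (fun n => F n ∘ τ n) (c.map ∘ id) x := Conv2.comp (f₀ := id) (hF x hx) (hτ2 x)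
    exact Conv2.comp (g₀ := id) (f₀ := c.map ∘ id) (hs2 _) h1

end Choices

end StochasticIsland
end

noncomputable section

namespace StochasticIsland

open Filter Set

/-! ### Maps near a blown-up point -/

theorem tendsto_zero_fst {ι : Type*} {l : Filter ι} (θ : ℝ) :
    Tendsto (fun p : ι × ℝ × ℝ => (p.1, ((0 : ℝ), p.2.2))) (l ×ˢ 𝓝 (0, θ)) (l ×ˢ 𝓝 (0, θ)) := by
  refine tendsto_fst.prodMk ?_
  have h : Continuous fun q : ℝ × ℝ => ((0 : ℝ), q.2) := by fun_prop
  have := h.tendsto (0, θ)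
  exact this.comp tendsto_snd

/-- Hadamard's quotient, uniformly in the family: since `g` vanishes at `s = 0`, the mean value
inequality on the segment from `(0, t)` to `(s, t)` compares `g / s` with the limiting
`s`-derivative. -/
theorem tendsto_div_fst {ι : Type*} {l : Filter ι} {g : ι → ℝ × ℝ → ℝ} {g₀ : ℝ × ℝ → ℝ} {θ : ℝ}
    (hg : Conv1 l g g₀ (0, θ)) (h0 : ∀ᶠ p in l ×ˢ 𝓝 ((0 : ℝ), θ), g p.1 (0, p.2.2) = 0) :
    Tendsto (fun p : ι × ℝ × ℝ => g p.1 p.2 / p.2.1)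
      ((l ×ˢ 𝓝 (0, θ)) ⊓ 𝓟 {p | 0 < p.2.1}) (𝓝 (fderiv ℝ g₀ (0, θ) (1, 0))) := by
  rw [Metric.tendsto_nhds]
  intro r hr
  have h1 : ∀ᶠ p in l ×ˢ 𝓝 ((0 : ℝ), θ), DifferentiableAt ℝ (g p.1) p.2 ∧
      ‖fderiv ℝ (g p.1) p.2 - fderiv ℝ g₀ (0, θ)‖ ≤ r / 2 ∧ g p.1 (0, p.2.2) = 0 := by
    have := Metric.tendsto_nhds.1 hg.conv_fderiv (r / 2) (half_pos hr)
    filter_upwards [hg.diff, this, h0] with p a1 a2 a3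
    rw [dist_eq_norm] at a2
    exact ⟨a1, a2.le, a3⟩
  obtain ⟨pa, ha, pb, hb, h⟩ := eventually_prod_iff.1 h1
  obtain ⟨R, hR, hball⟩ := Metric.eventually_nhds_iff_ball.1 hb
  rw [eventually_inf_principal]
  refine eventually_prod_iff.2 ⟨pa, ha, fun q => q ∈ Metric.ball ((0 : ℝ), θ) R,
    Metric.ball_mem_nhds _ hR, fun {n} hn q hq hs => ?_⟩
  have hs' : 0 < q.1 := hs
  have hq : q ∈ Metric.ball ((0 : ℝ), θ) R := hq
  have hq0 : ((0 : ℝ), q.2) ∈ Metric.ball ((0 : ℝ), θ) R := by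
    rw [Metric.mem_ball, Prod.dist_eq, max_lt_iff] at hq ⊢
    exact ⟨by simpa using hR, hq.2⟩
  have hm := (convex_ball ((0 : ℝ), θ) R).norm_image_sub_le_of_norm_fderiv_le' (𝕜 := ℝ)
    (f := g n) (C := r / 2) (φ := fderiv ℝ g₀ (0, θ))
    (fun x hx => (h hn (hball x hx)).1) (fun x hx => (h hn (hball x hx)).2.1) hq0 hq
  have e0 : g n (0, q.2) = 0 := (h hn (hball q hq)).2.2
  have e1 : q - ((0 : ℝ), q.2) = q.1 • ((1 : ℝ), (0 : ℝ)) := by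
    ext <;> simp
  rw [e0, e1, map_smul, norm_smul, sub_zero, Prod.norm_mk, norm_one, norm_zero,
    max_eq_left zero_le_one, mul_one, Real.norm_of_nonneg hs'.le, smul_eq_mul,
    Real.norm_eq_abs] at hm
  rw [Real.dist_eq]
  have e2 : g n q / q.1 - fderiv ℝ g₀ (0, θ) (1, 0) =
      (g n q - q.1 * fderiv ℝ g₀ (0, θ) (1, 0)) / q.1 := by field_simp
  change |g n q / q.1 - fderiv ℝ g₀ (0, θ) (1, 0)| < r
  rw [e2, abs_div, abs_of_pos hs', div_lt_iff₀ hs']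
  nlinarith

/-- The linear map with given matrix in the frames of polar coordinates at angles `a` and `b`. -/
def frameMap (a b x y z w : ℝ) : Plane →L[ℝ] Plane :=
  (innerSL ℝ (eAngle a)).smulRight (x • eAngle b + y • eAngle (b + Real.pi / 2)) +
    (innerSL ℝ (eAngle (a + Real.pi / 2))).smulRight
      (z • eAngle b + w • eAngle (b + Real.pi / 2))

theorem tendsto_smulRight {E α : Type*} [NormedAddCommGroup E] [NormedSpace ℝ E]
    {k : Filter α} {f : α → StrongDual ℝ E} {g : α → E} {f₀ : StrongDual ℝ E} {g₀ : E}
    (hf : Tendsto f k (𝓝 f₀)) (hg : Tendsto g k (𝓝 g₀)) :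
    Tendsto (fun p => (f p).smulRight (g p)) k (𝓝 (f₀.smulRight g₀)) := by
  have h2 := (isBoundedBilinearMap_smulRight (𝕜 := ℝ) (E := E) (F := E)).continuous.tendsto
    (f₀, g₀)
  exact h2.comp (hf.prodMk_nhds hg)

theorem tendsto_innerSL {E α : Type*} [NormedAddCommGroup E] [InnerProductSpace ℝ E]
    {k : Filter α} {f : α → E} {f₀ : E} (hf : Tendsto f k (𝓝 f₀)) :
    Tendsto (fun p => innerSL ℝ (f p)) k (𝓝 (innerSL ℝ f₀)) :=
  ((innerSL ℝ).continuous.tendsto f₀).comp hf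

theorem tendsto_frameMap {α : Type*} {k : Filter α} {a b x y z w : α → ℝ}
    {a₀ b₀ x₀ y₀ z₀ w₀ : ℝ} (ha : Tendsto a k (𝓝 a₀)) (hb : Tendsto b k (𝓝 b₀))
    (hx : Tendsto x k (𝓝 x₀)) (hy : Tendsto y k (𝓝 y₀)) (hz : Tendsto z k (𝓝 z₀))
    (hw : Tendsto w k (𝓝 w₀)) :
    Tendsto (fun p => frameMap (a p) (b p) (x p) (y p) (z p) (w p)) k
      (𝓝 (frameMap a₀ b₀ x₀ y₀ z₀ w₀)) := by
  have he : Continuous eAngle := (contDiff_eAngle (n := 0)).continuous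
  have e1 : ∀ {f : α → ℝ} {t : ℝ}, Tendsto f k (𝓝 t) →
      Tendsto (fun p => eAngle (f p)) k (𝓝 (eAngle t)) := fun h => (he.tendsto _).comp h
  have e2 : ∀ {f : α → ℝ} {t : ℝ}, Tendsto f k (𝓝 t) →
      Tendsto (fun p => eAngle (f p + Real.pi / 2)) k (𝓝 (eAngle (t + Real.pi / 2))) :=
    fun h => (he.tendsto _).comp (h.add_const _)
  exact (tendsto_smulRight (tendsto_innerSL (e1 ha)) ((hx.smul (e1 hb)).add (hy.smul (e2 hb)))).add
    (tendsto_smulRight (tendsto_innerSL (e2 ha)) ((hz.smul (e1 hb)).add (hw.smul (e2 hb))))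

/-- Symplectic polar coordinates. -/
def cone (q : ℝ × ℝ) : Plane := Real.sqrt (2 * q.1) • eAngle q.2

/-- The derivative of symplectic polar coordinates. -/
def dcone (q : ℝ × ℝ) : ℝ × ℝ →L[ℝ] Plane :=
  (ContinuousLinearMap.fst ℝ ℝ ℝ).smulRight ((Real.sqrt (2 * q.1))⁻¹ • eAngle q.2) +
    (ContinuousLinearMap.snd ℝ ℝ ℝ).smulRight
      (Real.sqrt (2 * q.1) • eAngle (q.2 + Real.pi / 2))

theorem dcone_apply (q v : ℝ × ℝ) : dcone q v = (v.1 * (Real.sqrt (2 * q.1))⁻¹) • eAngle q.2 +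
    (v.2 * Real.sqrt (2 * q.1)) • eAngle (q.2 + Real.pi / 2) := by
  simp [dcone, smul_smul]

theorem inner_eAngle_self (t : ℝ) : inner ℝ (eAngle t) (eAngle t) = 1 := by
  rw [real_inner_self_eq_norm_sq, norm_eAngle, one_pow]

theorem inner_frame (z w : Plane) : inner ℝ z w = uC z * uC w + vC z * vC w := by
  rw [inner_plane, uC_eq, uC_eq, vC_eq, vC_eq]
  linear_combination (-(z 0 * w 0 + z 1 * w 1)) * eU_sq

theorem inner_eAngle_orth (t : ℝ) : inner ℝ (eAngle t) (eAngle (t + Real.pi / 2)) = 0 := by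
  rw [inner_frame, uC_eAngle, uC_eAngle, vC_eAngle, vC_eAngle, Real.cos_add_pi_div_two,
    Real.sin_add_pi_div_two]
  ring

theorem hasFDerivAt_cone {q : ℝ × ℝ} (hq : 0 < q.1) : HasFDerivAt cone (dcone q) q := by
  have hp : 0 < 2 * q.1 := by linarith
  have d1 : HasFDerivAt (fun q : ℝ × ℝ => Real.sqrt (2 * q.1)) _ q :=
    ((Real.hasDerivAt_sqrt hp.ne').comp_hasFDerivAt q
      ((ContinuousLinearMap.fst ℝ ℝ ℝ).hasFDerivAt.const_mul 2))
  have d2 := (hasDerivAt_eAngle q.2).hasFDerivAt.comp q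
    (ContinuousLinearMap.snd ℝ ℝ ℝ).hasFDerivAt
  have d3 : HasFDerivAt cone _ q := d1.smul d2
  refine d3.congr_fderiv ?_
  refine ContinuousLinearMap.ext fun v => ?_
  rw [dcone_apply]
  simp [smul_smul]
  rw [add_comm]
  congr 2 <;> ring

theorem dcone_surjective {q : ℝ × ℝ} (hq : 0 < q.1) : Function.Surjective (dcone q) := by
  have hp : 0 < Real.sqrt (2 * q.1) := Real.sqrt_pos.2 (by linarith)
  intro v
  refine ⟨(inner ℝ (eAngle q.2) v * Real.sqrt (2 * q.1),
    inner ℝ (eAngle (q.2 + Real.pi / 2)) v * (Real.sqrt (2 * q.1))⁻¹), ?_⟩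
  rw [dcone_apply, mul_assoc, mul_assoc, mul_inv_cancel₀ hp.ne', inv_mul_cancel₀ hp.ne', mul_one,
    mul_one]
  refine frame_ext ?_ ?_
  · rw [uC_add, uC_smul, uC_smul, inner_frame, inner_frame]
    simp only [uC_eAngle, vC_eAngle, Real.cos_add_pi_div_two, Real.sin_add_pi_div_two]
    linear_combination uC v * Real.sin_sq_add_cos_sq q.2
  · rw [vC_add, vC_smul, vC_smul, inner_frame, inner_frame]
    simp only [uC_eAngle, vC_eAngle, Real.cos_add_pi_div_two, Real.sin_add_pi_div_two]
    linear_combination vC v * Real.sin_sq_add_cos_sq q.2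

/-- The derivative of a map of polar coordinates, in the frames of polar coordinates. -/
def coneMap (G : ℝ × ℝ → ℝ × ℝ) (q : ℝ × ℝ) : Plane →L[ℝ] Plane :=
  frameMap q.2 (G q).2
    ((fderiv ℝ G q (1, 0)).1 / Real.sqrt ((G q).1 / q.1))
    (2 * q.1 * Real.sqrt ((G q).1 / q.1) * (fderiv ℝ G q (1, 0)).2)
    ((fderiv ℝ G q (0, 1)).1 / q.1 / (2 * Real.sqrt ((G q).1 / q.1)))
    (Real.sqrt ((G q).1 / q.1) * (fderiv ℝ G q (0, 1)).2)

/-- This identifies `coneMap G` as the differential of `G` after the boundary is collapsed to a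
point by `cone`. Its entries are arranged so that the singular factors `√(2s)` cancel, leaving `G₁ /
s` and `∂_θ G₁ / s`. -/
theorem coneMap_comp {G : ℝ × ℝ → ℝ × ℝ} {q : ℝ × ℝ} (hq : 0 < q.1) (hG : 0 < (G q).1) :
    (coneMap G q).comp (dcone q) = (dcone (G q)).comp (fderiv ℝ G q) := by
  have hp : 0 < Real.sqrt (2 * q.1) := Real.sqrt_pos.2 (by linarith)
  have hr : 0 < Real.sqrt ((G q).1 / q.1) := Real.sqrt_pos.2 (div_pos hG hq)
  have hf : Real.sqrt (2 * (G q).1) = Real.sqrt ((G q).1 / q.1) * Real.sqrt (2 * q.1) := by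
    rw [← Real.sqrt_mul (div_pos hG hq).le]
    congr 1
    field_simp
  have hs : q.1 = Real.sqrt (2 * q.1) ^ 2 / 2 := by
    rw [Real.sq_sqrt (by linarith)]; ring
  refine ContinuousLinearMap.ext fun v => ?_
  have hv : fderiv ℝ G q v = v.1 • fderiv ℝ G q (1, 0) + v.2 • fderiv ℝ G q (0, 1) := by
    rw [← map_smul, ← map_smul, ← map_add]
    congr 1
    ext <;> simp
  rw [ContinuousLinearMap.comp_apply, ContinuousLinearMap.comp_apply, hv, dcone_apply, dcone_apply,
    coneMap, hf]
  have o1 := inner_eAngle_orth q.2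
  have o2 : inner ℝ (eAngle (q.2 + Real.pi / 2)) (eAngle q.2) = 0 := by
    rw [real_inner_comm]; exact o1
  simp only [frameMap, add_apply, ContinuousLinearMap.smulRight_apply, innerSL_apply_apply,
    inner_add_right, inner_smul_right, inner_eAngle_self, o1, o2, Prod.fst_add, Prod.snd_add,
    Prod.smul_fst, Prod.smul_snd, smul_eq_mul]
  generalize Real.sqrt ((G q).1 / q.1) = r at *
  generalize Real.sqrt (2 * q.1) = s at *
  rw [hs]
  generalize fderiv ℝ G q (1, 0) = A at *
  generalize fderiv ℝ G q (0, 1) = B at *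
  simp only [smul_add, smul_smul]
  have e1 : (v.1 * s⁻¹ * 1 + v.2 * s * 0) * (A.1 / r) +
      (v.1 * s⁻¹ * 0 + v.2 * s * 1) * (B.1 / (s ^ 2 / 2) / (2 * r)) =
      (v.1 * A.1 + v.2 * B.1) * (r * s)⁻¹ := by field_simp; ring
  have e2 : (v.1 * s⁻¹ * 1 + v.2 * s * 0) * (2 * (s ^ 2 / 2) * r * A.2) +
      (v.1 * s⁻¹ * 0 + v.2 * s * 1) * (r * B.2) =
      (v.1 * A.2 + v.2 * B.2) * (r * s) := by field_simp; ring
  rw [← e1, ← e2]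
  module

/-- The limit of `coneMap` at the boundary. -/
def coneLimit (G : ℝ × ℝ → ℝ × ℝ) (θ : ℝ) : Plane →L[ℝ] Plane :=
  frameMap θ (G (0, θ)).2
    ((fderiv ℝ G (0, θ) (1, 0)).1 / Real.sqrt (fderiv ℝ G (0, θ) (1, 0)).1) 0
    ((fderiv ℝ (fderiv ℝ G) (0, θ) (1, 0) (0, 1)).1 / (2 * Real.sqrt (fderiv ℝ G (0, θ) (1, 0)).1))
    (Real.sqrt (fderiv ℝ G (0, θ) (1, 0)).1 * (fderiv ℝ G (0, θ) (0, 1)).2)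

/-! ### Boundary limits of differentials in polar coordinates. -/

section Limit

variable {ι : Type*} {l : Filter ι} {G : ι → ℝ × ℝ → ℝ × ℝ} {G₀ : ℝ × ℝ → ℝ × ℝ} {θ : ℝ}

theorem tendsto_fst_div (hG : Conv2 l G G₀ (0, θ))
    (h0 : ∀ᶠ p in l ×ˢ 𝓝 ((0 : ℝ), θ), (G p.1 (0, p.2.2)).1 = 0) :
    Tendsto (fun p : ι × ℝ × ℝ => (G p.1 p.2).1 / p.2.1)
      ((l ×ˢ 𝓝 (0, θ)) ⊓ 𝓟 {p | 0 < p.2.1}) (𝓝 (fderiv ℝ G₀ (0, θ) (1, 0)).1) := by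
  have hL : Conv1 l (fun _ => (Prod.fst : ℝ × ℝ → ℝ)) Prod.fst (G₀ (0, θ)) :=
    .of_contDiffAt contDiffAt_fst
  have h1 : Conv1 l (fun n q => (G n q).1) (fun q => (G₀ q).1) (0, θ) := hL.comp hG.toConv1
  have h2 := tendsto_div_fst h1 h0
  have h3 : fderiv ℝ (fun q => (G₀ q).1) (0, θ) = (ContinuousLinearMap.fst ℝ ℝ ℝ).comp
      (fderiv ℝ G₀ (0, θ)) :=
    (hG.toConv1.diff₀.self_of_nhds.hasFDerivAt.fst).fderiv
  rw [h3] at h2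
  exact h2

/-- Each entry converges separately. The delicate one contains `∂_θ G₁ / s`, whose numerator
vanishes on the boundary together with `G₁`; its limit is a mixed second derivative, and this is
where C² convergence is used. -/
theorem tendsto_coneMap (hG : Conv2 l G G₀ (0, θ))
    (h0 : ∀ᶠ p in l ×ˢ 𝓝 ((0 : ℝ), θ), (G p.1 (0, p.2.2)).1 = 0)
    (hpos : 0 < (fderiv ℝ G₀ (0, θ) (1, 0)).1) :
    Tendsto (fun p : ι × ℝ × ℝ => coneMap (G p.1) p.2)
      ((l ×ˢ 𝓝 (0, θ)) ⊓ 𝓟 {p | 0 < p.2.1}) (𝓝 (coneLimit G₀ θ)) := by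
  set k := (l ×ˢ 𝓝 ((0 : ℝ), θ)) ⊓ 𝓟 {p : ι × ℝ × ℝ | 0 < p.2.1} with hk
  have hkl : k ≤ l ×ˢ 𝓝 ((0 : ℝ), θ) := inf_le_left
  have hsq : Tendsto (fun p : ι × ℝ × ℝ => Real.sqrt ((G p.1 p.2).1 / p.2.1)) k
      (𝓝 (Real.sqrt (fderiv ℝ G₀ (0, θ) (1, 0)).1)) :=
    (Real.continuous_sqrt.tendsto _).comp (tendsto_fst_div hG h0)
  have hsp : Real.sqrt (fderiv ℝ G₀ (0, θ) (1, 0)).1 ≠ 0 := (Real.sqrt_pos.2 hpos).ne'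
  have hq : Tendsto (fun p : ι × ℝ × ℝ => p.2) k (𝓝 (0, θ)) := tendsto_snd.mono_left hkl
  have hq1 : Tendsto (fun p : ι × ℝ × ℝ => p.2.1) k (𝓝 0) := (continuous_fst.tendsto _).comp hq
  have hq2 : Tendsto (fun p : ι × ℝ × ℝ => p.2.2) k (𝓝 θ) := (continuous_snd.tendsto _).comp hq
  have hGk : Tendsto (fun p : ι × ℝ × ℝ => (G p.1 p.2).2) k (𝓝 (G₀ (0, θ)).2) :=
    (continuous_snd.tendsto _).comp (hG.toConv1.conv.mono_left hkl)
  have hD : ∀ v : ℝ × ℝ, Tendsto (fun p : ι × ℝ × ℝ => fderiv ℝ (G p.1) p.2 v) k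
      (𝓝 (fderiv ℝ G₀ (0, θ) v)) := fun v =>
    ((ContinuousLinearMap.apply ℝ (ℝ × ℝ) v).continuous.tendsto _).comp
      (hG.toConv1.conv_fderiv.mono_left hkl)
  have hD1 : ∀ v : ℝ × ℝ, Tendsto (fun p : ι × ℝ × ℝ => (fderiv ℝ (G p.1) p.2 v).1) k
      (𝓝 (fderiv ℝ G₀ (0, θ) v).1) := fun v => (continuous_fst.tendsto _).comp (hD v)
  have hD2 : ∀ v : ℝ × ℝ, Tendsto (fun p : ι × ℝ × ℝ => (fderiv ℝ (G p.1) p.2 v).2) k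
      (𝓝 (fderiv ℝ G₀ (0, θ) v).2) := fun v => (continuous_snd.tendsto _).comp (hD v)
  have hmix : Tendsto (fun p : ι × ℝ × ℝ => (fderiv ℝ (G p.1) p.2 (0, 1)).1 / p.2.1) k
      (𝓝 (fderiv ℝ (fderiv ℝ G₀) (0, θ) (1, 0) (0, 1)).1) := by
    let L : (ℝ × ℝ →L[ℝ] ℝ × ℝ) →L[ℝ] ℝ :=
      (ContinuousLinearMap.fst ℝ ℝ ℝ).comp (ContinuousLinearMap.apply ℝ (ℝ × ℝ) ((0 : ℝ), (1 : ℝ)))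
    have hL : Conv1 l (fun _ => L) L (fderiv ℝ G₀ (0, θ)) := .of_contDiffAt L.contDiff.contDiffAt
    have h1 : Conv1 l (fun n q => (fderiv ℝ (G n) q (0, 1)).1)
        (fun q => (fderiv ℝ G₀ q (0, 1)).1) (0, θ) := hL.comp hG.deriv
    -- `G₁` is zero along the boundary near this point, hence so is its tangential derivative.
    have hz : ∀ᶠ p in l ×ˢ 𝓝 ((0 : ℝ), θ), (fderiv ℝ (G p.1) (0, p.2.2) (0, 1)).1 = 0 := by
      filter_upwards [(tendsto_zero_fst θ).eventually hG.toConv1.diff, eventually_prod_nhds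
        ((tendsto_zero_fst θ).eventually h0)] with p hp hp'
      have d1 : HasDerivAt (fun t : ℝ => ((0 : ℝ), t)) (0, 1) p.2.2 :=
        (hasDerivAt_const p.2.2 (0 : ℝ)).prodMk (hasDerivAt_id p.2.2)
      have d2 := (hp.hasFDerivAt.comp_hasDerivAt p.2.2 d1)
      have d3 := (ContinuousLinearMap.fst ℝ ℝ ℝ).hasFDerivAt.comp_hasDerivAt p.2.2 d2
      have d4 : (fun t : ℝ => (G p.1 (0, t)).1) =ᶠ[𝓝 p.2.2] fun _ => 0 := by
        have hc : Continuous fun t : ℝ => (p.2.1, t) := by fun_prop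
        exact (hc.tendsto p.2.2).eventually hp'
      exact d3.unique ((hasDerivAt_const p.2.2 (0 : ℝ)).congr_of_eventuallyEq d4)
    have h2 := tendsto_div_fst h1 hz
    have h3 : fderiv ℝ (fun q => (fderiv ℝ G₀ q (0, 1)).1) (0, θ) =
        L.comp (fderiv ℝ (fderiv ℝ G₀) (0, θ)) :=
      (L.hasFDerivAt.comp _ hG.deriv.diff₀.self_of_nhds.hasFDerivAt).fderiv
    rw [h3] at h2
    exact h2
  have hy : Tendsto (fun p : ι × ℝ × ℝ => 2 * p.2.1 * Real.sqrt ((G p.1 p.2).1 / p.2.1) *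
      (fderiv ℝ (G p.1) p.2 (1, 0)).2) k (𝓝 0) := by
    have := ((hq1.const_mul 2).mul hsq).mul (hD2 (1, 0))
    simpa using this
  exact tendsto_frameMap hq2 hGk ((hD1 (1, 0)).div hsq hsp) hy
    (hmix.div (hsq.const_mul 2) (mul_ne_zero two_ne_zero hsp)) (hsq.mul (hD2 (0, 1)))

theorem tendsto_cone_div (hG : Conv2 l G G₀ (0, θ))
    (h0 : ∀ᶠ p in l ×ˢ 𝓝 ((0 : ℝ), θ), (G p.1 (0, p.2.2)).1 = 0) :
    Tendsto (fun p : ι × ℝ × ℝ => Real.sqrt ((G p.1 p.2).1 / p.2.1) • eAngle (G p.1 p.2).2)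
      ((l ×ˢ 𝓝 (0, θ)) ⊓ 𝓟 {p | 0 < p.2.1})
      (𝓝 (Real.sqrt (fderiv ℝ G₀ (0, θ) (1, 0)).1 • eAngle (G₀ (0, θ)).2)) := by
  have hsq := (Real.continuous_sqrt.tendsto _).comp (tendsto_fst_div hG h0)
  have hGk := ((contDiff_eAngle (n := 0)).continuous.comp continuous_snd).tendsto
    (G₀ (0, θ)) |>.comp (hG.toConv1.conv.mono_left
      (inf_le_left : (l ×ˢ 𝓝 ((0 : ℝ), θ)) ⊓ 𝓟 {p : ι × ℝ × ℝ | 0 < p.2.1} ≤ _))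
  exact hsq.smul hGk

end Limit

end StochasticIsland
end

noncomputable section

namespace StochasticIsland

open Filter Set

/-! ### Lifts of perturbed maps to the torus -/

theorem continuous_anosov : Continuous anosov := by
  have : anosov = anosovL := funext fun z => (anosovL_apply z).symm
  rw [this]
  exact anosovL.continuous

theorem continuous_eAngle : Continuous eAngle := (contDiff_eAngle (n := 0)).continuous

theorem eAngle_ne_zero (t : ℝ) : eAngle t ≠ 0 := by
  rw [← norm_pos_iff, norm_eAngle]; exact one_pos

theorem anosov_ne_zero {z : Plane} (hz : z ≠ 0) : anosov z ≠ 0 := by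
  rw [← linFlow_sigma]; exact linFlow_ne_zero hz _

theorem norm_cone (q : ℝ × ℝ) : ‖cone q‖ = Real.sqrt (2 * q.1) := by
  rw [cone, norm_smul, norm_eAngle, mul_one, Real.norm_of_nonneg (Real.sqrt_nonneg _)]

/-- In a neighbourhood of the image of `w`, the map `H` lifts through the semiconjugacy to a map
that is `r`-close to the Anosov map. -/
def Lifts (c : Choices) (H : Plane → Plane) (r : ℝ) (w : Plane) : Prop :=
  ∃ w' ∉ halfLattice, ∃ M : Plane →L[ℝ] Plane, c.chi w' = H (c.chi w) ∧
    (fderiv ℝ c.chi w').comp M = (fderiv ℝ H (c.chi w)).comp (fderiv ℝ c.chi w) ∧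
    ‖M - anosovL‖ ≤ r ∧ ‖w' - anosov w‖ ≤ r * centerDist w

theorem Lifts.add {c : Choices} {H : Plane → Plane} {r : ℝ} {w l : Plane} (h : Lifts c H r w)
    (hw : w ∉ halfLattice) (hl : l ∈ lattice) : Lifts c H r (w + l) := by
  obtain ⟨w', hw', M, h1, h2, h3, h4⟩ := h
  have hA := anosov_mem_lattice hl
  refine ⟨w' + anosov l, fun h => hw' ?_, M, ?_, ?_, h3, ?_⟩
  · simpa using sub_mem_halfLattice h (lattice_subset_halfLattice hA)
  · rw [c.chi_add hw' hA, c.chi_add hw hl, h1]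
  · rw [c.fderiv_chi_add hw' hA, c.fderiv_chi_add hw hl, c.chi_add hw hl, h2]
  · rw [anosov_add, add_sub_add_right_eq_sub, centerDist_add _ (lattice_subset_halfLattice hl)]
    exact h4

namespace Choices

variable (c : Choices)

theorem chi_mem_isl {w : Plane} (hw : w ∉ halfLattice) : c.chi w ∈ c.isl := ⟨w, hw, rfl⟩

theorem isl_subset_clIsl : c.isl ⊆ c.clIsl := subset_union_left

theorem circle_mem_clIsl (i : Fin 4) (t : ℝ) : c.circle i t ∈ c.clIsl :=
  Or.inr (mem_iUnion.2 ⟨i, t, rfl⟩)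

/-- With `Q` a local inverse of `chi` at `anosov w₀`, the maps `Q ∘ H ∘ chi` converge to `anosov`
with their derivatives. They supply the lift and its differential; the bound on the displacement
holds nearby because `centerDist w₀ > 0`. -/
theorem lifts_interior {ι : Type*} {l : Filter ι} {H : ι → Plane → Plane}
    (hH : ∀ x ∈ c.clIsl, Conv2 l H c.map x) {r : ℝ} (hr : 0 < r) {w₀ : Plane}
    (hw : w₀ ∉ halfLattice) : ∀ᶠ p in l ×ˢ 𝓝 w₀, Lifts c (H p.1) r p.2 := by
  have hA := anosov_not_mem hw
  obtain ⟨s1, -⟩ := c.chi_smooth hw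
  obtain ⟨s2, i2⟩ := c.chi_smooth hA
  obtain ⟨Q, Q1, Q2, Q3, Q4⟩ := exists_local_inverse s2 two_ne_zero i2
  have hHc := hH _ (c.isl_subset_clIsl (c.chi_mem_isl hw))
  have hcomp : Conv2 l (fun n => H n ∘ c.chi) (c.map ∘ c.chi) w₀ :=
    hHc.comp (.of_contDiffAt s1)
  have hQ : Conv2 l (fun _ => Q) Q ((c.map ∘ c.chi) w₀) := by
    rw [Function.comp_apply, c.map_chi hw]
    exact .of_contDiffAt Q1
  have hG := hQ.comp hcomp
  have hG0 : Q ∘ (c.map ∘ c.chi) =ᶠ[𝓝 w₀] anosovL := by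
    have hc : Tendsto anosovL (𝓝 w₀) (𝓝 (anosov w₀)) := by
      rw [← anosovL_apply]; exact anosovL.continuous.tendsto w₀
    filter_upwards [isClosed_halfLattice.isOpen_compl.mem_nhds hw, hc.eventually Q4] with x hx hx'
    rw [Function.comp_apply, Function.comp_apply, c.map_chi hx, ← anosovL_apply, hx']
  have hG' : Conv2 l (fun n => Q ∘ (H n ∘ c.chi)) anosovL w₀ :=
    hG.congr (.of_forall fun _ => rfl) hG0
  have t1 : Tendsto (fun p : ι × Plane => (Q ∘ (H p.1 ∘ c.chi)) p.2) (l ×ˢ 𝓝 w₀)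
      (𝓝 (anosov w₀)) := by
    have := hG'.toConv1.conv
    rwa [Conv0, anosovL_apply] at this
  have t2 : Tendsto (fun p : ι × Plane => fderiv ℝ (Q ∘ (H p.1 ∘ c.chi)) p.2) (l ×ˢ 𝓝 w₀)
      (𝓝 anosovL) := by
    have := hG'.toConv1.conv_fderiv
    rwa [Conv0, anosovL.fderiv] at this
  have t3 : Tendsto (fun p : ι × Plane => H p.1 (c.chi p.2)) (l ×ˢ 𝓝 w₀)
      (𝓝 (c.chi (anosov w₀))) := by
    have := hcomp.toConv1.conv
    rwa [Conv0, Function.comp_apply, c.map_chi hw] at this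
  have t4 : Tendsto (fun p : ι × Plane => ‖(Q ∘ (H p.1 ∘ c.chi)) p.2 - anosov p.2‖ -
      r * centerDist p.2) (l ×ˢ 𝓝 w₀) (𝓝 (‖anosov w₀ - anosov w₀‖ - r * centerDist w₀)) :=
    (t1.sub ((continuous_anosov.tendsto w₀).comp tendsto_snd)).norm.sub
      (((continuous_centerDist.tendsto w₀).comp tendsto_snd).const_mul r)
  have hcd := centerDist_pos hw
  filter_upwards [eventually_prod_nhds (t3.eventually Q3),
    t1.eventually (isClosed_halfLattice.isOpen_compl.mem_nhds hA),
    t2.eventually (Metric.closedBall_mem_nhds anosovL hr),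
    t4.eventually_lt_const (by rw [sub_self, norm_zero, zero_sub, neg_lt_zero]; positivity),
    hG'.toConv1.diff, hcomp.toConv1.diff,
    (tendsto_snd (f := l)).eventually (s1.eventually (by simp)),
    (Conv0.of_continuousAt s1.continuousAt).tendsto_prodMk.eventually hHc.toConv1.diff]
    with p a1 a2 a3 a4 a5 a6 a7 a8
  refine ⟨_, a2, fderiv ℝ (Q ∘ (H p.1 ∘ c.chi)) p.2, a1.self_of_nhds, ?_, ?_, ?_⟩
  · have e1 := fderiv_comp p.2 ((c.chi_smooth a2).1.differentiableAt two_ne_zero) a5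
    have e2 := fderiv_comp p.2 a8 (a7.differentiableAt two_ne_zero)
    rw [← e1, ← e2]
    exact EventuallyEq.fderiv_eq a1
  · rw [← dist_eq_norm]; exact a3
  · linarith

theorem cone_add_not_mem (i : Fin 4) {q : ℝ × ℝ} (hq : 0 < q.1) (hq' : q.1 < c.s₀) :
    Omega i + cone q ∉ halfLattice ∧ ‖cone q‖ < 1 / 4 := by
  have h : ‖cone q‖ < 1 / 4 := by
    refine lt_trans ?_ c.ε_lt
    rw [norm_cone, Real.sqrt_lt' c.ε_pos]
    nlinarith [c.s₀_lt, c.δ_pos]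
  refine ⟨add_not_mem_halfLattice (Omega_mem_halfLattice i) ?_ h, h⟩
  rw [← norm_pos_iff, norm_cone]
  exact Real.sqrt_pos.2 (by linarith)

theorem chi_cone (i : Fin 4) {q : ℝ × ℝ} (hq : 0 < q.1) (hq' : q.1 < c.s₀) :
    c.chi (Omega i + cone q) = c.polar i q :=
  c.chi_polar i hq hq' q.2

theorem chi_dcone (i : Fin 4) {q : ℝ × ℝ} (hq : 0 < q.1) (hq' : q.1 < c.s₀) :
    (fderiv ℝ c.chi (Omega i + cone q)).comp (dcone q) = fderiv ℝ (c.polar i) q := by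
  have h1 := (c.chi_smooth (c.cone_add_not_mem i hq hq').1).1.differentiableAt two_ne_zero
  have h2 := (hasFDerivAt_cone hq).const_add (Omega i)
  have h3 : HasFDerivAt (fun q => c.chi (Omega i + cone q)) _ q :=
    HasFDerivAt.comp (g := c.chi) q h1.hasFDerivAt h2
  rw [← h3.fderiv]
  refine EventuallyEq.fderiv_eq ?_
  filter_upwards [continuous_fst.continuousAt.eventually_const_lt hq,
    continuous_fst.continuousAt.eventually_lt_const hq'] with y hy hy'
  exact c.chi_cone i hy hy'

/-- On the circle `outerFlow` is the linear flow followed by rescaling to radius `δ`, so `c.map`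
acts on the angle through the directions of `anosov`. -/
theorem map_circle (i : Fin 4) {θ b q : ℝ} (hq : 0 < q) (h : anosov (eAngle θ) = q • eAngle b) :
    c.map (c.circle i θ) = c.circle i b := by
  have hδ := c.δ_pos
  have hn := c.norm_delta_smul θ
  rw [circle_eq_Phi, (c.map_Phi_near i hn).self_of_nhds, circle_eq_Phi,
    c.ringMap_outer hn.ge (by linarith), outerFlow, linFlow_sigma, hn, anosov_smul, h, norm_smul,
    norm_smul, norm_eAngle, Real.norm_of_nonneg hδ.le, Real.norm_of_nonneg hq.le, mul_one,
    div_self (by positivity), sub_self, zero_add, mul_pow]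
  have e : c.δ ^ 2 / (c.δ ^ 2 * q ^ 2) = (1 / q) ^ 2 := by field_simp
  rw [e, Real.sqrt_sq (by positivity), smul_smul, smul_smul]
  congr 3
  field_simp

theorem exists_angle (θ : ℝ) : ∃ b, anosov (eAngle θ) = ‖anosov (eAngle θ)‖ • eAngle b :=
  exists_eAngle_eq (anosov_ne_zero (eAngle_ne_zero θ))

/-- The data of a chart of the target for maps near `c.map` at the point of angle `θ` of the
`i`-th circle. -/
structure TargetChart (i : Fin 4) (θ b : ℝ) (Q : Plane → ℝ × ℝ) : Prop where
  angle : anosov (eAngle θ) = ‖anosov (eAngle θ)‖ • eAngle b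
  smooth : ContDiffAt ℝ 2 Q (c.circle i b)
  base : Q (c.circle i b) = (0, b)
  inv : ∀ᶠ y in 𝓝 (c.circle i b), c.polar i (Q y) = y

theorem exists_targetChart (i : Fin 4) (θ : ℝ) : ∃ b Q, c.TargetChart i θ b Q := by
  obtain ⟨b, hb⟩ := exists_angle θ
  obtain ⟨h1, h2⟩ := c.polar_smooth i (q := (0, b)) (by simpa using c.s₀_pos)
  obtain ⟨Q, Q1, Q2, Q3, Q4⟩ := exists_local_inverse h1 two_ne_zero h2
  rw [← circle_eq] at Q1 Q2 Q3
  exact ⟨b, Q, hb, Q1, Q2, Q3⟩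

/-! ### Lifts of perturbed maps near the boundary circles. -/

section Chart

variable {c} {i : Fin 4} {θ b : ℝ} {Q : Plane → ℝ × ℝ} {ι : Type*} {l : Filter ι}
  {H : ι → Plane → Plane}

theorem TargetChart.map_circle (hQ : c.TargetChart i θ b Q) :
    c.map (c.circle i θ) = c.circle i b :=
  c.map_circle i (norm_pos_iff.2 (anosov_ne_zero (eAngle_ne_zero θ))) hQ.angle

theorem conv_comp_polar (i : Fin 4) (θ : ℝ) (hH : ∀ x ∈ c.clIsl, Conv2 l H c.map x) :
    Conv2 l (fun n => H n ∘ c.polar i) (c.map ∘ c.polar i) (0, θ) := by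
  have h0 : |((0 : ℝ), θ).1| < c.s₀ := by simpa using c.s₀_pos
  have h1 := hH _ (c.circle_mem_clIsl i θ)
  rw [circle_eq] at h1
  exact h1.comp (.of_contDiffAt (c.polar_smooth i h0).1)

theorem TargetChart.conv (hQ : c.TargetChart i θ b Q) (hH : ∀ x ∈ c.clIsl, Conv2 l H c.map x) :
    Conv2 l (fun n => Q ∘ (H n ∘ c.polar i)) (Q ∘ (c.map ∘ c.polar i)) (0, θ) := by
  have hQ2 : Conv2 l (fun _ => Q) Q ((c.map ∘ c.polar i) (0, θ)) := by
    rw [Function.comp_apply, ← circle_eq, hQ.map_circle]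
    exact .of_contDiffAt hQ.smooth
  exact hQ2.comp (conv_comp_polar i θ hH)

theorem TargetChart.model_base (hQ : c.TargetChart i θ b Q) :
    (Q ∘ (c.map ∘ c.polar i)) (0, θ) = (0, b) := by
  rw [Function.comp_apply, Function.comp_apply, ← circle_eq, hQ.map_circle, hQ.base]

theorem TargetChart.eventually (hQ : c.TargetChart i θ b Q)
    (hH : ∀ x ∈ c.clIsl, Conv2 l H c.map x) :
    ∀ᶠ p in l ×ˢ 𝓝 ((0 : ℝ), θ), c.polar i (Q (H p.1 (c.polar i p.2))) = H p.1 (c.polar i p.2) ∧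
      |(Q (H p.1 (c.polar i p.2))).1| < c.s₀ := by
  have t1 : Tendsto (fun p : ι × ℝ × ℝ => H p.1 (c.polar i p.2)) (l ×ˢ 𝓝 (0, θ))
      (𝓝 (c.circle i b)) := by
    have := (conv_comp_polar i θ hH).toConv1.conv
    rwa [Conv0, Function.comp_apply, ← circle_eq, hQ.map_circle] at this
  have t2 : Tendsto (fun p : ι × ℝ × ℝ => |(Q (H p.1 (c.polar i p.2))).1|) (l ×ˢ 𝓝 (0, θ))
      (𝓝 0) := by
    have := (hQ.conv hH).toConv1.conv
    rw [Conv0, hQ.model_base] at this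
    have h2 := ((continuous_abs.comp continuous_fst).tendsto ((0 : ℝ), b)).comp this
    have h3 : (abs ∘ Prod.fst) ((0 : ℝ), b) = 0 := abs_zero
    rw [h3] at h2
    exact h2
  filter_upwards [t1.eventually hQ.inv, t2.eventually_lt_const c.s₀_pos] with p h1 h2
  exact ⟨h1, h2⟩

/-- Invariance of the circles is used here: it makes the radial component of the chart expression
vanish on the boundary. -/
theorem TargetChart.zero (hQ : c.TargetChart i θ b Q) (hH : ∀ x ∈ c.clIsl, Conv2 l H c.map x)
    (hc : ∀ᶠ n in l, ∀ i t, ∃ t', H n (c.circle i t) = c.circle i t') :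
    ∀ᶠ p in l ×ˢ 𝓝 ((0 : ℝ), θ), ((Q ∘ (H p.1 ∘ c.polar i)) (0, p.2.2)).1 = 0 := by
  filter_upwards [(tendsto_zero_fst θ).eventually (hQ.eventually hH), tendsto_fst.eventually hc]
    with p ⟨h1, h2⟩ h3
  obtain ⟨t', ht'⟩ := h3 i p.2.2
  simp only [← circle_eq] at h1 h2
  rw [ht', circle_eq] at h1
  rw [ht', circle_eq] at h2
  have := (c.polar_inj h2 (by simpa using c.s₀_pos) h1).2.1
  rw [Function.comp_apply, Function.comp_apply, ← circle_eq, ht', circle_eq]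
  exact this

theorem conv_map : ∀ x ∈ c.clIsl, Conv2 (pure ()) (fun _ => c.map) c.map x :=
  fun _ hx => .of_contDiffAt (c.contDiffAt_map hx)

theorem map_circle_mem : ∀ᶠ _n : Unit in pure (), ∀ i t, ∃ t', c.map (c.circle i t) =
    c.circle i t' := by
  refine .of_forall fun _ i t => ?_
  obtain ⟨b, hb⟩ := exists_angle t
  exact ⟨b, c.map_circle i (norm_pos_iff.2 (anosov_ne_zero (eAngle_ne_zero t))) hb⟩

/-- In the charts, away from the boundary, the model map is `anosov` itself after blowing down,
because `chi` restricted to the cone coordinates is the polar chart. -/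
theorem TargetChart.model (hQ : c.TargetChart i θ b Q) :
    ∀ᶠ q in 𝓝 ((0 : ℝ), θ), 0 < q.1 → 0 < ((Q ∘ (c.map ∘ c.polar i)) q).1 ∧
      cone ((Q ∘ (c.map ∘ c.polar i)) q) = anosov (cone q) := by
  have hev : ∀ᶠ q in 𝓝 ((0 : ℝ), θ), c.polar i (Q (c.map (c.polar i q))) = c.map (c.polar i q) ∧
      |(Q (c.map (c.polar i q))).1| < c.s₀ := by
    have := hQ.eventually (c.conv_map)
    rw [pure_prod] at this
    exact this
  have hcont : ContinuousAt (Q ∘ (c.map ∘ c.polar i)) (0, θ) :=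
    (hQ.conv c.conv_map).toConv1.diff₀.self_of_nhds.continuousAt
  have hA : Continuous fun q : ℝ × ℝ => anosov (eAngle q.2) :=
    continuous_anosov.comp (continuous_eAngle.comp continuous_snd)
  have hm0 : 0 < ‖anosov (eAngle θ)‖ := norm_pos_iff.2 (anosov_ne_zero (eAngle_ne_zero θ))
  -- The chart determines the angle only modulo `π`; continuity from the base angle `b` excludes the
  -- opposite direction.
  have hsign : ∀ᶠ q in 𝓝 ((0 : ℝ), θ),
      0 < inner ℝ (eAngle ((Q ∘ (c.map ∘ c.polar i)) q).2) (anosov (eAngle q.2)) := by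
    have h1 : Tendsto (fun q => eAngle ((Q ∘ (c.map ∘ c.polar i)) q).2) (𝓝 ((0 : ℝ), θ))
        (𝓝 (eAngle b)) := by
      have := ((continuous_eAngle.comp continuous_snd).tendsto _).comp hcont.tendsto
      rw [hQ.model_base] at this
      exact this
    have h2 := h1.inner (𝕜 := ℝ) (hA.tendsto ((0 : ℝ), θ))
    refine h2.eventually_const_lt ?_
    simp only
    rw [hQ.angle, inner_smul_right, inner_eAngle_self, mul_one]
    exact hm0
  have hsmall : ∀ᶠ q in 𝓝 ((0 : ℝ), θ), q.1 * ‖anosov (eAngle q.2)‖ ^ 2 < c.s₀ := by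
    have h1 : Continuous fun q : ℝ × ℝ => q.1 * ‖anosov (eAngle q.2)‖ ^ 2 :=
      continuous_fst.mul (hA.norm.pow 2)
    refine (h1.tendsto _).eventually_lt_const ?_
    simpa using c.s₀_pos
  have hs : ∀ᶠ q in 𝓝 ((0 : ℝ), θ), q.1 < c.s₀ :=
    (continuous_fst.tendsto ((0 : ℝ), θ)).eventually_lt_const c.s₀_pos
  filter_upwards [hev, hsign, hsmall, hs] with q ⟨h1, h2⟩ h3 h4 h5 h6
  set G := Q ∘ (c.map ∘ c.polar i) with hG
  change c.polar i (G q) = c.map (c.polar i q) at h1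
  change |(G q).1| < c.s₀ at h2
  obtain ⟨β, hβ⟩ := exists_angle q.2
  have hm : 0 < ‖anosov (eAngle q.2)‖ := norm_pos_iff.2 (anosov_ne_zero (eAngle_ne_zero _))
  set m := ‖anosov (eAngle q.2)‖ with hmd
  have hp : 0 < q.1 * m ^ 2 := by positivity
  have hcone : anosov (cone q) = cone (q.1 * m ^ 2, β) := by
    rw [cone, cone, anosov_smul, hβ, smul_smul, ← mul_assoc,
      Real.sqrt_mul (show 0 ≤ 2 * q.1 by positivity) (m ^ 2), Real.sqrt_sq hm.le]
  have hmap : c.map (c.polar i q) = c.polar i (q.1 * m ^ 2, β) := by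
    have hnm := c.cone_add_not_mem i (q := (q.1 * m ^ 2, β)) hp h4
    rw [← c.chi_cone i h6 h5, c.map_chi (c.cone_add_not_mem i h6 h5).1, anosov_add, hcone,
      ← c.chi_cone i (q := (q.1 * m ^ 2, β)) hp h4,
      ← c.chi_add hnm.1 (anosov_sub_mem_lattice (Omega_mem_halfLattice i))]
    congr 1
    abel
  rw [hmap] at h1
  obtain ⟨-, h7, k, h8⟩ := c.polar_inj h2 (q' := (q.1 * m ^ 2, β))
    (by rw [abs_of_pos hp]; exact h4) h1
  have h7 : (G q).1 = q.1 * m ^ 2 := h7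
  have h8 : β = (G q).2 + k * Real.pi := h8
  refine ⟨h7 ▸ hp, ?_⟩
  rw [hcone, cone, cone, h7]
  congr 1
  rcases eAngle_add_int_mul_pi (G q).2 k with h9 | h9
  · rw [h8, h9]
  · exfalso
    rw [← h8] at h9
    rw [hβ, h9, inner_smul_right, inner_neg_right, inner_eAngle_self] at h3
    linarith

/-- For `s > 0` the relation `cone ∘ G = anosov ∘ cone` makes `coneMap G` equal to `anosovL`. By
uniqueness of limits its boundary limit is the same matrix. The convergence results are applied here
to the constant family, indexed over `pure ()`. -/
theorem TargetChart.limits (hQ : c.TargetChart i θ b Q) :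
    0 < (fderiv ℝ (Q ∘ (c.map ∘ c.polar i)) (0, θ) (1, 0)).1 ∧
    coneLimit (Q ∘ (c.map ∘ c.polar i)) θ = anosovL ∧
    Real.sqrt (fderiv ℝ (Q ∘ (c.map ∘ c.polar i)) (0, θ) (1, 0)).1 • eAngle b =
      anosov (eAngle θ) := by
  set G := Q ∘ (c.map ∘ c.polar i) with hG
  have hconv : Conv2 (pure ()) (fun _ => G) G (0, θ) := hQ.conv c.conv_map
  have hzero : ∀ᶠ p in (pure () : Filter Unit) ×ˢ 𝓝 ((0 : ℝ), θ), (G (0, p.2.2)).1 = 0 :=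
    hQ.zero c.conv_map c.map_circle_mem
  have hmod := hQ.model
  rw [← hG] at hmod
  -- Uniqueness of limits requires the boundary point to be a limit of points with `s > 0`.
  have hne : (𝓝[{q : ℝ × ℝ | 0 < q.1}] ((0 : ℝ), θ)).NeBot := by
    rw [← mem_closure_iff_nhdsWithin_neBot]
    have h1 : Tendsto (fun s : ℝ => (s, θ)) (𝓝[>] 0) (𝓝 (0, θ)) :=
      ((Continuous.prodMk_left θ).tendsto 0).mono_left nhdsWithin_le_nhds
    exact mem_closure_of_tendsto h1 (by filter_upwards [self_mem_nhdsWithin] with s hs using hs)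
  have hT : Tendsto (fun q : ℝ × ℝ => ((), q)) (𝓝[{q : ℝ × ℝ | 0 < q.1}] ((0 : ℝ), θ))
      (((pure () : Filter Unit) ×ˢ 𝓝 ((0 : ℝ), θ)) ⊓ 𝓟 {p | 0 < p.2.1}) := by
    refine tendsto_inf.2 ⟨?_, ?_⟩
    · exact tendsto_const_pure.prodMk (tendsto_id.mono_left nhdsWithin_le_nhds)
    · exact tendsto_principal.2 self_mem_nhdsWithin
  have hmod' := eventually_nhdsWithin_iff.2 hmod
  have hc : Tendsto (fun q : ℝ × ℝ => anosov (eAngle q.2)) (𝓝[{q : ℝ × ℝ | 0 < q.1}] ((0 : ℝ), θ))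
      (𝓝 (anosov (eAngle θ))) :=
    ((continuous_anosov.comp (continuous_eAngle.comp continuous_snd)).tendsto
      ((0 : ℝ), θ)).mono_left nhdsWithin_le_nhds
  have g1 : (fderiv ℝ G (0, θ) (1, 0)).1 = ‖anosov (eAngle θ)‖ ^ 2 := by
    refine tendsto_nhds_unique_of_eventuallyEq ((tendsto_fst_div hconv hzero).comp hT)
      (hc.norm.pow 2) ?_
    filter_upwards [hmod', self_mem_nhdsWithin] with q ⟨h1, h2⟩ h3
    have h3 : 0 < q.1 := h3
    have h4 : ‖cone (G q)‖ ^ 2 = ‖anosov (cone q)‖ ^ 2 := by rw [h2]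
    rw [norm_cone, cone, anosov_smul, norm_smul, mul_pow, Real.sq_sqrt (by linarith),
      Real.norm_of_nonneg (Real.sqrt_nonneg _), Real.sq_sqrt (by linarith)] at h4
    change (G q).1 / q.1 = _
    rw [div_eq_iff h3.ne']
    linarith
  have hpos : 0 < (fderiv ℝ G (0, θ) (1, 0)).1 := by
    rw [g1]
    have := norm_pos_iff.2 (anosov_ne_zero (eAngle_ne_zero θ))
    positivity
  refine ⟨hpos, ?_, ?_⟩
  · refine tendsto_nhds_unique_of_eventuallyEq ((tendsto_coneMap hconv hzero hpos).comp hT)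
      tendsto_const_nhds ?_
    have hd : ∀ᶠ q in 𝓝 ((0 : ℝ), θ), DifferentiableAt ℝ G q := hconv.toConv1.diff₀
    filter_upwards [nhdsWithin_le_nhds hmod.eventually_nhds, nhdsWithin_le_nhds hd,
      self_mem_nhdsWithin] with q h1 h2 h3
    have h3 : 0 < q.1 := h3
    have h4 : (fun y => cone (G y)) =ᶠ[𝓝 q] fun y => anosovL (cone y) := by
      filter_upwards [h1, continuous_fst.continuousAt.eventually_const_lt h3] with y hy hy'
      rw [(hy hy').2, anosovL_apply]
    have hGq := (h1.self_of_nhds h3).1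
    have e1 : HasFDerivAt (fun y => cone (G y)) _ q :=
      (hasFDerivAt_cone hGq).comp q h2.hasFDerivAt
    have e2 : HasFDerivAt (fun y => anosovL (cone y)) _ q :=
      anosovL.hasFDerivAt.comp q (hasFDerivAt_cone h3)
    have e3 := e1.unique (e2.congr_of_eventuallyEq h4)
    rw [← coneMap_comp h3 hGq] at e3
    refine ContinuousLinearMap.ext fun v => ?_
    obtain ⟨u, rfl⟩ := dcone_surjective h3 v
    exact DFunLike.congr_fun e3 u
  · rw [g1, Real.sqrt_sq (norm_nonneg _), ← hQ.angle]

/-- The lift is `cone (G q)` about the same centre, moved by a lattice vector, with differential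
`coneMap G`, which tends to `anosovL`. Its displacement from `anosov` is `√(2s)` times a vector that
tends to zero, and `√(2s)` is exactly the distance to the half lattice. -/
theorem lifts_boundary (hH : ∀ x ∈ c.clIsl, Conv2 l H c.map x)
    (hc : ∀ᶠ n in l, ∀ i t, ∃ t', H n (c.circle i t) = c.circle i t') {r : ℝ} (hr : 0 < r)
    (i : Fin 4) (θ : ℝ) :
    ∀ᶠ p in l ×ˢ 𝓝 ((0 : ℝ), θ), 0 < p.2.1 → Lifts c (H p.1) r (Omega i + cone p.2) := by
  obtain ⟨b, Q, hQ⟩ := c.exists_targetChart i θ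
  obtain ⟨hpos, hlim, hang⟩ := hQ.limits
  have hconv := hQ.conv hH
  have hzero := hQ.zero hH hc
  set k := (l ×ˢ 𝓝 ((0 : ℝ), θ)) ⊓ 𝓟 {p : ι × ℝ × ℝ | 0 < p.2.1} with hk
  have hkl : k ≤ l ×ˢ 𝓝 ((0 : ℝ), θ) := inf_le_left
  have t1 := tendsto_fst_div hconv hzero
  have t2 := tendsto_coneMap hconv hzero hpos
  have t3 := tendsto_cone_div hconv hzero
  rw [hQ.model_base] at t3
  rw [hang] at t3
  rw [hlim] at t2
  have t4 : Tendsto (fun p : ι × ℝ × ℝ => anosov (eAngle p.2.2)) k (𝓝 (anosov (eAngle θ))) :=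
    ((continuous_anosov.comp (continuous_eAngle.comp continuous_snd)).tendsto
      ((0 : ℝ), θ)).comp (tendsto_snd.mono_left hkl)
  have t5 := (t3.sub t4).norm
  rw [sub_self, norm_zero] at t5
  have hs : ∀ᶠ p in l ×ˢ 𝓝 ((0 : ℝ), θ), p.2.1 < c.s₀ :=
    eventually_prod_of_nhds
      ((continuous_fst.tendsto ((0 : ℝ), θ)).eventually_lt_const c.s₀_pos)
  have h0 : |((0 : ℝ), θ).1| < c.s₀ := by simpa using c.s₀_pos
  have hHd : ∀ᶠ p in l ×ˢ 𝓝 ((0 : ℝ), θ), DifferentiableAt ℝ (H p.1) (c.polar i p.2) := by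
    have h1 := (hH _ (c.circle_mem_clIsl i θ)).toConv1.diff
    rw [circle_eq] at h1
    exact (Conv0.of_continuousAt (c.polar_smooth i h0).1.continuousAt).tendsto_prodMk.eventually h1
  have main : ∀ᶠ p in k, Lifts c (H p.1) r (Omega i + cone p.2) := by
    filter_upwards [t1.eventually_const_lt hpos, t2.eventually (Metric.closedBall_mem_nhds _ hr),
      t5.eventually_lt_const hr, hkl hs, hkl (eventually_prod_nhds (hQ.eventually hH)),
      hkl hconv.toConv1.diff, hkl hHd, mem_inf_of_right (mem_principal_self _)]
      with p a1 a2 a3 a4 a5 a6 a7 a8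
    have a8 : 0 < p.2.1 := a8
    set G := Q ∘ (H p.1 ∘ c.polar i) with hG
    -- The quotient `G₁ / s` is near a positive limit, so points of the island side remain on that
    -- side.
    have hGpos : 0 < (G p.2).1 := by
      have := mul_pos a1 a8
      rwa [div_mul_cancel₀ _ a8.ne'] at this
    have hGlt : (G p.2).1 < c.s₀ := lt_of_abs_lt a5.self_of_nhds.2
    have n1 := c.cone_add_not_mem i hGpos hGlt
    have n2 := c.cone_add_not_mem i a8 a4
    have hl := anosov_sub_mem_lattice (Omega_mem_halfLattice i)
    have hchi : c.chi (Omega i + cone p.2) = c.polar i p.2 := c.chi_cone i a8 a4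
    refine ⟨Omega i + cone (G p.2) + (anosov (Omega i) - Omega i), fun h => n1.1 ?_,
      coneMap G p.2, ?_, ?_, ?_, ?_⟩
    · simpa using sub_mem_halfLattice h (lattice_subset_halfLattice hl)
    · rw [c.chi_add n1.1 hl, c.chi_cone i hGpos hGlt, hchi]
      exact a5.self_of_nhds.1
    · rw [c.fderiv_chi_add n1.1 hl, hchi]
      refine ContinuousLinearMap.ext fun v => ?_
      obtain ⟨u, rfl⟩ := dcone_surjective a8 v
      have e1 := DFunLike.congr_fun (coneMap_comp a8 hGpos) u
      have e2 := DFunLike.congr_fun (c.chi_dcone i a8 a4) u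
      have e3 := c.chi_dcone i hGpos hGlt
      simp only [ContinuousLinearMap.comp_apply] at e1 e2 ⊢
      rw [e1, e2]
      have e4 := DFunLike.congr_fun e3 (fderiv ℝ G p.2 u)
      rw [ContinuousLinearMap.comp_apply] at e4
      rw [e4]
      have s1 : DifferentiableAt ℝ (c.polar i) (G p.2) :=
        (c.polar_smooth i (by rw [abs_of_pos hGpos]; exact hGlt)).1.differentiableAt two_ne_zero
      have s2 : DifferentiableAt ℝ (c.polar i) p.2 :=
        (c.polar_smooth i (by rw [abs_of_pos a8]; exact a4)).1.differentiableAt two_ne_zero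
      have e5 : (fun y => c.polar i (G y)) =ᶠ[𝓝 p.2] fun y => H p.1 (c.polar i y) :=
        a5.mono fun y hy => hy.1
      have e6 := (s1.hasFDerivAt.comp p.2 a6.hasFDerivAt).unique
        (HasFDerivAt.congr_of_eventuallyEq (a7.hasFDerivAt.comp p.2 s2.hasFDerivAt) e5)
      exact DFunLike.congr_fun e6 u
    · rw [← dist_eq_norm]; exact a2
    · have e1 : Omega i + cone (G p.2) + (anosov (Omega i) - Omega i) - anosov (Omega i + cone p.2) =
          cone (G p.2) - anosov (cone p.2) := by
        rw [anosov_add]; abel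
      have e2 : cone (G p.2) - anosov (cone p.2) = Real.sqrt (2 * p.2.1) •
          (Real.sqrt ((G p.2).1 / p.2.1) • eAngle (G p.2).2 - anosov (eAngle p.2.2)) := by
        rw [cone, cone, anosov_smul, smul_sub, smul_smul, ← Real.sqrt_mul (by linarith),
          mul_assoc, mul_div_cancel₀ _ a8.ne']
      rw [e1, e2, norm_smul, centerDist_add_of_lt (Omega_mem_halfLattice i) n2.2, norm_cone,
        Real.norm_of_nonneg (Real.sqrt_nonneg _), mul_comm]
      exact mul_le_mul_of_nonneg_right a3.le (Real.sqrt_nonneg _)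
  rw [hk, eventually_inf_principal] at main
  exact main

end Chart

theorem exists_cone_coords {w : Plane} (hw : w ∉ halfLattice) (h : centerDist w < Real.sqrt c.s₀) :
    ∃ i, ∃ a ∈ lattice, ∃ q : ℝ × ℝ, q ∈ Icc (0 : ℝ) (c.s₀ / 2) ×ˢ Icc (0 : ℝ) (2 * Real.pi) ∧
      0 < q.1 ∧ w = Omega i + cone q + a ∧ w - center w = cone q := by
  have hs := c.s₀_pos
  obtain ⟨i, a, ha, hO⟩ := exists_Omega_add (center_mem_halfLattice w)
  have hcd := centerDist_pos hw
  have h0 : w - center w ≠ 0 := norm_pos_iff.1 hcd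
  obtain ⟨t, ht⟩ := exists_eAngle_eq h0
  obtain ⟨k, hk, -⟩ := existsUnique_sub_zsmul_mem_Ico Real.two_pi_pos t 0
  rw [zero_add] at hk
  have he : eAngle (t - k • (2 * Real.pi)) = eAngle t := by
    rw [eAngle_eq_iff]
    exact ⟨k, by rw [zsmul_eq_mul]; ring⟩
  have hsq : Real.sqrt (2 * (centerDist w ^ 2 / 2)) = centerDist w := by
    rw [mul_div_cancel₀ _ two_ne_zero, Real.sqrt_sq hcd.le]
  have hcone : w - center w = cone (centerDist w ^ 2 / 2, t - k • (2 * Real.pi)) := by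
    simp only [cone]
    rw [he, hsq, centerDist, ← ht]
  have hlt : centerDist w ^ 2 < c.s₀ := by
    rw [← Real.sq_sqrt hs.le]
    exact pow_lt_pow_left₀ h hcd.le two_ne_zero
  have hp : 0 < centerDist w ^ 2 / 2 := by positivity
  refine ⟨i, a, ha, (centerDist w ^ 2 / 2, t - k • (2 * Real.pi)),
    ⟨⟨hp.le, by simp only; linarith⟩, ⟨hk.1, hk.2.le⟩⟩, hp, ?_, hcone⟩
  rw [← hcone, hO]
  abel

/-- Modulo the lattice two compact sets suffice: polar rectangles that include the boundary `s = 0`,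
and the part of a ball away from the half lattice. The threshold `√s₀` on the distance corresponds
to `s = s₀ / 2`. -/
theorem lifts_all {ι : Type*} {l : Filter ι} {H : ι → Plane → Plane}
    (hH : ∀ x ∈ c.clIsl, Conv2 l H c.map x)
    (hc : ∀ᶠ n in l, ∀ i t, ∃ t', H n (c.circle i t) = c.circle i t') {r : ℝ} (hr : 0 < r) :
    ∀ᶠ n in l, ∀ w ∉ halfLattice, Lifts c (H n) r w := by
  have hs := c.s₀_pos
  have near : ∀ i, ∀ᶠ n in l, ∀ q ∈ Icc (0 : ℝ) (c.s₀ / 2) ×ˢ Icc (0 : ℝ) (2 * Real.pi),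
      0 < q.1 → Lifts c (H n) r (Omega i + cone q) := by
    intro i
    refine eventually_forall_mem_of_isCompact (isCompact_Icc.prod isCompact_Icc)
      (P := fun n q => 0 < q.1 → Lifts c (H n) r (Omega i + cone q)) fun q hq => ?_
    rcases hq.1.1.eq_or_lt with h | h
    · have hq0 : q = (0, q.2) := Prod.ext h.symm rfl
      rw [hq0]
      exact lifts_boundary hH hc hr i q.2
    · have hnm := c.cone_add_not_mem i h (hq.1.2.trans_lt (by linarith))
      have h1 := c.lifts_interior hH hr hnm.1
      have h2 : Tendsto (fun p : ι × ℝ × ℝ => (p.1, Omega i + cone p.2)) (l ×ˢ 𝓝 q)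
          (l ×ˢ 𝓝 (Omega i + cone q)) :=
        tendsto_fst.prodMk ((((hasFDerivAt_cone h).continuousAt.const_add (Omega i)).tendsto).comp
          tendsto_snd)
      exact (h2.eventually h1).mono fun p hp _ => hp
  have far : ∀ᶠ n in l, ∀ w ∈ {w | Real.sqrt c.s₀ ≤ centerDist w} ∩ Metric.closedBall 0 2,
      Lifts c (H n) r w := by
    refine eventually_forall_mem_of_isCompact ((isCompact_closedBall _ _).inter_left
      (isClosed_le continuous_const continuous_centerDist)) fun w hw => ?_
    refine c.lifts_interior hH hr fun h => ?_
    have h1 : Real.sqrt c.s₀ ≤ centerDist w := hw.1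
    rw [centerDist_eq_zero_iff.2 h] at h1
    exact absurd (Real.sqrt_pos.2 hs) (not_lt.2 h1)
  filter_upwards [eventually_all.2 near, far] with n hn hf w hw
  rcases le_or_gt (Real.sqrt c.s₀) (centerDist w) with h | h
  · obtain ⟨w₁, hw₁, a, ha, rfl⟩ := exists_mem_closedBall w
    have hw₁' : w₁ ∉ halfLattice :=
      fun h' => hw (add_mem_halfLattice h' (lattice_subset_halfLattice ha))
    rw [centerDist_add _ (lattice_subset_halfLattice ha)] at h
    exact (hf w₁ ⟨h, hw₁⟩).add hw₁' ha
  · obtain ⟨i, a, ha, q, hq, hq0, hwq, -⟩ := c.exists_cone_coords hw h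
    rw [hwq]
    exact (hn i q hq hq0).add
      (c.cone_add_not_mem i hq0 (hq.1.2.trans_lt (by linarith))).1 ha

end Choices

end StochasticIsland
end

noncomputable section

namespace StochasticIsland

open Filter Set

/-! ### Expansion along orbits -/

theorem exists_lower_bound {X E G : Type*} [TopologicalSpace X] [NormedAddCommGroup E]
    [NormedSpace ℝ E] [FiniteDimensional ℝ E] [NormedAddCommGroup G] [NormedSpace ℝ G] {K : Set X}
    (hK : IsCompact K) {L : X → E →L[ℝ] G} (hL : ContinuousOn L K)
    (hi : ∀ x ∈ K, (L x).IsInvertible) : ∃ m > 0, ∀ x ∈ K, ∀ v, m * ‖v‖ ≤ ‖L x v‖ := by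
  have : ProperSpace E := FiniteDimensional.proper_real E
  have hc : ContinuousOn (fun p : X × E => ‖L p.1 p.2‖) (K ×ˢ Metric.sphere (0 : E) 1) :=
    ((hL.comp continuousOn_fst fun p hp => hp.1).clm_apply continuousOn_snd).norm
  obtain ⟨m, hm, h⟩ := (hK.prod (isCompact_sphere (0 : E) 1)).exists_forall_le' hc (a := 0)
    fun p hp => by
      rw [norm_pos_iff]
      intro h0
      have h1 := isInvertible_ker (hi p.1 hp.1) h0
      have h2 := hp.2
      rw [h1] at h2
      simp at h2
  refine ⟨m, hm, fun x hx v => ?_⟩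
  by_cases hv : v = 0
  · simp [hv]
  have hn : 0 < ‖v‖ := norm_pos_iff.2 hv
  have h1 := h (x, ‖v‖⁻¹ • v) ⟨hx, by
    rw [mem_sphere_zero_iff_norm, norm_smul, norm_inv, norm_norm, inv_mul_cancel₀ hn.ne']⟩
  simp only [map_smul, norm_smul, norm_inv, norm_norm] at h1
  rwa [inv_mul_eq_div, le_div_iff₀ hn] at h1

/-- In the cone the error is at most `|u|`, since `‖z‖ ≤ 2 |u|`. With `exp sigma > 17` this gives
`|u'| ≥ 16 |u|`, while `|v'| ≤ 2 |u|`. It serves both for tangent vectors and for the displacement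
of an orbit from the half lattice. -/
theorem unstable_step {z z' : Plane} (h : ‖z' - anosov z‖ ≤ 1 / 2 * ‖z‖)
    (hz : |vC z| ≤ |uC z|) : 16 * |uC z| ≤ |uC z'| ∧ |vC z'| ≤ |uC z'| / 8 := by
  have h1 := exp_sigma_gt
  have h2 := exp_neg_sigma_lt
  have h3 := norm_le_abs_add_abs z
  have hu := abs_uC_le (z' - anosov z)
  have hv := abs_vC_le (z' - anosov z)
  have eu : uC z' = Real.exp sigma * uC z + uC (z' - anosov z) := by
    rw [uC_sub, uC_anosov]; ring
  have ev : vC z' = Real.exp (-sigma) * vC z + vC (z' - anosov z) := by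
    rw [vC_sub, vC_anosov]; ring
  have b1 : Real.exp sigma * |uC z| - |uC (z' - anosov z)| ≤ |uC z'| := by
    rw [eu]
    have := abs_sub_abs_le_abs_sub (Real.exp sigma * uC z) (-uC (z' - anosov z))
    rwa [abs_neg, sub_neg_eq_add, abs_mul, Real.abs_exp] at this
  have b2 : |vC z'| ≤ Real.exp (-sigma) * |vC z| + |vC (z' - anosov z)| := by
    rw [ev]
    have := abs_add_le (Real.exp (-sigma) * vC z) (vC (z' - anosov z))
    rwa [abs_mul, Real.abs_exp] at this
  have a0 := abs_nonneg (uC z)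
  have a1 := abs_nonneg (vC z)
  have c1 : 17 * |uC z| ≤ Real.exp sigma * |uC z| := mul_le_mul_of_nonneg_right h1.le a0
  have c2 : Real.exp (-sigma) * |vC z| ≤ 1 / 17 * |vC z| := mul_le_mul_of_nonneg_right h2.le a1
  constructor <;> linarith

theorem exp_sigma_lt : Real.exp sigma < 18 := by
  rw [exp_sigma]; linarith [sqrt_five_lt]

theorem norm_step {z z' : Plane} (h : ‖z' - anosov z‖ ≤ 1 / 2 * ‖z‖) : ‖z'‖ ≤ 20 * ‖z‖ := by
  have h1 := exp_sigma_lt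
  have h2 := exp_neg_sigma_lt
  have h3 := norm_le_abs_add_abs (anosov z)
  rw [uC_anosov, vC_anosov, abs_mul, abs_mul, Real.abs_exp, Real.abs_exp] at h3
  have c1 := mul_le_mul h1.le (abs_uC_le z) (abs_nonneg _) (by norm_num)
  have c2 := mul_le_mul h2.le (abs_vC_le z) (abs_nonneg _) (by norm_num)
  have h4 := norm_add_le (z' - anosov z) (anosov z)
  rw [sub_add_cancel] at h4
  linarith [norm_nonneg z]

namespace Choices

variable (c : Choices)

/-- A radius below which points are near the half-lattice. -/
def r₀ : ℝ := min (Real.sqrt c.s₀) (1 / 100)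

theorem r₀_pos : 0 < c.r₀ := lt_min (Real.sqrt_pos.2 c.s₀_pos) (by norm_num)

theorem r₀_le : c.r₀ ≤ 1 / 100 := min_le_right _ _

theorem exists_fderiv_bound_far : ∃ m > 0, ∀ w, c.r₀ ≤ centerDist w →
    ∀ v, m * ‖v‖ ≤ ‖fderiv ℝ c.chi w v‖ := by
  have hno : ∀ {w}, c.r₀ ≤ centerDist w → w ∉ halfLattice := fun hw h => by
    rw [centerDist_eq_zero_iff.2 h] at hw
    exact absurd c.r₀_pos (not_lt.2 hw)
  have hK : IsCompact ({w | c.r₀ ≤ centerDist w} ∩ Metric.closedBall (0 : Plane) 2) :=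
    (isCompact_closedBall _ _).inter_left (isClosed_le continuous_const continuous_centerDist)
  obtain ⟨m, hm, h⟩ := exists_lower_bound hK (L := fderiv ℝ c.chi)
    (fun w hw => ((c.chi_smooth (hno hw.1)).1.fderiv_right (m := 1)
      (by norm_num)).continuousAt.continuousWithinAt)
    fun w hw => (c.chi_smooth (hno hw.1)).2
  refine ⟨m, hm, fun w hw v => ?_⟩
  obtain ⟨w₁, hw₁, a, ha, rfl⟩ := exists_mem_closedBall w
  rw [centerDist_add _ (lattice_subset_halfLattice ha)] at hw
  rw [c.fderiv_chi_add (hno hw) ha]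
  exact h w₁ ⟨hw, hw₁⟩ v

/-- At a point nearer to the stable axis than to the unstable one, an unstable vector has an angular
component comparable to its length. The blow-down coordinates divide that component by `√(2s) ≤ 1`,
so it does not shrink, and the polar chart has differential bounded below up to the boundary. -/
theorem exists_fderiv_bound_near : ∃ m > 0, ∀ w ∉ halfLattice, centerDist w < c.r₀ →
    |uC (w - center w)| ≤ |vC (w - center w)| → ∀ v, |vC v| ≤ |uC v| / 8 →
      m * |uC v| ≤ ‖fderiv ℝ c.chi w v‖ := by
  have hs := c.s₀_pos
  have hlt : ∀ (i : Fin 4), ∀ q ∈ Icc (0 : ℝ) (c.s₀ / 2) ×ˢ Icc (0 : ℝ) (2 * Real.pi),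
      |q.1| < c.s₀ := fun i q hq => by
    rw [abs_of_nonneg hq.1.1]; linarith [hq.1.2]
  choose m hm hb using fun i : Fin 4 => exists_lower_bound (L := fderiv ℝ (c.polar i))
    (isCompact_Icc.prod isCompact_Icc : IsCompact (Icc (0 : ℝ) (c.s₀ / 2) ×ˢ
      Icc (0 : ℝ) (2 * Real.pi)))
    (fun q hq => ((c.polar_smooth i (hlt i q hq)).1.fderiv_right (m := 1)
      (by norm_num)).continuousAt.continuousWithinAt)
    fun q hq => (c.polar_smooth i (hlt i q hq)).2
  obtain ⟨μ, hμ, hμm⟩ : ∃ μ > 0, ∀ i, μ ≤ m i := by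
    obtain ⟨j, hj⟩ := Finite.exists_min m
    exact ⟨m j, hm j, hj⟩
  refine ⟨μ / 3, by positivity, fun w hw hr hpos v hv => ?_⟩
  obtain ⟨i, a, ha, q, hq, hq0, hwq, hcen⟩ := c.exists_cone_coords hw
    (hr.trans_le (min_le_left _ _))
  have hqs : q.1 < c.s₀ := lt_of_abs_lt (hlt i q hq)
  have hn := c.cone_add_not_mem i hq0 hqs
  have hD : fderiv ℝ c.chi w = fderiv ℝ c.chi (Omega i + cone q) := by
    rw [hwq, c.fderiv_chi_add hn.1 ha]
  obtain ⟨x, hx⟩ := dcone_surjective hq0 v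
  have e1 : fderiv ℝ c.chi w v = fderiv ℝ (c.polar i) q x := by
    rw [hD, ← hx, ← c.chi_dcone i hq0 hqs]; rfl
  have hsq0 : 0 < Real.sqrt (2 * q.1) := Real.sqrt_pos.2 (by linarith)
  have hsq1 : Real.sqrt (2 * q.1) ≤ 1 := by
    rw [← norm_cone]; linarith [hn.2]
  have e2 : x.2 * Real.sqrt (2 * q.1) = -Real.sin q.2 * uC v + Real.cos q.2 * vC v := by
    rw [← hx, dcone_apply, uC_add, vC_add, uC_smul, uC_smul, vC_smul, vC_smul]
    simp only [uC_eAngle, vC_eAngle, Real.cos_add_pi_div_two, Real.sin_add_pi_div_two]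
    linear_combination (-(x.2 * Real.sqrt (2 * q.1))) * Real.sin_sq_add_cos_sq q.2
  rw [hcen, cone, uC_smul, vC_smul, uC_eAngle, vC_eAngle, abs_mul, abs_mul,
    abs_of_pos hsq0] at hpos
  have h1 : |Real.cos q.2| ≤ |Real.sin q.2| := le_of_mul_le_mul_left hpos hsq0
  -- Since `|cos| ≤ |sin|`; the angular part is then at least `1/2 · 7/8 · |u|`, which exceeds `|u|
  -- / 3`.
  have h2 : 1 / 2 ≤ |Real.sin q.2| := by
    have := Real.sin_sq_add_cos_sq q.2
    rw [← sq_abs, ← sq_abs (Real.cos q.2)] at this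
    nlinarith [abs_nonneg (Real.sin q.2), abs_nonneg (Real.cos q.2)]
  have h3 : |uC v| / 3 ≤ |x.2| := by
    have h4 : |x.2 * Real.sqrt (2 * q.1)| ≤ |x.2| := by
      rw [abs_mul, abs_of_pos hsq0]
      exact mul_le_of_le_one_right (abs_nonneg _) hsq1
    have h5 : |Real.sin q.2| * |uC v| - |Real.cos q.2| * |vC v| ≤ |x.2 * Real.sqrt (2 * q.1)| := by
      rw [e2, ← abs_mul, ← abs_mul, neg_mul, neg_add_eq_sub, abs_sub_comm]
      exact abs_sub_abs_le_abs_sub _ _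
    have h6 : |Real.cos q.2| * |vC v| ≤ |Real.sin q.2| * (|uC v| / 8) :=
      mul_le_mul h1 hv (abs_nonneg _) (abs_nonneg _)
    have h7 : 1 / 2 * (|uC v| - |uC v| / 8) ≤ |Real.sin q.2| * (|uC v| - |uC v| / 8) :=
      mul_le_mul_of_nonneg_right h2 (by linarith [abs_nonneg (uC v)])
    linarith [abs_nonneg (uC v)]
  have h4 : |x.2| ≤ ‖x‖ := norm_snd_le x
  have h5 := hb i q hq x
  rw [e1]
  have h6 : μ * ‖x‖ ≤ m i * ‖x‖ := mul_le_mul_of_nonneg_right (hμm i) (norm_nonneg _)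
  have h7 : μ * (|uC v| / 3) ≤ μ * ‖x‖ := mul_le_mul_of_nonneg_left (h3.trans h4) hμ.le
  linarith

/-- Lifts are chosen pointwise and iterated on a point together with a tangent vector. No continuity
of the choice is needed, since only the images under `chi` and its differential matter. -/
theorem exists_orbit {H : Plane → Plane} (hL : ∀ w ∉ halfLattice, Lifts c H (1 / 2) w)
    {w₀ : Plane} (hw : w₀ ∉ halfLattice) : ∃ W v : ℕ → Plane, W 0 = w₀ ∧ v 0 = eU ∧
      ∀ n, W n ∉ halfLattice ∧ c.chi (W (n + 1)) = H (c.chi (W n)) ∧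
        fderiv ℝ c.chi (W (n + 1)) (v (n + 1)) =
          fderiv ℝ H (c.chi (W n)) (fderiv ℝ c.chi (W n) (v n)) ∧
        ‖v (n + 1) - anosov (v n)‖ ≤ 1 / 2 * ‖v n‖ ∧
        ‖W (n + 1) - anosov (W n)‖ ≤ 1 / 2 * centerDist (W n) := by
  choose! f hf M h1 h2 h3 h4 using hL
  let P : ℕ → Plane × Plane := fun n => (fun p : Plane × Plane => (f p.1, M p.1 p.2))^[n] (w₀, eU)
  have hP : ∀ n, P (n + 1) = (f (P n).1, M (P n).1 (P n).2) := fun n =>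
    Function.iterate_succ_apply' _ _ _
  have hmem : ∀ n, (P n).1 ∉ halfLattice := by
    intro n
    induction n with
    | zero => exact hw
    | succ k ih => rw [hP]; exact hf _ ih
  refine ⟨fun n => (P n).1, fun n => (P n).2, rfl, rfl, fun n => ⟨hmem n, ?_, ?_, ?_, ?_⟩⟩
  · simp only [hP]; exact h1 _ (hmem n)
  · simp only [hP]; exact DFunLike.congr_fun (h2 _ (hmem n)) _
  · simp only [hP]
    have := (M (P n).1 - anosovL).le_of_opNorm_le (h3 _ (hmem n)) (P n).2
    rwa [sub_apply, anosovL_apply] at this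
  · simp only [hP]; exact h4 _ (hmem n)

theorem pow_le_of_step {v : ℕ → Plane} (h : ∀ n, ‖v (n + 1) - anosov (v n)‖ ≤ 1 / 2 * ‖v n‖)
    {N : ℕ} (hv : |vC (v N)| ≤ |uC (v N)|) (n : ℕ) :
    16 ^ n * |uC (v N)| ≤ |uC (v (N + n))| ∧ |vC (v (N + n))| ≤ |uC (v (N + n))| := by
  induction n with
  | zero => simpa using hv
  | succ k ih =>
    obtain ⟨h1, h2⟩ := unstable_step (h (N + k)) ih.2
    rw [← add_assoc]
    refine ⟨?_, h2.trans (by linarith [abs_nonneg (uC (v (N + k + 1)))])⟩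
    calc 16 ^ (k + 1) * |uC (v N)| = 16 * (16 ^ k * |uC (v N)|) := by ring
      _ ≤ 16 * |uC (v (N + k))| := by linarith [ih.1]
      _ ≤ _ := h1

/-- Either the orbit returns infinitely often to the region where the differential of `chi` is
bounded below, or it eventually stays near the half lattice. In the second case it must remain on
the stable side of the diagonals, where the other lower bound applies to unstable vectors.
Infinitely many times suffice for an upper limit. -/
theorem frequently_bound {W v : ℕ → Plane} (h0 : v 0 = eU) (hW : ∀ n, W n ∉ halfLattice)
    (hv : ∀ n, ‖v (n + 1) - anosov (v n)‖ ≤ 1 / 2 * ‖v n‖)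
    (hWs : ∀ n, ‖W (n + 1) - anosov (W n)‖ ≤ 1 / 2 * centerDist (W n)) :
    ∃ m > 0, ∃ᶠ n in atTop, m * 16 ^ n ≤ ‖fderiv ℝ c.chi (W n) (v n)‖ := by
  obtain ⟨m₁, hm₁, hfar⟩ := c.exists_fderiv_bound_far
  obtain ⟨m₂, hm₂, hnear⟩ := c.exists_fderiv_bound_near
  have hbase : |vC (v 0)| ≤ |uC (v 0)| := by rw [h0, vC_eU, uC_eU]; simp
  have hgrow : ∀ n, 16 ^ n ≤ |uC (v n)| ∧ |vC (v n)| ≤ |uC (v n)| / 8 := by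
    intro n
    have h1 := pow_le_of_step hv hbase n
    rw [zero_add, h0, uC_eU, abs_one, mul_one] at h1
    refine ⟨h1.1, ?_⟩
    cases n with
    | zero => rw [h0, vC_eU, uC_eU]; simp
    | succ k =>
      have h2 := pow_le_of_step hv hbase k
      rw [zero_add] at h2
      exact (unstable_step (hv k) h2.2).2
  by_cases hcase : ∃ᶠ n in atTop, c.r₀ ≤ centerDist (W n)
  · refine ⟨m₁, hm₁, hcase.mono fun n hn => ?_⟩
    refine le_trans ?_ (hfar _ hn (v n))
    exact mul_le_mul_of_nonneg_left ((hgrow n).1.trans (abs_uC_le _)) hm₁.le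
  · rw [not_frequently] at hcase
    obtain ⟨N, hN⟩ := eventually_atTop.1 hcase
    simp only [not_le] at hN
    -- One step multiplies the offset by at most `20`, and `20 r₀ ≤ 1 / 5 < 1 / 4`; hence the
    -- nearest half-lattice point is carried by `anosov`, and the offsets form a perturbed linear
    -- orbit.
    have hstep : ∀ n ≥ N, ‖(W (n + 1) - center (W (n + 1))) - anosov (W n - center (W n))‖ ≤
        1 / 2 * ‖W n - center (W n)‖ := by
      intro n hn
      have e1 : W (n + 1) - anosov (center (W n)) - anosov (W n - center (W n)) =
          W (n + 1) - anosov (W n) := by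
        rw [anosov_sub]; abel
      have h1 : ‖W (n + 1) - anosov (center (W n)) - anosov (W n - center (W n))‖ ≤
          1 / 2 * ‖W n - center (W n)‖ := by rw [e1]; exact hWs n
      have h2 := norm_step h1
      have h3 : ‖W n - center (W n)‖ < c.r₀ := hN n hn
      have h4 : center (W (n + 1)) = anosov (center (W n)) :=
        center_eq (anosov_mem_halfLattice_iff.2 (center_mem_halfLattice _))
          (by linarith [c.r₀_le])
      rw [h4]
      exact h1
    -- An offset inside the unstable cone would grow like `16 ^ k` and leave the `r₀`-neighbourhood.
    have hpos : ∀ n ≥ N, |uC (W n - center (W n))| ≤ |vC (W n - center (W n))| := by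
      intro n hn
      by_contra! hlt
      have h1 := fun k => (pow_le_of_step (v := fun k => W (n + k) - center (W (n + k)))
        (fun k => hstep (n + k) (hn.trans (Nat.le_add_right _ _))) (N := 0) hlt.le k).1
      have hu : 0 < |uC (W n - center (W n))| := (abs_nonneg _).trans_lt hlt
      obtain ⟨k, hk⟩ := pow_unbounded_of_one_lt (1 / |uC (W n - center (W n))|)
        (by norm_num : (1 : ℝ) < 16)
      have h2 := h1 k
      rw [zero_add] at h2
      have h3 : |uC (W (n + k) - center (W (n + k)))| < c.r₀ :=
        (abs_uC_le _).trans_lt (hN (n + k) (hn.trans (Nat.le_add_right _ _)))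
      rw [div_lt_iff₀ hu] at hk
      have h4 : (16 : ℝ) ^ k * |uC (W n - center (W n))| ≤
        |uC (W (n + k) - center (W (n + k)))| := h2
      linarith [c.r₀_le]
    refine ⟨m₂, hm₂, Eventually.frequently ?_⟩
    filter_upwards [eventually_ge_atTop N] with n hn
    refine le_trans ?_ (hnear (W n) (hW n) (hN n hn) (hpos n hn) (v n) (hgrow n).2)
    exact mul_le_mul_of_nonneg_left (hgrow n).1 hm₂.le

end Choices

end StochasticIsland
end

noncomputable section

namespace StochasticIsland

open Filter Set

/-! ### Lyapunov exponents and entropy -/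

/-- If the norm were less than one, the powers would tend to zero while their determinants stay
equal to one. -/
theorem one_le_norm_of_det {L : Plane →L[ℝ] Plane} (h : L.det = 1) : 1 ≤ ‖L‖ := by
  by_contra! hlt
  have h1 : Tendsto (fun n : ℕ => L ^ n) atTop (𝓝 0) :=
    tendsto_pow_atTop_nhds_zero_of_norm_lt_one hlt
  have h2 := (ContinuousLinearMap.continuous_det.tendsto (0 : Plane →L[ℝ] Plane)).comp h1
  have h3 : ∀ n : ℕ, (L ^ n).det = 1 := by
    intro n
    induction n with
    | zero => exact LinearMap.det_id
    | succ k ih =>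
      rw [pow_succ]
      have : (L ^ k * L).det = (L ^ k).det * L.det := LinearMap.det_comp _ _
      rw [this, ih, h, one_mul]
  have h4 : (0 : Plane →L[ℝ] Plane).det = 0 := by
    change LinearMap.det (0 : Plane →ₗ[ℝ] Plane) = 0
    exact LinearMap.det_zero' (EuclideanSpace.basisFun (Fin 2) ℝ).toBasis
  rw [h4] at h2
  have h5 : Tendsto (fun _ : ℕ => (1 : ℝ)) atTop (𝓝 0) := h2.congr h3
  exact one_ne_zero (tendsto_nhds_unique tendsto_const_nhds h5)

theorem survivors_subset_disc (F : Plane → Plane) : survivors F ⊆ disc := fun _ hx => hx 0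

theorem map_mem_survivors {F : Plane → Plane} {x : Plane} (hx : x ∈ survivors F) :
    F x ∈ survivors F := fun n => hx (n + 1)

theorem iterDeriv_orbit {F : Plane → Plane} {x V : ℕ → Plane} (hx : ∀ n, F (x n) = x (n + 1))
    (hV : ∀ n, fderivWithin ℝ F disc (x n) (V n) = V (n + 1)) (n : ℕ) :
    ∀ k, iterDeriv F n (x k) (V k) = V (k + n) := by
  induction n with
  | zero => exact fun k => rfl
  | succ n ih =>
    intro k
    rw [iterDeriv, ContinuousLinearMap.comp_apply, hV, hx, ih, add_right_comm, add_assoc]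

/-! ### Bounds, measurability and integration of the exponents of a conservative map. -/

namespace IsConservative

variable {F : Plane → Plane}

theorem continuousOn_fderivWithin (hF : IsConservative F) :
    ContinuousOn (fderivWithin ℝ F disc) disc :=
  hF.smooth.continuousOn_fderivWithin uniqueDiffOn_disc (by norm_num)

theorem exists_norm_bound (hF : IsConservative F) :
    ∃ B : ℝ, 1 ≤ B ∧ ∀ n, ∀ x ∈ survivors F, ‖iterDeriv F n x‖ ≤ B ^ n := by
  obtain ⟨C, hC⟩ := (isCompact_closedBall (0 : Plane) 1).exists_bound_of_continuousOn
    hF.continuousOn_fderivWithin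
  have hB : 1 ≤ max 1 C := le_max_left _ _
  refine ⟨max 1 C, hB, fun n => ?_⟩
  induction n with
  | zero =>
    intro x _
    rw [pow_zero]
    exact ContinuousLinearMap.norm_id_le
  | succ n ih =>
    intro x hx
    rw [iterDeriv, pow_succ]
    refine (ContinuousLinearMap.opNorm_comp_le _ _).trans ?_
    exact mul_le_mul (ih _ (map_mem_survivors hx))
      ((hC x (survivors_subset_disc F hx)).trans (le_max_right _ _)) (norm_nonneg _) (by positivity)

theorem one_le_norm (hF : IsConservative F) (n : ℕ) : ∀ x ∈ survivors F, 1 ≤ ‖iterDeriv F n x‖ := by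
  have hdet : ∀ x ∈ survivors F, (iterDeriv F n x).det = 1 := by
    induction n with
    | zero => exact fun x _ => LinearMap.det_id
    | succ n ih =>
      intro x hx
      have : (iterDeriv F (n + 1) x).det =
          (iterDeriv F n (F x)).det * (fderivWithin ℝ F disc x).det := LinearMap.det_comp _ _
      rw [this, ih _ (map_mem_survivors hx), hF.area x (survivors_subset_disc F hx), one_mul]
  exact fun x hx => one_le_norm_of_det (hdet x hx)

/-- A real `limsup` is meaningful only for bounded sequences. The upper bound comes from compactness
of the disc, the lower one from area preservation. -/
theorem exists_exponent_bound (hF : IsConservative F) : ∃ b : ℝ, ∀ x ∈ survivors F, ∀ n : ℕ,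
    0 ≤ (1 / (n : ℝ)) * Real.log ‖iterDeriv F n x‖ ∧
      (1 / (n : ℝ)) * Real.log ‖iterDeriv F n x‖ ≤ b := by
  obtain ⟨B, hB, h⟩ := hF.exists_norm_bound
  refine ⟨Real.log B, fun x hx n => ?_⟩
  have h1 := hF.one_le_norm n x hx
  refine ⟨mul_nonneg (by positivity) (Real.log_nonneg h1), ?_⟩
  -- For `n = 0` the quotient is zero, by the convention `1 / 0 = 0`.
  rcases Nat.eq_zero_or_pos n with h0 | h0
  · rw [h0]
    simpa using Real.log_nonneg hB
  · have h2 := Real.log_le_log (by linarith) (h n x hx)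
    rw [Real.log_pow] at h2
    rw [one_div, inv_mul_le_iff₀ (by exact_mod_cast h0)]
    exact h2

theorem lyapunov_mem_Icc (hF : IsConservative F) :
    ∃ b : ℝ, ∀ x ∈ survivors F, lyapunov F x ∈ Icc 0 b := by
  obtain ⟨b, hb⟩ := hF.exists_exponent_bound
  refine ⟨b, fun x hx => ⟨?_, ?_⟩⟩
  · exact le_limsup_of_frequently_le (Frequently.of_forall fun n => (hb x hx n).1)
      (isBoundedUnder_of ⟨b, fun n => (hb x hx n).2⟩)
  · exact limsup_le_of_le (isCoboundedUnder_le_of_le atTop fun n => (hb x hx n).1)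
      (.of_forall fun n => (hb x hx n).2)

theorem lyapunov_pos (hF : IsConservative F) {x : Plane} (hx : x ∈ survivors F) {m : ℝ} (hm : 0 < m)
    (h : ∃ᶠ n in atTop, m * 16 ^ n ≤ ‖iterDeriv F n x‖) : 0 < lyapunov F x := by
  obtain ⟨b, hb⟩ := hF.exists_exponent_bound
  refine (Real.log_pos one_lt_two).trans_le ?_
  refine le_limsup_of_frequently_le ?_ (isBoundedUnder_of ⟨b, fun n => (hb x hx n).2⟩)
  -- Half of the exponential rate absorbs the constant: `m · 16 ^ n ≥ 2 ^ n` once `8 ^ n ≥ 1 / m`,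
  -- which bounds the exponent below by `log 2`.
  have h8 : ∀ᶠ n : ℕ in atTop, 1 / m ≤ (8 : ℝ) ^ n :=
    (tendsto_pow_atTop_atTop_of_one_lt (by norm_num)).eventually_ge_atTop _
  refine (h.and_eventually (h8.and (eventually_gt_atTop 0))).mono ?_
  rintro n ⟨h1, h2, h3⟩
  have h4 : (2 : ℝ) ^ n ≤ ‖iterDeriv F n x‖ := by
    refine le_trans ?_ h1
    rw [div_le_iff₀ hm] at h2
    have e : (16 : ℝ) ^ n = 8 ^ n * 2 ^ n := by rw [← mul_pow]; norm_num
    rw [e]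
    nlinarith [pow_pos (two_pos : (0 : ℝ) < 2) n]
  have h5 := Real.log_le_log (by positivity) h4
  rw [Real.log_pow] at h5
  rw [one_div, le_inv_mul_iff₀ (by exact_mod_cast h3)]
  exact h5

/-- `F` is continuous only on the disc, so preimages are taken one step at a time inside it, and the
set is an intersection of finite-time conditions. -/
theorem isClosed_survivors (hF : IsConservative F) : IsClosed (survivors F) := by
  have hd : IsClosed disc := Metric.isClosed_closedBall
  have h : ∀ n : ℕ, IsClosed {x | ∀ k ≤ n, F^[k] x ∈ disc} := by
    intro n
    induction n with
    | zero =>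
      convert hd using 1
      ext x
      simp
    | succ n ih =>
      have : {x | ∀ k ≤ n + 1, F^[k] x ∈ disc} = disc ∩ F ⁻¹' {x | ∀ k ≤ n, F^[k] x ∈ disc} := by
        ext x
        constructor
        · exact fun hx => ⟨hx 0 (Nat.zero_le _), fun k hk => hx (k + 1) (by omega)⟩
        · rintro ⟨h0, h1⟩ k hk
          cases k with
          | zero => exact h0
          | succ k => exact h1 k (by omega)
      rw [this]
      exact hF.smooth.continuousOn.preimage_isClosed_of_isClosed hd ih
  have : survivors F = ⋂ n : ℕ, {x | ∀ k ≤ n, F^[k] x ∈ disc} := by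
    ext x
    rw [mem_iInter]
    exact ⟨fun hx n k _ => hx k, fun hx n => hx n n le_rfl⟩
  rw [this]
  exact isClosed_iInter h

theorem continuousOn_iterDeriv (hF : IsConservative F) (n : ℕ) :
    ContinuousOn (iterDeriv F n) (survivors F) := by
  induction n with
  | zero => exact continuousOn_const
  | succ n ih =>
    have hs := survivors_subset_disc F
    have h1 : ContinuousOn (fun x => iterDeriv F n (F x)) (survivors F) :=
      ih.comp (hF.smooth.continuousOn.mono hs) fun x hx => map_mem_survivors hx
    exact h1.clm_comp (hF.continuousOn_fderivWithin.mono hs)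

theorem aestronglyMeasurable_lyapunov (hF : IsConservative F) :
    MeasureTheory.AEStronglyMeasurable (lyapunov F)
      (MeasureTheory.volume.restrict (survivors F)) := by
  classical
  have hS := hF.isClosed_survivors.measurableSet
  let f : ℕ → Plane → ℝ := fun n => (survivors F).indicator
    fun x => (1 / (n : ℝ)) * Real.log ‖iterDeriv F n x‖
  have hf : ∀ n, Measurable (f n) := by
    intro n
    have h1 : ContinuousOn (fun x => (1 / (n : ℝ)) * Real.log ‖iterDeriv F n x‖) (survivors F) :=
      continuousOn_const.mul ((hF.continuousOn_iterDeriv n).norm.log fun x hx =>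
        (zero_lt_one.trans_le (hF.one_le_norm n x hx)).ne')
    have h2 := h1.measurable_piecewise (g := fun _ => (0 : ℝ)) continuousOn_const hS
    convert h2 using 1
    exact (piecewise_eq_indicator (f := fun x => (1 / (n : ℝ)) * Real.log ‖iterDeriv F n x‖)).symm
  have hlim : Measurable fun x => limsup (fun n => f n x) atTop := Measurable.limsup hf
  refine hlim.aestronglyMeasurable.congr ?_
  filter_upwards [MeasureTheory.ae_restrict_mem hS] with x hx
  simp only [f, indicator_of_mem hx]
  rfl

/-- The exponent is nonnegative and bounded on a set of finite measure, hence integrable; a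
nonnegative integrand that is positive on a nonempty open set has positive integral. -/
theorem metricEntropy_pos (hF : IsConservative F) {I : Set Plane} (hI : IsOpen I) (hne : I.Nonempty)
    (hs : I ⊆ survivors F) (hpos : ∀ x ∈ I, 0 < lyapunov F x) : 0 < metricEntropy F := by
  have hS := hF.isClosed_survivors.measurableSet
  obtain ⟨b, hb⟩ := hF.lyapunov_mem_Icc
  have hfin : MeasureTheory.volume (survivors F) < ⊤ :=
    (MeasureTheory.measure_mono (survivors_subset_disc F)).trans_lt
      (isCompact_closedBall (0 : Plane) 1).measure_lt_top
  have hintg : MeasureTheory.IntegrableOn (lyapunov F) (survivors F) := by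
    have : MeasureTheory.IsFiniteMeasure (MeasureTheory.volume.restrict (survivors F)) :=
      ⟨by simpa using hfin⟩
    refine MeasureTheory.Integrable.of_bound hF.aestronglyMeasurable_lyapunov b ?_
    filter_upwards [MeasureTheory.ae_restrict_mem hS] with x hx
    rw [Real.norm_of_nonneg (hb x hx).1]
    exact (hb x hx).2
  rw [metricEntropy, MeasureTheory.setIntegral_pos_iff_support_of_nonneg_ae _ hintg]
  · refine (hI.measure_pos MeasureTheory.volume hne).trans_le (MeasureTheory.measure_mono ?_)
    exact fun x hx => ⟨(hpos x hx).ne', hs hx⟩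
  · filter_upwards [MeasureTheory.ae_restrict_mem hS] with x hx
    exact (hb x hx).1

end IsConservative

theorem IsBiLink.isHeteroclinicLink {F : Plane → Plane} {P Q : Plane} {L : Set Plane}
    (h : IsBiLink F P Q L) : IsHeteroclinicLink F 2 L := by
  obtain ⟨h1, h2, h3, h4, h5, h6, h7, h8⟩ := h
  refine ⟨h1, ⟨1, one_pos, by simpa using h2⟩, ![P, Q], fun _ => 1, ?_, ?_, ?_⟩
  · intro a b hab
    fin_cases a <;> fin_cases b
    · rfl
    · exact absurd hab h3
    · exact absurd hab.symm h3
    · rfl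
  · intro j
    fin_cases j
    · exact ⟨h6, h4⟩
    · exact ⟨h7, h5⟩
  · intro x hx
    rcases h8 hx with h | h
    · exact mem_iUnion.2 ⟨0, Or.inr h⟩
    · exact mem_iUnion.2 ⟨1, Or.inl h⟩

namespace Choices

variable (c : Choices)

/-- The lifted orbit and its tangent vectors, pushed forward by `τ ∘ chi`, are an orbit of `F` and
of its derivative inside the open disc. The growth from `frequently_bound` survives because the
differential of `τ` loses at most a factor two. -/
theorem image_isl_expanding {F : Plane → Plane} (hF : IsConservative F) (τ : Plane ≃ₜ Plane)
    (hτ : ∀ x, DifferentiableAt ℝ τ x ∧ ∀ v, ‖v‖ ≤ 2 * ‖fderiv ℝ τ x v‖)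
    (hinner : ∀ x ∈ c.clIsl, τ x ∈ interior disc)
    (hdiff : ∀ x ∈ c.clIsl, DifferentiableAt ℝ (fun y => τ.symm (F (τ y))) x)
    (hL : ∀ w ∉ halfLattice, Lifts c (fun y => τ.symm (F (τ y))) (1 / 2) w) :
    ∀ x ∈ τ '' c.isl, x ∈ survivors F ∧ 0 < lyapunov F x := by
  rintro _ ⟨_, ⟨w₀, hw, rfl⟩, rfl⟩
  obtain ⟨W, v, hW0, hv0, h⟩ := c.exists_orbit hL hw
  have hmem : ∀ n, c.chi (W n) ∈ c.clIsl := fun n => c.isl_subset_clIsl (c.chi_mem_isl (h n).1)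
  have hx : ∀ n, F (τ (c.chi (W n))) = τ (c.chi (W (n + 1))) := fun n => by
    rw [(h n).2.1, τ.apply_symm_apply]
  have hV : ∀ n, fderivWithin ℝ F disc (τ (c.chi (W n)))
      (fderiv ℝ τ (c.chi (W n)) (fderiv ℝ c.chi (W n) (v n))) =
      fderiv ℝ τ (c.chi (W (n + 1))) (fderiv ℝ c.chi (W (n + 1)) (v (n + 1))) := by
    intro n
    have hn := mem_interior_iff_mem_nhds.1 (hinner _ (hmem n))
    have hFd : DifferentiableAt ℝ F (τ (c.chi (W n))) :=
      (hF.smooth.contDiffAt hn).differentiableAt two_ne_zero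
    rw [fderivWithin_of_mem_nhds hn, (h n).2.2.1, (h n).2.1]
    have e1 := hFd.hasFDerivAt.comp _ (hτ (c.chi (W n))).1.hasFDerivAt
    have e2 := HasFDerivAt.comp (g := τ) (f := fun y => τ.symm (F (τ y))) (c.chi (W n))
      (hτ _).1.hasFDerivAt (hdiff _ (hmem n)).hasFDerivAt
    have e3 : (τ ∘ fun y => τ.symm (F (τ y))) = F ∘ τ := by
      ext1 y; exact τ.apply_symm_apply _
    rw [e3] at e2
    exact DFunLike.congr_fun (e1.unique e2) _
  have hsurv : τ (c.chi w₀) ∈ survivors F := by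
    intro n
    have hit : ∀ n, F^[n] (τ (c.chi w₀)) = τ (c.chi (W n)) := by
      intro n
      induction n with
      | zero => rw [hW0]; rfl
      | succ k ih => rw [Function.iterate_succ_apply', ih, hx]
    rw [hit]
    exact interior_subset (hinner _ (hmem n))
  refine ⟨hsurv, ?_⟩
  obtain ⟨m, hm, hfreq⟩ := c.frequently_bound hv0 (fun n => (h n).1) (fun n => (h n).2.2.2.1)
    fun n => (h n).2.2.2.2
  set V : ℕ → Plane := fun n => fderiv ℝ τ (c.chi (W n)) (fderiv ℝ c.chi (W n) (v n)) with hVd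
  have horb : ∀ n, iterDeriv F n (τ (c.chi w₀)) (V 0) = V n := by
    intro n
    have := iterDeriv_orbit (x := fun n => τ (c.chi (W n))) (V := V) hx hV n 0
    rwa [zero_add, hW0] at this
  -- The `2` is the loss through `τ`; `‖V 0‖ + 1` passes from the vector to the operator norm
  -- without division by zero.
  refine hF.lyapunov_pos hsurv (m := m / (2 * (‖V 0‖ + 1))) (by positivity) ?_
  refine hfreq.mono fun n hn => ?_
  have h1 : m * 16 ^ n ≤ 2 * ‖V n‖ := hn.trans ((hτ _).2 _)
  have h2 : ‖V n‖ ≤ ‖iterDeriv F n (τ (c.chi w₀))‖ * ‖V 0‖ := by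
    rw [← horb]; exact ContinuousLinearMap.le_opNorm _ _
  rw [div_mul_eq_mul_div, div_le_iff₀ (by positivity)]
  nlinarith [norm_nonneg (iterDeriv F n (τ (c.chi w₀)))]

end Choices

end StochasticIsland

end

/-! ### Proof of the proposition. -/

open StochasticIsland in
open Filter Set in
theorem proposition2p1 (c : Choices) :
    ∃ η : ℝ, 0 < η ∧ ∀ F : Plane → Plane, IsConservative F → C2Close η F c.map →
      ∀ P Q : Fin 4 → Plane,
        (∀ i, IsHyperbolicPeriodic F 1 (P i) ∧ dist (P i) (c.saddleP i) < η) →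
        (∀ i, IsHyperbolicPeriodic F 1 (Q i) ∧ dist (Q i) (c.saddleQ i) < η) →
        ∀ L : Fin 4 → Set Plane,
          (∀ i, IsBiLink F (P i) (Q i) (L i)) →
          (∀ i, CurveC2Close η (L i) (c.circle i)) →
            (∃ I : Set Plane, IsStochasticIsland F L I) ∧ 0 < metricEntropy F := by
  by_contra! hcon
  -- Failure for every `η` yields a sequence of counterexamples with `η = 1 / (n + 1)`, which
  -- converges to the model.
  choose F hF hclose P Q _ _ L hbi hcurve hfail using
    fun n : ℕ => hcon (1 / ((n : ℝ) + 1)) (by positivity)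
  choose γ γ1 γ2 γ3 γ4 γ5 using hcurve
  have hconv : ∀ x ∈ c.clIsl, Conv2 atTop F c.map x := fun x hx =>
    conv2_of_C2Close (fun n => (hF n).smooth) hclose (c.clIsl_subset_interior hx)
      (c.contDiffAt_map hx)
  obtain ⟨τ, hτ, hτ2, hH⟩ := c.exists_conjugacy hconv γ2 fun i t =>
    conv2_of_curve_close (fun n => γ1 n i) (c.contDiff_circle i) (fun n => γ5 n i) t
  -- Invariance of the links under `F` becomes invariance of the model circles under the conjugated
  -- maps.
  have hcirc : ∀ᶠ n in atTop, ∀ i t, ∃ t',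
      (τ n).symm (F n (τ n (c.circle i t))) = c.circle i t' := by
    filter_upwards [hτ] with n hn i t
    have h1 : F n (γ n i t) ∈ L n i := by
      have h2 : F n '' L n i = L n i := (hbi n i).2.1
      rw [← h2]
      exact ⟨_, γ4 n i ▸ mem_range_self t, rfl⟩
    rw [← γ4 n i] at h1
    obtain ⟨t', ht'⟩ := h1
    exact ⟨t', by rw [hn.1 i t, ← ht', ← hn.1 i t', Homeomorph.symm_apply_apply]⟩
  have hlift := c.lifts_all hH hcirc one_half_pos
  have hinner : ∀ᶠ n in atTop, ∀ x ∈ c.clIsl, τ n x ∈ interior disc :=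
    eventually_forall_mem_of_isCompact c.isCompact_clIsl (P := fun n x => τ n x ∈ interior disc)
      fun x hx => (hτ2 x).toConv1.conv.eventually
        (isOpen_interior.mem_nhds (c.clIsl_subset_interior hx))
  have hdiff := eventually_forall_mem_of_isCompact c.isCompact_clIsl
    (P := fun n x => DifferentiableAt ℝ (fun y => (τ n).symm (F n (τ n y))) x)
    fun x hx => (hH x hx).toConv1.diff
  -- One large index satisfies all conditions; the image of the model island under `τ n` is then a
  -- stochastic island for `F n`, against the choice of the sequence.
  obtain ⟨n, ⟨hn1, hn2⟩, hn3, hn4, hn5⟩ := (hτ.and (hlift.and (hinner.and hdiff))).exists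
  have hexp := c.image_isl_expanding (hF n) (τ n) hn2 hn4 hn5 hn3
  have hopen : IsOpen (τ n '' c.isl) := (τ n).isOpenMap _ c.isOpen_isl
  have hconn : IsConnected (τ n '' c.isl) :=
    c.isConnected_isl.image _ (τ n).continuous.continuousOn
  have hfront : frontier (τ n '' c.isl) = ⋃ i, L n i := by
    rw [← (τ n).image_frontier, c.frontier_isl, image_iUnion]
    refine iUnion_congr fun i => ?_
    rw [← range_comp, ← γ4 n i]
    exact congrArg range (funext fun t => hn1 i t)
  refine absurd (hfail n ⟨τ n '' c.isl, hopen, hconn, fun x hx => (hexp x hx).1,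
    fun i => ⟨2, (hbi n i).isHeteroclinicLink⟩, hfront, fun x hx => (hexp x hx).2⟩) (not_le.2 ?_)
  exact (hF n).metricEntropy_pos hopen hconn.nonempty (fun x hx => (hexp x hx).1)
    fun x hx => (hexp x hx).2
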